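/- All graphs are finite, simple and undirected. Fix $k$. An instance of $k$-MHE or $k$-MHV consists of a graph $G=(V,E)$, a partial vertex-coloring $c\colon S\to\{1,\dots,k\}$ with $S\subseteq V$, and an integer $\ell$. An extended full coloring of $c$ is a map $c'\colon V\to\{1,\dots,k\}$ that agrees with $c$ on $S$. Under $c'$, an edge is happy if its two endpoints have the same color, and a vertex is happy if it and all its neighbors have the same color. The problem $k$-MHE (Maximum Happy Edges) asks whether some extended full coloring of $c$ makes at least $\ell$ edges happy; $k$-MHV (Maximum Happy Vertices) asks whether some extended full coloring of $c$ makes at least $\ell$ vertices happy. Let $n'=|V\setminus S|$ be the number of uncolored vertices. A problem can be solved in time $O^*(g)$ if there are a deterministic random access machine (with logarithmic cost) and a polynomial $p$ such that the machine decides every instance $I$ of the problem correctly in time at most $g(I)\cdot p(|I|)$, where $|I|$ is the size of the instance in bits, with the graph given by its adjacency matrix and $\ell$ in binary. **Theorem.** For every $k\ge 3$, the problems $k$-MHE and $k$-MHV can be solved in time $O^*(2^{n'})$. For $k=3$, both problems can be solved in time $O^*(1.89^{n'})$. -/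

import Mathlib

/-! ### Random access machines with logarithmic cost -/

namespace RAM

/-- A machine state: directly addressed registers and an indirectly addressed memory; every cell
holds a natural number. A program mentions only finitely many registers. -/
structure State where
  reg : ℕ → ℕ
  mem : ℕ → ℕ

/-- Structured programs of a random access machine. -/
inductive Prog : Type
  /-- do nothing -/
  | skip : Prog
  /-- `x := c` -/
  | const (x c : ℕ) : Prog
  /-- `x := y + z` -/
  | add (x y z : ℕ) : Prog
  /-- `x := y - z`, or `0` if `y < z` -/
  | sub (x y z : ℕ) : Prog
  /-- `x := y * z` -/
  | mul (x y z : ℕ) : Prog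
  /-- `x := ⌊y / z⌋`, or `0` if `z = 0` -/
  | div (x y z : ℕ) : Prog
  /-- `x := mem[y]` -/
  | load (x y : ℕ) : Prog
  /-- `mem[x] := y` -/
  | store (x y : ℕ) : Prog
  /-- `P; Q` -/
  | seq (P Q : Prog) : Prog
  /-- `if x ≠ 0 then P else Q` -/
  | ite (x : ℕ) (P Q : Prog) : Prog
  /-- `while x ≠ 0 do P` -/
  | loop (x : ℕ) (P : Prog) : Prog

namespace State

/-- Write the value `a` into register `x`. -/
def setReg (s : State) (x a : ℕ) : State := { s with reg := Function.update s.reg x a }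

/-- Write the value `a` into the memory cell with address `i`. -/
def setMem (s : State) (i a : ℕ) : State := { s with mem := Function.update s.mem i a }

end State

/-- `Exec P s t s'`: started in state `s`, the program `P` halts in state `s'` after time `t`.
Time is measured by the logarithmic cost criterion: an elementary operation or test costs one unit
plus the binary lengths (`Nat.size`) of the numbers, addresses included, on which it operates. -/
inductive Exec : Prog → State → ℕ → State → Prop
  | skip (s : State) : Exec .skip s 1 s
  | const (s : State) (x c : ℕ) : Exec (.const x c) s (1 + Nat.size c) (s.setReg x c)
  | add (s : State) (x y z : ℕ) :
      Exec (.add x y z) s (1 + Nat.size (s.reg y) + Nat.size (s.reg z))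
        (s.setReg x (s.reg y + s.reg z))
  | sub (s : State) (x y z : ℕ) :
      Exec (.sub x y z) s (1 + Nat.size (s.reg y) + Nat.size (s.reg z))
        (s.setReg x (s.reg y - s.reg z))
  | mul (s : State) (x y z : ℕ) :
      Exec (.mul x y z) s (1 + Nat.size (s.reg y) + Nat.size (s.reg z))
        (s.setReg x (s.reg y * s.reg z))
  | div (s : State) (x y z : ℕ) :
      Exec (.div x y z) s (1 + Nat.size (s.reg y) + Nat.size (s.reg z))
        (s.setReg x (s.reg y / s.reg z))
  | load (s : State) (x y : ℕ) :
      Exec (.load x y) s (1 + Nat.size (s.reg y) + Nat.size (s.mem (s.reg y)))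
        (s.setReg x (s.mem (s.reg y)))
  | store (s : State) (x y : ℕ) :
      Exec (.store x y) s (1 + Nat.size (s.reg x) + Nat.size (s.reg y))
        (s.setMem (s.reg x) (s.reg y))
  | seq {P Q : Prog} {s s' s'' : State} {t t' : ℕ} (h : Exec P s t s') (h' : Exec Q s' t' s'') :
      Exec (.seq P Q) s (t + t') s''
  | ite_true {x : ℕ} {P Q : Prog} {s s' : State} {t : ℕ} (hx : s.reg x ≠ 0) (h : Exec P s t s') :
      Exec (.ite x P Q) s (1 + Nat.size (s.reg x) + t) s'
  | ite_false {x : ℕ} {P Q : Prog} {s s' : State} {t : ℕ} (hx : s.reg x = 0) (h : Exec Q s t s') :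
      Exec (.ite x P Q) s (1 + Nat.size (s.reg x) + t) s'
  | loop_stop {x : ℕ} {P : Prog} {s : State} (hx : s.reg x = 0) :
      Exec (.loop x P) s (1 + Nat.size (s.reg x)) s
  | loop_step {x : ℕ} {P : Prog} {s s' s'' : State} {t t' : ℕ} (hx : s.reg x ≠ 0)
      (h : Exec P s t s') (h' : Exec (.loop x P) s' t' s'') :
      Exec (.loop x P) s (1 + Nat.size (s.reg x) + t + t') s''

/-- The machine is deterministic: final state and running time are determined by the program and
the initial state. -/
theorem Exec.unique {P : Prog} {s s₁ : State} {t₁ : ℕ} (h₁ : Exec P s t₁ s₁) :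
    ∀ {t₂ : ℕ} {s₂ : State}, Exec P s t₂ s₂ → t₁ = t₂ ∧ s₁ = s₂ := by
  induction h₁ with
  | skip | const | add | sub | mul | div | load | store =>
    intro t₂ s₂ h₂
    cases h₂
    exact ⟨rfl, rfl⟩
  | seq _ _ ih ih' =>
    intro t₂ s₂ h₂
    cases h₂ with
    | seq k k' =>
      obtain ⟨rfl, rfl⟩ := ih k
      obtain ⟨rfl, rfl⟩ := ih' k'
      exact ⟨rfl, rfl⟩
  | ite_true hx _ ih =>
    intro t₂ s₂ h₂
    cases h₂ with
    | ite_true _ k =>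
      obtain ⟨rfl, rfl⟩ := ih k
      exact ⟨rfl, rfl⟩
    | ite_false hx' _ => exact absurd hx' hx
  | ite_false hx _ ih =>
    intro t₂ s₂ h₂
    cases h₂ with
    | ite_true hx' _ => exact absurd hx hx'
    | ite_false _ k =>
      obtain ⟨rfl, rfl⟩ := ih k
      exact ⟨rfl, rfl⟩
  | loop_stop hx =>
    intro t₂ s₂ h₂
    cases h₂ with
    | loop_stop _ => exact ⟨rfl, rfl⟩
    | loop_step hx' _ _ => exact absurd hx hx'
  | loop_step hx _ _ ih ih' =>
    intro t₂ s₂ h₂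
    cases h₂ with
    | loop_stop hx' => exact absurd hx' hx
    | loop_step _ k k' =>
      obtain ⟨rfl, rfl⟩ := ih k
      obtain ⟨rfl, rfl⟩ := ih' k'
      exact ⟨rfl, rfl⟩

/-- Initially the memory holds the input words in the cells `0, 1, 2, …`; all other cells and all
registers are `0`. -/
def init (w : List ℕ) : State where
  reg := fun _ => 0
  mem := fun i => w.getD i 0

/-- The size of an input in bits, counting one additional bit per word. -/
def inputSize (w : List ℕ) : ℕ := (w.map fun a => Nat.size a + 1).sum

open Classical in
/-- The program `P` decides the problem `yes` (on instances encoded by `encode`), in time at most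
`T x` on every instance `x`: it halts with register `0` equal to `1` on the yes-instances, and
equal to `0` on the no-instances. -/
def DecidesInTime {α : Type} (encode : α → List ℕ) (yes : α → Prop) (T : α → ℝ) (P : Prog) :
    Prop :=
  ∀ x : α, ∃ (t : ℕ) (s : State), Exec P (init (encode x)) t s ∧
    s.reg 0 = (if yes x then 1 else 0) ∧ (t : ℝ) ≤ T x

/-- The problem `yes` can be solved in time `O*(g)`, that is, in time `g(x) · poly(|x|)`, where
`|x|` is the size of the encoded instance `x`. -/
def SolvableInOStar {α : Type} (encode : α → List ℕ) (yes : α → Prop) (g : α → ℝ) : Prop :=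
  ∃ (P : Prog) (p : Polynomial ℕ),
    DecidesInTime encode yes (fun x => g x * (p.eval (inputSize (encode x)) : ℕ)) P

end RAM

/-! ### Happy colorings -/

namespace HappyColoring

/-- An edge is happy under a coloring if its endpoints have the same color. -/
def EdgeHappy {V C : Type} (c : V → C) (e : Sym2 V) : Prop :=
  ∀ u ∈ e, ∀ v ∈ e, c u = c v

/-- A vertex is happy under a coloring if it and all its neighbors have the same color. -/
def VertexHappy {V C : Type} (G : SimpleGraph V) (c : V → C) (v : V) : Prop :=
  ∀ u, G.Adj v u → c u = c v

/-- The number of happy edges. -/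
noncomputable def happyEdges {V C : Type} (G : SimpleGraph V) (c : V → C) : ℕ :=
  {e | e ∈ G.edgeSet ∧ EdgeHappy c e}.ncard

/-- The number of happy vertices. -/
noncomputable def happyVertices {V C : Type} (G : SimpleGraph V) (c : V → C) : ℕ :=
  {v | VertexHappy G c v}.ncard

/-- An instance of `k`-MHE or `k`-MHV: a finite simple graph, a partial coloring of its vertices
with `k` colors (`none` means uncolored), and an integer threshold. -/
structure Inst (k : ℕ) where
  n : ℕ
  graph : SimpleGraph (Fin n)
  precolor : Fin n → Option (Fin k)
  threshold : ℤ

namespace Inst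

variable {k : ℕ}

/-- `c` is an extended full coloring of the given partial coloring. -/
def Extends (I : Inst k) (c : Fin I.n → Fin k) : Prop :=
  ∀ v a, I.precolor v = some a → c v = a

/-- The number of uncolored vertices. -/
def uncolored (I : Inst k) : ℕ := (Finset.univ.filter fun v => I.precolor v = none).card

/-- The word that encodes an optional color: `0` for uncolored, `a + 1` for the color `a`. -/
def colorCode : Option (Fin k) → ℕ
  | none => 0
  | some a => a.val + 1

open Classical in
/-- The encoding of an instance: the number of vertices, the sign and the absolute value of the
threshold, the precolors of the vertices, and the adjacency matrix, row by row. -/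
noncomputable def encode (I : Inst k) : List ℕ :=
  [I.n, if I.threshold < 0 then 1 else 0, I.threshold.natAbs] ++
    (List.finRange I.n).map (fun v => colorCode (I.precolor v)) ++
    (List.finRange I.n).flatMap (fun u => (List.finRange I.n).map fun v =>
      if I.graph.Adj u v then 1 else 0)

end Inst

/-- `k`-MHE: is there an extended full coloring with at least `threshold` happy edges? -/
def MHE (k : ℕ) (I : Inst k) : Prop :=
  ∃ c : Fin I.n → Fin k, I.Extends c ∧ I.threshold ≤ (happyEdges I.graph c : ℤ)

/-- `k`-MHV: is there an extended full coloring with at least `threshold` happy vertices? -/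
def MHV (k : ℕ) (I : Inst k) : Prop :=
  ∃ c : Fin I.n → Fin k, I.Extends c ∧ I.threshold ≤ (happyVertices I.graph c : ℤ)

end HappyColoring

namespace RAM

/-! Both problems are instances of one: given a hypergraph with a partial vertex coloring, find an
extension with many monochromatic nonempty hyperedges. For MHE the hyperedges are the edges, for MHV
the closed neighborhoods (`happyEdges_eq_mono`, `happyVertices_eq_mono`). A nonempty hyperedge lies
inside at most one color class, so the value of a coloring is a sum over the colors of a function of
the respective class alone (`Hyper.mono_eq_sum`). This sum has to be maximized over the partitions
of the `N` uncolored vertices into `k` classes; let `m` be the number of hyperedges.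

For the bound `2 ^ N`, partitions are relaxed to covers by `k` sets. A class `X` is rewarded with
`(k * m + 1) * (N - |X|)`, so a cover that is not a partition loses more than all hyperedges
together can contribute (`Hyper.exists_cover_iff`). The weights become exponents of the base `2 ^ (k
* N + 1)`. Inclusion and exclusion turns the sum over all covers into an alternating sum, over the
subsets, of products of zeta transforms (`sum_powerset_prod_eq_sum_covers`). There are fewer covers
than the base, so comparing the sum with one power of the base tells whether a weight is reached
(`two_pow_le_sum_covers_iff`). The zeta transforms take `N` sweeps over `k * 2 ^ N` numbers with
polynomially many bits.

For three colors, some color is used on at most `N / 3` uncolored vertices, and there are at most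
`1.89 ^ N` such sets because `27 / 4 ≤ 1.89 ^ 3` (`card_smallSets_le`). Once this class is fixed,
the hyperedges that can get the second color and those that can get the third form a bipartite
conflict graph, and an independent set in it can be realized by one coloring
(`Hyper.exists_three_coloring_iff`). By König's theorem its maximum size is determined by a maximum
matching, which an auction finds in polynomial time (`Auction.exists_independent_iff`).

On the machine, most polynomial computations are single expressions with bounded sums and products.
One compiler handles them (`Expr.exec_compile`), and their running time is polynomial for syntactic
reasons (`Expr.polyBdd_tm`). The remaining programs are short sequences of assignments and counting
loops (`Triple.for_`), and `solvable_of_triple` converts their time bounds into the final statement.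
-/

theorem Exec.loop_zero {x : ℕ} {P : Prog} {s : State} (hx : s.reg x = 0) :
    Exec (.loop x P) s (1 + Nat.size (s.reg x)) s := by
  constructor
  exact hx

/-! ### Arithmetic expressions with bounded sums and products -/

/-- The binary operations of the machine. -/
inductive Op : Type
  | add | sub | mul | div

namespace Op

/-- The instruction for an operation. -/
def prog : Op → ℕ → ℕ → ℕ → Prog
  | add => .add
  | sub => .sub
  | mul => .mul
  | div => .div

/-- The function computed by an operation. -/
def fn : Op → ℕ → ℕ → ℕ
  | add => (· + ·)
  | sub => (· - ·)
  | mul => (· * ·)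
  | div => (· / ·)

theorem exec (o : Op) (s : State) (x y z : ℕ) :
    Exec (o.prog x y z) s (1 + Nat.size (s.reg y) + Nat.size (s.reg z))
      (s.setReg x (o.fn (s.reg y) (s.reg z))) := by
  cases o
  · exact .add ..
  · exact .sub ..
  · exact .mul ..
  · exact .div ..

end Op

/-- The abstract state of a program: scalar variables, four arrays, and the read-only input. -/
structure St where
  var : ℕ → ℕ
  arr : Fin 4 → ℕ → ℕ
  inp : ℕ → ℕ

namespace St

/-- Assign the value `a` to the variable `x`. -/
def setVar (σ : St) (x a : ℕ) : St := { σ with var := Function.update σ.var x a }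

/-- Assign the value `v` to the entry `i` of the array `a`. -/
def setArr (σ : St) (a : Fin 4) (i v : ℕ) : St :=
  { σ with arr := Function.update σ.arr a (Function.update (σ.arr a) i v) }

@[simp] theorem setVar_arr (σ : St) (x a : ℕ) : (σ.setVar x a).arr = σ.arr := rfl
@[simp] theorem setArr_var (σ : St) (a : Fin 4) (i v : ℕ) : (σ.setArr a i v).var = σ.var := rfl

theorem setVar_var (σ : St) (x a y : ℕ) :
    (σ.setVar x a).var y = if y = x then a else σ.var y := by
  simp [setVar, Function.update_apply]

theorem setArr_arr (σ : St) (a : Fin 4) (i v : ℕ) (b : Fin 4) (j : ℕ) :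
    (σ.setArr a i v).arr b j = if b = a ∧ j = i then v else σ.arr b j := by
  simp only [setArr, Function.update_apply]
  by_cases h : b = a
  · subst h; simp [Function.update_apply]
  · simp [h]

@[simp] theorem setVar_setVar (σ : St) (x a b : ℕ) :
    (σ.setVar x a).setVar x b = σ.setVar x b := by
  simp [setVar]

theorem setVar_self (σ : St) (x : ℕ) : σ.setVar x (σ.var x) = σ := by
  simp [setVar]

end St

/-- Expressions over variables, arrays and input, with bounded sums and products. -/
inductive Expr : Type
  | cst (n : ℕ) : Expr
  | var (x : ℕ) : Expr
  | op (o : Op) (a b : Expr) : Expr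
  /-- the input word with index `a` -/
  | inp (a : Expr) : Expr
  /-- the entry with index `i` of an array -/
  | arr (a : Fin 4) (i : Expr) : Expr
  /-- the sum, or the product if the flag is set, of `b` over all `x < a` -/
  | fold (isProd : Bool) (x : ℕ) (a b : Expr) : Expr

/-- The operation that a bounded sum or product iterates. -/
def bigOp (isProd : Bool) : Op := if isProd then .mul else .add

/-- The value of an empty sum or product. -/
def bigUnit (isProd : Bool) : ℕ := if isProd then 1 else 0

/-- A bounded sum or product. -/
def big (isProd : Bool) (n : ℕ) (f : ℕ → ℕ) : ℕ :=
  if isProd then ∏ i ∈ Finset.range n, f i else ∑ i ∈ Finset.range n, f i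

theorem big_zero (isProd : Bool) (f : ℕ → ℕ) (a : ℕ) :
    (bigOp isProd).fn a (big isProd 0 f) = a := by
  cases isProd <;> simp [big, bigOp, Op.fn]

/-- The compiled loop counts its index down, so the term with the largest index enters the
accumulator first. This identity preserves the invariant of that loop. -/
theorem big_succ (isProd : Bool) (f : ℕ → ℕ) (a n : ℕ) :
    (bigOp isProd).fn ((bigOp isProd).fn a (f n)) (big isProd n f) =
      (bigOp isProd).fn a (big isProd (n + 1) f) := by
  cases isProd
  · simp [big, bigOp, Op.fn, Finset.sum_range_succ]; ring
  · simp [big, bigOp, Op.fn, Finset.prod_range_succ]; ring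

theorem bigUnit_op (isProd : Bool) (a : ℕ) : (bigOp isProd).fn (bigUnit isProd) a = a := by
  cases isProd <;> simp [bigUnit, bigOp, Op.fn]

namespace Expr

/-- The value of an expression. -/
def eval : Expr → St → ℕ
  | cst n, _ => n
  | var x, σ => σ.var x
  | op o a b, σ => o.fn (a.eval σ) (b.eval σ)
  | inp a, σ => σ.inp (a.eval σ)
  | arr a i, σ => σ.arr a (i.eval σ)
  | fold isProd x a b, σ => big isProd (a.eval σ) fun i => b.eval (σ.setVar x i)

/-- Expressions whose value is polynomially bounded for syntactic reasons: the variables with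
index below `16` and the arrays other than `3` hold small numbers. -/
def small : Expr → Bool
  | cst _ => true
  | var x => decide (x < 16)
  | op .add a b => a.small && b.small
  | op .mul a b => a.small && b.small
  | op .sub a _ => a.small
  | op .div a _ => a.small
  | inp _ => false
  | arr a _ => decide (a ≠ 3)
  | fold isProd _ _ b => !isProd && b.small

/-- Sums and products range over small variables and have small bounds. -/
def ok : Expr → Bool
  | cst _ => true
  | var _ => true
  | op _ a b => a.ok && b.ok
  | inp a => a.ok
  | arr _ a => a.ok
  | fold _ x a b => decide (x < 16) && a.ok && a.small && b.ok

/-- A bound on small values, and on the binary logarithm of all values. -/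
def bd : Expr → ℕ → ℕ
  | cst n, _ => n
  | var _, s => s
  | op .add a b, s => a.bd s + b.bd s + 1
  | op .mul a b, s => a.bd s * b.bd s + a.bd s + b.bd s
  | op .sub a _, s => a.bd s
  | op .div a _, s => a.bd s
  | inp _, s => s
  | arr _ _, s => s
  | fold _ _ a b, s => a.bd s * (b.bd (s + a.bd s) + 1)

/-- A bound on the time needed to evaluate an expression. -/
def tm : Expr → ℕ → ℕ
  | cst n, _ => n + 1
  | var _, s => s + 3
  | op _ a b, s => a.tm s + b.tm s + a.bd s + b.bd s + 3
  | inp a, s => a.tm s + 2 * a.bd s + 3 * s + 20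
  | arr _ i, s => i.tm s + 10 * i.bd s + 10 * s + 100
  | fold isProd x a b, s => a.tm s + a.bd s * (b.tm (s + a.bd s) + 3 * a.bd s +
      (fold isProd x a b).bd s + b.bd (s + a.bd s) + 20) + 2 * s +
      (fold isProd x a b).bd s + a.bd s + 20

end Expr

/-- All variables, arrays and input words are bounded by `2 ^ s`, the small ones by `s`. -/
structure Bdd (s : ℕ) (σ : St) : Prop where
  var_small : ∀ x < 16, σ.var x ≤ s
  var_le : ∀ x, σ.var x ≤ 2 ^ s
  inp_le : ∀ i, σ.inp i ≤ 2 ^ s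
  arr_small : ∀ a i, a ≠ 3 → σ.arr a i ≤ s
  arr_le : ∀ a i, σ.arr a i ≤ 2 ^ s

theorem Bdd.mono {s s' : ℕ} {σ : St} (h : Bdd s σ) (hs : s ≤ s') : Bdd s' σ where
  var_small x hx := (h.var_small x hx).trans hs
  var_le x := (h.var_le x).trans (Nat.pow_le_pow_right two_pos hs)
  inp_le i := (h.inp_le i).trans (Nat.pow_le_pow_right two_pos hs)
  arr_small a i ha := (h.arr_small a i ha).trans hs
  arr_le a i := (h.arr_le a i).trans (Nat.pow_le_pow_right two_pos hs)

theorem Bdd.setVar {s : ℕ} {σ : St} (h : Bdd s σ) {x v : ℕ} (hv : v ≤ 2 ^ s)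
    (hv' : x < 16 → v ≤ s) : Bdd s (σ.setVar x v) where
  var_small y hy := by
    rw [St.setVar_var]; split_ifs with e
    · exact hv' (e ▸ hy)
    · exact h.var_small y hy
  var_le y := by
    rw [St.setVar_var]; split_ifs
    · exact hv
    · exact h.var_le y
  inp_le := h.inp_le
  arr_small := h.arr_small
  arr_le := h.arr_le

theorem Bdd.setSmall {s : ℕ} {σ : St} (h : Bdd s σ) {x v : ℕ} (hv : v ≤ s) :
    Bdd s (σ.setVar x v) :=
  h.setVar (hv.trans Nat.lt_two_pow_self.le) fun _ => hv

theorem Bdd.setArr {s : ℕ} {σ : St} (h : Bdd s σ) {a : Fin 4} {i v : ℕ} (hv : v ≤ 2 ^ s)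
    (hv' : a ≠ 3 → v ≤ s) : Bdd s (σ.setArr a i v) where
  var_small := h.var_small
  var_le := h.var_le
  inp_le := h.inp_le
  arr_small b j hb := by
    rw [St.setArr_arr]; split_ifs with e
    · exact hv' (e.1 ▸ hb)
    · exact h.arr_small b j hb
  arr_le b j := by
    rw [St.setArr_arr]; split_ifs
    · exact hv
    · exact h.arr_le b j

theorem two_pow_add_le (a b : ℕ) : 2 ^ a + 2 ^ b ≤ 2 ^ (a + b + 1) := by
  have h1 : 2 ^ a ≤ 2 ^ (a + b) := Nat.pow_le_pow_right two_pos (Nat.le_add_right _ _)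
  have h2 : 2 ^ b ≤ 2 ^ (a + b) := Nat.pow_le_pow_right two_pos (Nat.le_add_left _ _)
  rw [pow_succ]; omega

theorem size_le_of_le_two_pow {v b : ℕ} (h : v ≤ 2 ^ b) : Nat.size v ≤ b + 1 :=
  Nat.size_le.2 (h.trans_lt (Nat.pow_lt_pow_right one_lt_two (Nat.lt_succ_self b)))

theorem bigOp_le (isProd : Bool) {u v a b : ℕ} (hu : u ≤ 2 ^ a) (hv : v ≤ 2 ^ b) :
    (bigOp isProd).fn u v ≤ 2 ^ (a + b + 1) := by
  cases isProd
  · exact (Nat.add_le_add hu hv).trans (two_pow_add_le a b)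
  · refine (Nat.mul_le_mul hu hv).trans ?_
    rw [← pow_add]
    exact Nat.pow_le_pow_right two_pos (Nat.le_succ _)

/-- Each further term lengthens the result by at most `b + 1` bits, whether it is added or
multiplied, so one exponent serves both flags. -/
theorem big_le (isProd : Bool) (f : ℕ → ℕ) (b : ℕ) :
    ∀ n, (∀ i < n, f i ≤ 2 ^ b) → big isProd n f ≤ 2 ^ (n * (b + 1))
  | 0, _ => by cases isProd <;> simp [big]
  | n + 1, h => by
    have h1 : big isProd (n + 1) f = (bigOp isProd).fn (big isProd n f) (f n) := by
      cases isProd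
      · simp [big, bigOp, Op.fn, Finset.sum_range_succ]
      · simp [big, bigOp, Op.fn, Finset.prod_range_succ]
    rw [h1]
    refine (bigOp_le isProd (big_le isProd f b n fun i hi => h i (by omega))
      (h n (by omega))).trans ?_
    exact Nat.pow_le_pow_right two_pos (by ring_nf; omega)

namespace Expr

/-- The two bounds need each other: the range of a fold must be small in value, since it counts
iterations, whereas the body of a fold only needs few bits. -/
theorem eval_le (e : Expr) : ∀ {s : ℕ} {σ : St}, e.ok = true → Bdd s σ →
    e.eval σ ≤ 2 ^ e.bd s ∧ (e.small = true → e.eval σ ≤ e.bd s) := by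
  induction e with
  | cst n => intro s σ _ _; exact ⟨Nat.lt_two_pow_self.le, fun _ => le_rfl⟩
  | var x =>
    intro s σ _ h
    exact ⟨h.var_le x, fun hx => h.var_small x (by simpa [small] using hx)⟩
  | op o a b iha ihb =>
    intro s σ hok h
    simp only [ok, Bool.and_eq_true] at hok
    obtain ⟨a1, a2⟩ := iha hok.1 h
    obtain ⟨b1, b2⟩ := ihb hok.2 h
    cases o
    · refine ⟨(Nat.add_le_add a1 b1).trans (two_pow_add_le _ _), fun hs => ?_⟩
      simp only [small, Bool.and_eq_true] at hs
      have := a2 hs.1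
      have := b2 hs.2
      simp only [eval, Op.fn, bd]
      omega
    · exact ⟨(Nat.sub_le _ _).trans a1, fun hs => (Nat.sub_le _ _).trans (a2 hs)⟩
    · refine ⟨(Nat.mul_le_mul a1 b1).trans ?_, fun hs => ?_⟩
      · rw [← pow_add]
        exact Nat.pow_le_pow_right two_pos (by simp only [bd]; omega)
      · simp only [small, Bool.and_eq_true] at hs
        have := Nat.mul_le_mul (a2 hs.1) (b2 hs.2)
        simp only [eval, Op.fn, bd]
        omega
    · exact ⟨(Nat.div_le_self _ _).trans a1, fun hs => (Nat.div_le_self _ _).trans (a2 hs)⟩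
  | inp a _ => intro s σ _ h; exact ⟨h.inp_le _, fun hs => by simp [small] at hs⟩
  | arr a i _ =>
    intro s σ _ h
    exact ⟨h.arr_le _ _, fun hs => h.arr_small _ _ (by simpa [small] using hs)⟩
  | fold isProd x a b iha ihb =>
    intro s σ hok h
    simp only [ok, Bool.and_eq_true, decide_eq_true_eq] at hok
    obtain ⟨⟨⟨hx, hoka⟩, hsa⟩, hokb⟩ := hok
    have ha := (iha hoka h).2 hsa
    -- The fold variable runs up to the value of `a`, which may exceed `s`; hence the body is
    -- bounded with the parameter `s + a.bd s`.
    have hb : ∀ i < a.eval σ, Bdd (s + a.bd s) (σ.setVar x i) := fun i hi =>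
      (h.mono (Nat.le_add_right _ _)).setSmall (by omega)
    refine ⟨?_, fun hs => ?_⟩
    · refine (big_le isProd _ _ _ fun i hi => (ihb hokb (hb i hi)).1).trans ?_
      exact Nat.pow_le_pow_right two_pos (Nat.mul_le_mul_right _ ha)
    · simp only [small, Bool.and_eq_true, Bool.not_eq_true'] at hs
      obtain ⟨rfl, hs⟩ := hs
      refine (Finset.sum_le_card_nsmul _ _ (b.bd (s + a.bd s)) fun i hi =>
        (ihb hokb (hb i (Finset.mem_range.1 hi))).2 hs).trans ?_
      simp only [Finset.card_range, smul_eq_mul, bd]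
      exact Nat.mul_le_mul ha (Nat.le_succ _)

end Expr

/-! ### Compilation of expressions -/

/-- The machine state `st` represents the abstract state `σ`: even registers hold the variables,
register `1` holds the length `D` of the input, and the arrays are interleaved behind the input. -/
structure Rep (D : ℕ) (st : State) (σ : St) : Prop where
  var : ∀ x, st.reg (2 * x) = σ.var x
  len : st.reg 1 = D
  inp : ∀ i < D, st.mem i = σ.inp i
  inp_zero : ∀ i, D ≤ i → σ.inp i = 0
  arr : ∀ (a : Fin 4) i, st.mem (D + (4 * i + a)) = σ.arr a i

/-- The registers for temporary values. -/
def tmp (d : ℕ) : ℕ := 2 * d + 3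

theorem setReg_reg (s : State) (x a y : ℕ) :
    (s.setReg x a).reg y = if y = x then a else s.reg y := by
  simp [State.setReg, Function.update_apply]

theorem Rep.setTmp {D : ℕ} {st : State} {σ : St} (h : Rep D st σ) (d v : ℕ) :
    Rep D (st.setReg (tmp d) v) σ where
  var x := by rw [setReg_reg, if_neg (by unfold tmp; omega), h.var]
  len := by rw [setReg_reg, if_neg (by unfold tmp; omega), h.len]
  inp := h.inp
  inp_zero := h.inp_zero
  arr := h.arr

theorem Rep.setVar {D : ℕ} {st : State} {σ : St} (h : Rep D st σ) (x v : ℕ) :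
    Rep D (st.setReg (2 * x) v) (σ.setVar x v) where
  var y := by
    rw [setReg_reg, St.setVar_var, h.var]
    by_cases e : y = x <;> simp [e]
  len := by rw [setReg_reg, if_neg (by omega), h.len]
  inp := h.inp
  inp_zero := h.inp_zero
  arr := h.arr

/-- Copy register `y` to register `x ≠ y`. -/
def Prog.mov (x y : ℕ) : Prog := .seq (.const x 0) (.add x y x)

theorem Exec.mov (s : State) {x y : ℕ} (h : y ≠ x) :
    Exec (Prog.mov x y) s (Nat.size (s.reg y) + 2) (s.setReg x (s.reg y)) := by
  have := Exec.seq (Exec.const s x 0) (Exec.add (s.setReg x 0) x y x)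
  have e1 : (s.setReg x 0).reg y + (s.setReg x 0).reg x = s.reg y := by
    simp [setReg_reg, h]
  have e2 : (s.setReg x 0).setReg x (s.reg y) = s.setReg x (s.reg y) := by
    simp [State.setReg]
  rw [e1, e2] at this
  refine (congrArg (fun t => Exec (Prog.mov x y) s t _) ?_).mp this
  simp [setReg_reg, h]
  ring

/-- Turn the array index in temporary register `d` into a memory address. -/
def Prog.addr (a : Fin 4) (d : ℕ) : Prog :=
  .seq (.add (tmp d) (tmp d) (tmp d)) <| .seq (.add (tmp d) (tmp d) (tmp d)) <|
    .seq (.const (tmp (d + 1)) a) <| .seq (.add (tmp d) (tmp d) (tmp (d + 1))) <|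
      .add (tmp d) 1 (tmp d)

/-- The code that evaluates an expression into temporary register `d`. -/
def Expr.compile : Expr → ℕ → Prog
  | .cst n, d => .const (tmp d) n
  | .var x, d => .mov (tmp d) (2 * x)
  | .op o a b, d => .seq (a.compile d) <| .seq (b.compile (d + 1)) <|
      o.prog (tmp d) (tmp d) (tmp (d + 1))
  | .inp a, d => .seq (a.compile d) <| .seq (.sub (tmp (d + 1)) 1 (tmp d)) <|
      .ite (tmp (d + 1)) (.load (tmp d) (tmp d)) (.const (tmp d) 0)
  | .arr a i, d => .seq (i.compile d) <| .seq (.addr a d) <| .load (tmp d) (tmp d)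
  | .fold isProd x a b, d => .seq (a.compile d) <| .seq (.mov (tmp (d + 1)) (2 * x)) <|
      .seq (.const (tmp (d + 2)) (bigUnit isProd)) <|
      .seq (.loop (tmp d) <| .seq (.const (tmp (d + 3)) 1) <|
        .seq (.sub (tmp d) (tmp d) (tmp (d + 3))) <| .seq (.mov (2 * x) (tmp d)) <|
        .seq (b.compile (d + 3)) <|
          (bigOp isProd).prog (tmp (d + 2)) (tmp (d + 2)) (tmp (d + 3))) <|
      .seq (.mov (2 * x) (tmp (d + 1))) <| .mov (tmp d) (tmp (d + 2))

theorem tmp_inj {a b : ℕ} : tmp a = tmp b ↔ a = b := by unfold tmp; omega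

theorem tmp_ne_even (d x : ℕ) : tmp d ≠ 2 * x := by unfold tmp; omega

/-- The program `c` computes the value `v` into temporary register `d` in time `T`, and leaves
the variables, the arrays and the temporary registers below `d` alone. -/
def Computes (D : ℕ) (c : Prog) (d : ℕ) (st : State) (σ : St) (v T : ℕ) : Prop :=
  ∃ t st', Exec c st t st' ∧ t ≤ T ∧ Rep D st' σ ∧ st'.reg (tmp d) = v ∧
    ∀ j < d, st'.reg (tmp j) = st.reg (tmp j)

/-- Two doublings produce the factor 4 of the interleaving, and register `1` contributes the offset
that skips the input. -/
theorem exec_addr {D : ℕ} {st : State} {σ : St} (h : Rep D st σ) (a : Fin 4) {d B s : ℕ}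
    (hv : st.reg (tmp d) ≤ 2 ^ B) (hD : D ≤ 2 ^ s) :
    Computes D (.addr a d) d st σ (D + (4 * st.reg (tmp d) + a)) (8 * B + s + 50) := by
  set v := st.reg (tmp d) with hvdef
  have e1 := Exec.add st (tmp d) (tmp d) (tmp d)
  set s1 := st.setReg (tmp d) (st.reg (tmp d) + st.reg (tmp d)) with h1
  have e2 := Exec.add s1 (tmp d) (tmp d) (tmp d)
  set s2 := s1.setReg (tmp d) (s1.reg (tmp d) + s1.reg (tmp d)) with h2
  have e3 := Exec.const s2 (tmp (d + 1)) a
  set s3 := s2.setReg (tmp (d + 1)) a with h3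
  have e4 := Exec.add s3 (tmp d) (tmp d) (tmp (d + 1))
  set s4 := s3.setReg (tmp d) (s3.reg (tmp d) + s3.reg (tmp (d + 1))) with h4
  have e5 := Exec.add s4 (tmp d) 1 (tmp d)
  set s5 := s4.setReg (tmp d) (s4.reg 1 + s4.reg (tmp d)) with h5
  have r1 : s1.reg (tmp d) = v + v := by simp [h1, setReg_reg, hvdef]
  have r2 : s2.reg (tmp d) = (v + v) + (v + v) := by simp [h2, setReg_reg, r1]
  have r3 : s3.reg (tmp d) = (v + v) + (v + v) := by simp [h3, setReg_reg, r2, tmp_inj]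
  have r3' : s3.reg (tmp (d + 1)) = a := by simp [h3, setReg_reg]
  have r4 : s4.reg (tmp d) = (v + v) + (v + v) + a := by simp [h4, setReg_reg, r3, r3']
  have q5 : Rep D s4 σ := (((h.setTmp _ _).setTmp _ _).setTmp _ _).setTmp _ _
  have r4' : s4.reg 1 = D := q5.len
  refine ⟨_, s5, (e1.seq (e2.seq (e3.seq (e4.seq e5)))), ?_, q5.setTmp _ _, ?_, ?_⟩
  · rw [r1, r3, r3', r4, r4', ← hvdef]
    have k1 := size_le_of_le_two_pow hv
    have k2 : Nat.size (v + v) ≤ B + 1 + 1 := size_le_of_le_two_pow (by rw [pow_succ]; omega)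
    have k3 : Nat.size (v + v + (v + v)) ≤ B + 2 + 1 := size_le_of_le_two_pow (by
      rw [pow_add]; omega)
    have ha := a.isLt
    have k4 : Nat.size (a : ℕ) ≤ 2 + 1 := size_le_of_le_two_pow (by omega)
    have k5 : Nat.size (v + v + (v + v) + a) ≤ B + 3 + 1 := size_le_of_le_two_pow (by
      have := Nat.one_le_two_pow (n := B)
      rw [pow_add]; omega)
    have k6 := size_le_of_le_two_pow hD
    omega
  · rw [h5, setReg_reg, if_pos rfl, r4, r4']; ring
  · intro j hj
    have n1 : tmp j ≠ tmp d := by rw [Ne, tmp_inj]; omega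
    have n2 : tmp j ≠ tmp (d + 1) := by rw [Ne, tmp_inj]; omega
    simp only [h5, h4, h3, h2, h1, setReg_reg, if_neg n1, if_neg n2]

/-- The temporary registers act as a stack. A value at depth `d` survives the evaluation of further
operands because their code runs at a greater depth, and the last clause of `Computes` protects
everything below it. -/
theorem Expr.exec_compile (e : Expr) : ∀ {D s d : ℕ} {st : State} {σ : St}, e.ok = true →
    Bdd s σ → D ≤ 2 ^ s → Rep D st σ → Computes D (e.compile d) d st σ (e.eval σ) (e.tm s) := by
  induction e with
  | cst n =>
    intro D s d st σ _ _ _ h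
    refine ⟨_, _, .const .., ?_, h.setTmp _ _, by simp [setReg_reg, eval], fun j hj => ?_⟩
    · have := Nat.size_le.2 (Nat.lt_two_pow_self (n := n))
      simp only [tm]; omega
    · rw [setReg_reg, if_neg (by rw [tmp_inj]; omega)]
  | var x =>
    intro D s d st σ _ hb _ h
    refine ⟨_, _, .mov _ (tmp_ne_even d x).symm, ?_, h.setTmp _ _,
      by simp [setReg_reg, eval, h.var], fun j hj => ?_⟩
    · have := size_le_of_le_two_pow (hb.var_le x)
      rw [h.var]; simp only [tm]; omega
    · rw [setReg_reg, if_neg (by rw [tmp_inj]; omega)]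
  | op o a b iha ihb =>
    intro D s d st σ hok hb hD h
    simp only [ok, Bool.and_eq_true] at hok
    obtain ⟨t1, s1, e1, ht1, h1, v1, f1⟩ := iha (d := d) hok.1 hb hD h
    obtain ⟨t2, s2, e2, ht2, h2, v2, f2⟩ := ihb (d := d + 1) hok.2 hb hD h1
    have v1' : s2.reg (tmp d) = a.eval σ := by rw [f2 d (by omega), v1]
    refine ⟨_, _, e1.seq (e2.seq (o.exec _ _ _ _)), ?_, h2.setTmp _ _, ?_, fun j hj => ?_⟩
    · have k1 := size_le_of_le_two_pow (eval_le a hok.1 hb).1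
      have k2 := size_le_of_le_two_pow (eval_le b hok.2 hb).1
      rw [v1', v2]; simp only [tm]; omega
    · simp [setReg_reg, eval, v1', v2]
    · rw [setReg_reg, if_neg (by rw [tmp_inj]; omega), f2 j (by omega), f1 j hj]
  | inp a iha =>
    intro D s d st σ hok hb hD h
    obtain ⟨t1, s1, e1, ht1, h1, v1, f1⟩ := iha (d := d) hok hb hD h
    have e2 := Exec.sub s1 (tmp (d + 1)) 1 (tmp d)
    have h2 := h1.setTmp (d + 1) (s1.reg 1 - s1.reg (tmp d))
    set s2 := s1.setReg (tmp (d + 1)) (s1.reg 1 - s1.reg (tmp d)) with hs2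
    have r2 : s2.reg (tmp (d + 1)) = D - a.eval σ := by simp [hs2, setReg_reg, h1.len, v1]
    have r2' : s2.reg (tmp d) = a.eval σ := by simp [hs2, setReg_reg, tmp_inj, v1]
    have k1 := size_le_of_le_two_pow (eval_le a hok hb).1
    have k2 := size_le_of_le_two_pow hD
    have k3 := size_le_of_le_two_pow ((Nat.sub_le D (a.eval σ)).trans hD)
    have f2 : ∀ j < d, s2.reg (tmp j) = st.reg (tmp j) := fun j hj => by
      rw [hs2, setReg_reg, if_neg (by rw [tmp_inj]; omega), f1 j hj]
    rw [h1.len, v1] at e2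
    -- Cells from `D` on belong to the arrays, so an index beyond the input must yield `0` without a
    -- memory access.
    by_cases hc : D ≤ a.eval σ
    · refine ⟨_, _, e1.seq (e2.seq (.ite_false (by rw [r2]; omega) (.const _ (tmp d) 0))), ?_,
        h2.setTmp _ _, ?_, fun j hj => ?_⟩
      · rw [r2]; simp only [tm, Nat.size_zero]; omega
      · rw [setReg_reg, if_pos rfl, eval, h.inp_zero _ hc]
      · rw [setReg_reg, if_neg (by rw [tmp_inj]; omega), f2 j hj]
    · refine ⟨_, _, e1.seq (e2.seq (.ite_true (by rw [r2]; omega)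
        (.load _ (tmp d) (tmp d)))), ?_, h2.setTmp _ _, ?_, fun j hj => ?_⟩
      · rw [r2, r2', h2.inp _ (by omega)]
        have := size_le_of_le_two_pow (hb.inp_le (a.eval σ))
        simp only [tm]; omega
      · rw [setReg_reg, if_pos rfl, r2', h2.inp _ (by omega), eval]
      · rw [setReg_reg, if_neg (by rw [tmp_inj]; omega), f2 j hj]
  | arr a i ih =>
    intro D s d st σ hok hb hD h
    obtain ⟨t1, s1, e1, ht1, h1, v1, f1⟩ := ih (d := d) hok hb hD h
    have kv := (eval_le i hok hb).1
    obtain ⟨t2, s2, e2, ht2, h2, v2, f2⟩ := exec_addr h1 a (by rw [v1]; exact kv) hD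
    rw [v1] at v2
    refine ⟨_, _, e1.seq (e2.seq (.load _ (tmp d) (tmp d))), ?_, h2.setTmp _ _, ?_,
      fun j hj => ?_⟩
    · rw [v2, h2.arr]
      have k1 := size_le_of_le_two_pow (hb.arr_le a (i.eval σ))
      have k2 : Nat.size (D + (4 * i.eval σ + a)) ≤ s + (i.bd s + 3) + 1 + 1 :=
        size_le_of_le_two_pow ((Nat.add_le_add hD (by
          have := Nat.one_le_two_pow (n := i.bd s)
          have := a.isLt
          rw [pow_add]; omega)).trans (two_pow_add_le _ _))
      simp only [tm]; omega
    · rw [setReg_reg, if_pos rfl, v2, h2.arr, eval]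
    · rw [setReg_reg, if_neg (by rw [tmp_inj]; omega), f2 j hj, f1 j hj]
  | fold isProd x a b iha ihb =>
    intro D s d st σ hok hb hD h
    have hok' := hok
    simp only [ok, Bool.and_eq_true, decide_eq_true_eq] at hok
    obtain ⟨⟨⟨hx, hoka⟩, hsa⟩, hokb⟩ := hok
    obtain ⟨t1, s1, e1, ht1, h1, v1, f1⟩ := iha (d := d) hoka hb hD h
    have ha := (eval_le a hoka hb).2 hsa
    have e2 := Exec.mov s1 (tmp_ne_even (d + 1) x).symm
    have h2 := h1.setTmp (d + 1) (s1.reg (2 * x))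
    set s2 := s1.setReg (tmp (d + 1)) (s1.reg (2 * x)) with hs2
    have e3 := Exec.const s2 (tmp (d + 2)) (bigUnit isProd)
    have h3 := h2.setTmp (d + 2) (bigUnit isProd)
    set s3 := s2.setReg (tmp (d + 2)) (bigUnit isProd) with hs3
    set β := b.bd (s + a.bd s) with hβ
    set G := (fold isProd x a b).bd s with hG
    set body : Prog := .seq (.const (tmp (d + 3)) 1) <|
        .seq (.sub (tmp d) (tmp d) (tmp (d + 3))) <| .seq (.mov (2 * x) (tmp d)) <|
        .seq (b.compile (d + 3)) <|
          (bigOp isProd).prog (tmp (d + 2)) (tmp (d + 2)) (tmp (d + 3)) with hbody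
    set C := b.tm (s + a.bd s) + 3 * a.bd s + G + β + 20 with hC
    -- With `j` iterations to go, the accumulator is at most `2 ^ K`. Every iteration may add `β +
    -- 1` to this exponent, and `K + j * (β + 1) ≤ G` says that the budget `G` suffices. The value
    -- `y` of the fold variable is arbitrary because each iteration overwrites it.
    have loop : ∀ j K acc y st, j ≤ a.eval σ → acc ≤ 2 ^ K → K + j * (β + 1) ≤ G →
        Rep D st (σ.setVar x y) → st.reg (tmp d) = j → st.reg (tmp (d + 2)) = acc →
        ∃ t st' y', Exec (.loop (tmp d) body) st t st' ∧ t ≤ j * C + a.bd s + 2 ∧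
          Rep D st' (σ.setVar x y') ∧
          st'.reg (tmp (d + 2)) =
            (bigOp isProd).fn acc (big isProd j fun i => b.eval (σ.setVar x i)) ∧
          ∀ i < d + 2, i ≠ d → st'.reg (tmp i) = st.reg (tmp i) := by
      intro j
      induction j with
      | zero =>
        intro K acc y st _ _ _ hr hj hacc
        refine ⟨_, st, y, .loop_zero hj, ?_, hr, by rw [big_zero, hacc], fun _ _ _ => rfl⟩
        rw [hj, Nat.size_zero]; omega
      | succ j ihj =>
        intro K acc y st hjle hK hKG hr hj hacc
        have g1 := Exec.const st (tmp (d + 3)) 1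
        have q1 := hr.setTmp (d + 3) 1
        set u1 := st.setReg (tmp (d + 3)) 1 with hu1
        have g2 := Exec.sub u1 (tmp d) (tmp d) (tmp (d + 3))
        have r1 : u1.reg (tmp d) = j + 1 := by simp [hu1, setReg_reg, tmp_inj, hj]
        have r1' : u1.reg (tmp (d + 3)) = 1 := by simp [hu1, setReg_reg]
        rw [r1, r1', Nat.add_sub_cancel] at g2
        have q2 := q1.setTmp d j
        set u2 := u1.setReg (tmp d) j with hu2
        have g3 := Exec.mov u2 (tmp_ne_even d x)
        have r2 : u2.reg (tmp d) = j := by simp [hu2, setReg_reg]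
        rw [r2] at g3
        have q3 := q2.setVar x j
        rw [St.setVar_setVar] at q3
        set u3 := u2.setReg (2 * x) j with hu3
        have hbj : Bdd (s + a.bd s) (σ.setVar x j) :=
          (hb.mono (Nat.le_add_right _ _)).setSmall (by omega)
        obtain ⟨t4, u4, g4, ht4, q4, v4, f4⟩ := ihb (d := d + 3) hokb hbj
          (hD.trans (Nat.pow_le_pow_right two_pos (Nat.le_add_right _ _))) q3
        have g5 := (bigOp isProd).exec u4 (tmp (d + 2)) (tmp (d + 2)) (tmp (d + 3))
        have r3 : ∀ i < d + 3, i ≠ d → u3.reg (tmp i) = st.reg (tmp i) := by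
          intro i hi hid
          rw [hu3, setReg_reg, if_neg (tmp_ne_even _ _), hu2, setReg_reg,
            if_neg (by rw [tmp_inj]; omega), hu1, setReg_reg, if_neg (by rw [tmp_inj]; omega)]
        have r3d : u3.reg (tmp d) = j := by
          rw [hu3, setReg_reg, if_neg (tmp_ne_even _ _), r2]
        have r4 : u4.reg (tmp (d + 2)) = acc := by
          rw [f4 _ (by omega), r3 _ (by omega) (by omega), hacc]
        have hval := (eval_le b hokb hbj).1
        rw [r4, v4] at g5
        have q5 := q4.setTmp (d + 2) ((bigOp isProd).fn acc (b.eval (σ.setVar x j)))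
        set u5 := u4.setReg (tmp (d + 2))
          ((bigOp isProd).fn acc (b.eval (σ.setVar x j))) with hu5
        obtain ⟨t6, u6, y', g6, ht6, q6, v6, f6⟩ := ihj (K + β + 1)
          ((bigOp isProd).fn acc (b.eval (σ.setVar x j))) j u5 (by omega)
          (bigOp_le isProd hK hval) (by rw [Nat.succ_mul] at hKG; omega) q5
          (by rw [hu5, setReg_reg, if_neg (by rw [tmp_inj]; omega), f4 _ (by omega), r3d])
          (by rw [hu5, setReg_reg, if_pos rfl])
        refine ⟨_, u6, y', .loop_step (by omega)
          (g1.seq (g2.seq (g3.seq (g4.seq g5)))) g6, ?_, q6, ?_, ?_⟩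
        · have k1 : Nat.size (j + 1) ≤ a.bd s + 1 :=
            size_le_of_le_two_pow ((hjle.trans ha).trans Nat.lt_two_pow_self.le)
          have k2 : Nat.size j ≤ a.bd s + 1 :=
            size_le_of_le_two_pow ((by omega : j ≤ a.bd s).trans Nat.lt_two_pow_self.le)
          have k3 : Nat.size acc ≤ G + 1 := size_le_of_le_two_pow
            (hK.trans (Nat.pow_le_pow_right two_pos (by omega)))
          have k4 := size_le_of_le_two_pow hval
          have k5 : (j + 1) * C = j * C + C := Nat.succ_mul _ _
          have k6 : Nat.size 1 = 1 := Nat.size_one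
          rw [hj, k6, k5]
          omega
        · rw [v6]
          exact big_succ isProd (fun i => b.eval (σ.setVar x i)) acc j
        · intro i hi hid
          rw [f6 i hi hid, hu5, setReg_reg, if_neg (by rw [tmp_inj]; omega), f4 _ (by omega),
            r3 _ (by omega) hid]
    have r3 : s3.reg (tmp d) = a.eval σ := by
      simp [hs3, hs2, setReg_reg, tmp_inj, v1]
    have r3' : s3.reg (tmp (d + 1)) = σ.var x := by
      simp [hs3, hs2, setReg_reg, tmp_inj, h1.var]
    -- The exponent starts at `0`, since the unit of either operation is at most `1`.
    obtain ⟨t4, s4, y, e4, ht4, h4, v4, f4⟩ := loop (a.eval σ) 0 (bigUnit isProd) (σ.var x) s3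
      le_rfl (by cases isProd <;> simp [bigUnit])
      (by rw [hG, bd, Nat.zero_add]; exact Nat.mul_le_mul_right _ ha)
      (by rw [St.setVar_self]; exact h3) r3 (by simp [hs3, setReg_reg])
    rw [bigUnit_op] at v4
    have r4 : s4.reg (tmp (d + 1)) = σ.var x := by rw [f4 _ (by omega) (by omega), r3']
    have e5 := Exec.mov s4 (tmp_ne_even (d + 1) x)
    -- Restoring the saved value of the fold variable makes the evaluation free of side effects on
    -- `σ`.
    have h5 := h4.setVar x (σ.var x)
    rw [r4] at e5
    rw [St.setVar_setVar, St.setVar_self] at h5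
    set s5 := s4.setReg (2 * x) (σ.var x) with hs5
    have e6 := Exec.mov s5 (x := tmp d) (y := tmp (d + 2)) (by rw [Ne, tmp_inj]; omega)
    have r5 : s5.reg (tmp (d + 2)) = (fold isProd x a b).eval σ := by
      rw [hs5, setReg_reg, if_neg (tmp_ne_even _ _), v4, eval]
    rw [r5] at e6
    refine ⟨_, _, e1.seq (e2.seq (e3.seq (e4.seq (e5.seq e6)))), ?_, h5.setTmp _ _, ?_,
      fun j hj => ?_⟩
    · have k1 := size_le_of_le_two_pow (hb.var_le x)
      have k2 := size_le_of_le_two_pow (eval_le _ hok' hb).1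
      have k3 : a.eval σ * C ≤ a.bd s * C := Nat.mul_le_mul_right _ ha
      have k4 : Nat.size (bigUnit isProd) ≤ 1 := by cases isProd <;> simp [bigUnit]
      have k5 : (fold isProd x a b).tm s = a.tm s + a.bd s * C + 2 * s + G + a.bd s + 20 := by
        rw [tm]
      rw [h1.var, k5]
      omega
    · rw [setReg_reg, if_pos rfl]
    · rw [setReg_reg, if_neg (by rw [tmp_inj]; omega), hs5, setReg_reg, if_neg (tmp_ne_even _ _),
        f4 j (by omega) (by omega), hs3, setReg_reg, if_neg (by rw [tmp_inj]; omega), hs2,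
        setReg_reg, if_neg (by rw [tmp_inj]; omega), f1 j hj]

end RAM

namespace RAM

/-! ### Polynomial bounds -/

/-- The function `f` is bounded by a polynomial. -/
def PolyBdd (f : ℕ → ℕ) : Prop := ∃ p : Polynomial ℕ, ∀ s, f s ≤ p.eval s

/-- All coefficients are natural numbers, so each monomial is monotone. This makes polynomial bounds
stable under composition. -/
theorem polynomial_eval_mono (p : Polynomial ℕ) {a b : ℕ} (h : a ≤ b) : p.eval a ≤ p.eval b := by
  rw [Polynomial.eval_eq_sum_range, Polynomial.eval_eq_sum_range]
  exact Finset.sum_le_sum fun i _ => Nat.mul_le_mul_left _ (Nat.pow_le_pow_left h i)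

namespace PolyBdd

theorem const (c : ℕ) : PolyBdd fun _ => c := ⟨.C c, fun s => by simp⟩

theorem id : PolyBdd fun s => s := ⟨.X, fun s => by simp⟩

theorem add {f g : ℕ → ℕ} : PolyBdd f → PolyBdd g → PolyBdd fun s => f s + g s
  | ⟨p, hp⟩, ⟨q, hq⟩ => ⟨p + q, fun s => by
    rw [Polynomial.eval_add]; exact Nat.add_le_add (hp s) (hq s)⟩

theorem mul {f g : ℕ → ℕ} : PolyBdd f → PolyBdd g → PolyBdd fun s => f s * g s
  | ⟨p, hp⟩, ⟨q, hq⟩ => ⟨p * q, fun s => by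
    rw [Polynomial.eval_mul]; exact Nat.mul_le_mul (hp s) (hq s)⟩

theorem comp {f g : ℕ → ℕ} : PolyBdd f → PolyBdd g → PolyBdd fun s => f (g s)
  | ⟨p, hp⟩, ⟨q, hq⟩ => ⟨p.comp q, fun s => by
    rw [Polynomial.eval_comp]; exact (hp _).trans (polynomial_eval_mono p (hq s))⟩

end PolyBdd

/-- A fold evaluates the bound of its body at `s + a.bd s`. The expression is fixed, so only a fixed
number of such compositions occurs. -/
theorem Expr.polyBdd_bd (e : Expr) : PolyBdd e.bd := by
  induction e with
  | cst n => exact .const n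
  | var x => exact .id
  | op o a b iha ihb =>
    cases o
    · exact (iha.add ihb).add (.const 1)
    · exact iha
    · exact ((iha.mul ihb).add iha).add ihb
    · exact iha
  | inp => exact .id
  | arr => exact .id
  | fold _ _ a b iha ihb => exact iha.mul ((ihb.comp (PolyBdd.id.add iha)).add (.const 1))

theorem Expr.polyBdd_tm (e : Expr) : PolyBdd e.tm := by
  induction e with
  | cst n => exact .const (n + 1)
  | var x => exact .add .id (.const 3)
  | op o a b iha ihb =>
    exact (((iha.add ihb).add a.polyBdd_bd).add b.polyBdd_bd).add (.const 3)
  | inp a iha =>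
    exact ((iha.add (.mul (.const 2) a.polyBdd_bd)).add (.mul (.const 3) .id)).add (.const 20)
  | arr a i ih =>
    exact ((ih.add (.mul (.const 10) i.polyBdd_bd)).add (.mul (.const 10) .id)).add (.const 100)
  | fold p x a b iha ihb =>
    have ha := a.polyBdd_bd
    have hb := b.polyBdd_bd.comp (PolyBdd.id.add ha)
    have hf := (fold p x a b).polyBdd_bd
    exact ((((iha.add (ha.mul (((((ihb.comp (PolyBdd.id.add ha)).add
      (.mul (.const 3) ha)).add hf).add hb).add (.const 20)))).add
      (.mul (.const 2) .id)).add hf).add ha).add (.const 20)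

/-! ### Commands -/

/-- Total correctness with a time bound, on the level of abstract states. -/
def Triple (D : ℕ) (c : Prog) (σ : St) (T : ℕ) (Q : St → Prop) : Prop :=
  ∀ st, Rep D st σ → ∃ t st' σ', Exec c st t st' ∧ t ≤ T ∧ Rep D st' σ' ∧ Q σ'

namespace Prog

/-- The assignment of an expression to a variable. -/
def assign (x : ℕ) (e : Expr) : Prog := .seq (e.compile 0) (.mov (2 * x) (tmp 0))

/-- The assignment of an expression to an array entry. -/
def write (a : Fin 4) (i e : Expr) : Prog :=
  .seq (i.compile 0) <| .seq (.addr a 0) <| .seq (e.compile 1) <| .store (tmp 0) (tmp 1)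

/-- Branching on the value of an expression. -/
def cond (e : Expr) (P Q : Prog) : Prog := .seq (e.compile 0) (.ite (tmp 0) P Q)

/-- Iteration over all values of the variable `x` below the value of the variable `y`. -/
def for_ (x y : ℕ) (P : Prog) : Prog :=
  .seq (.const (2 * x) 0) <| .seq (.sub (tmp 0) (2 * y) (2 * x)) <|
    .loop (tmp 0) <| .seq P <| .seq (.const (tmp 0) 1) <|
      .seq (.add (2 * x) (2 * x) (tmp 0)) (.sub (tmp 0) (2 * y) (2 * x))

end Prog

/-- Quotient and remainder modulo 4 recover the index and the array from an address behind the
input, so a write changes exactly one entry. -/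
theorem Rep.setArr {D : ℕ} {st : State} {σ : St} (h : Rep D st σ) (a : Fin 4) (i v : ℕ) :
    Rep D (st.setMem (D + (4 * i + a)) v) (σ.setArr a i v) where
  var := h.var
  len := h.len
  inp j hj := by
    simp only [State.setMem]
    rw [Function.update_of_ne (by omega)]
    exact h.inp j hj
  inp_zero := h.inp_zero
  arr b j := by
    rw [St.setArr_arr]
    simp only [State.setMem, Function.update_apply]
    rw [h.arr]
    have := a.isLt
    have := b.isLt
    congr 1
    rw [Fin.ext_iff]
    apply propext
    constructor <;> intro h <;> omega

namespace Triple

variable {D s : ℕ} {σ : St}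

theorem conseq {c : Prog} {T T' : ℕ} {Q Q' : St → Prop} (h : Triple D c σ T Q) (hT : T ≤ T')
    (hQ : ∀ σ', Q σ' → Q' σ') : Triple D c σ T' Q' := fun st hst => by
  obtain ⟨t, st', σ', h1, h2, h3, h4⟩ := h st hst
  exact ⟨t, st', σ', h1, h2.trans hT, h3, hQ _ h4⟩

theorem skip {Q : St → Prop} (h : Q σ) : Triple D .skip σ 1 Q :=
  fun st hst => ⟨1, st, σ, .skip st, le_rfl, hst, h⟩

theorem seq {P P' : Prog} {T T' : ℕ} {Q Q' : St → Prop} (h : Triple D P σ T Q)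
    (h' : ∀ σ', Q σ' → Triple D P' σ' T' Q') : Triple D (.seq P P') σ (T + T') Q' :=
  fun st hst => by
    obtain ⟨t, st', σ', h1, h2, h3, h4⟩ := h st hst
    obtain ⟨t', st'', σ'', k1, k2, k3, k4⟩ := h' σ' h4 st' h3
    exact ⟨_, st'', σ'', h1.seq k1, by omega, k3, k4⟩

theorem assign (hb : Bdd s σ) (hD : D ≤ 2 ^ s) (x : ℕ) {e : Expr} (he : e.ok = true)
    {Q : St → Prop} (hQ : Q (σ.setVar x (e.eval σ))) :
    Triple D (.assign x e) σ (e.tm s + e.bd s + 3) Q := fun st hst => by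
  obtain ⟨t, s1, e1, ht, h1, v1, -⟩ := e.exec_compile (d := 0) he hb hD hst
  have e2 := Exec.mov s1 (tmp_ne_even 0 x)
  rw [v1] at e2
  have k := size_le_of_le_two_pow (e.eval_le he hb).1
  exact ⟨_, _, _, e1.seq e2, by omega, h1.setVar x _, hQ⟩

theorem write (hb : Bdd s σ) (hD : D ≤ 2 ^ s) (a : Fin 4) {i e : Expr} (hi : i.ok = true)
    (he : e.ok = true) {Q : St → Prop} (hQ : Q (σ.setArr a (i.eval σ) (e.eval σ))) :
    Triple D (.write a i e) σ (i.tm s + e.tm s + 9 * i.bd s + e.bd s + 2 * s + 70) Q :=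
  fun st hst => by
    obtain ⟨t1, s1, e1, ht1, h1, v1, -⟩ := i.exec_compile (d := 0) hi hb hD hst
    have ki := (i.eval_le hi hb).1
    obtain ⟨t2, s2, e2, ht2, h2, v2, -⟩ := exec_addr h1 a (by rw [v1]; exact ki) hD
    obtain ⟨t3, s3, e3, ht3, h3, v3, f3⟩ := e.exec_compile (d := 1) he hb hD h2
    have e4 := Exec.store s3 (tmp 0) (tmp 1)
    rw [f3 0 one_pos, v2, v1, v3] at e4
    refine ⟨_, _, _, e1.seq (e2.seq (e3.seq e4)), ?_, h3.setArr a _ _, hQ⟩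
    have k1 := size_le_of_le_two_pow (e.eval_le he hb).1
    have k2 : Nat.size (D + (4 * i.eval σ + a)) ≤ s + (i.bd s + 3) + 1 + 1 :=
      size_le_of_le_two_pow ((Nat.add_le_add hD (by
        have := Nat.one_le_two_pow (n := i.bd s)
        have := a.isLt
        rw [pow_add]; omega)).trans (two_pow_add_le _ _))
    omega

theorem cond (hb : Bdd s σ) (hD : D ≤ 2 ^ s) {e : Expr} (he : e.ok = true) {P P' : Prog}
    {T : ℕ} {Q : St → Prop} (h : e.eval σ ≠ 0 → Triple D P σ T Q)
    (h' : e.eval σ = 0 → Triple D P' σ T Q) :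
    Triple D (.cond e P P') σ (e.tm s + e.bd s + 2 + T) Q := fun st hst => by
  obtain ⟨t, s1, e1, ht, h1, v1, -⟩ := e.exec_compile (d := 0) he hb hD hst
  have k := size_le_of_le_two_pow (e.eval_le he hb).1
  by_cases hc : e.eval σ = 0
  · obtain ⟨t2, s2, σ2, e2, ht2, h2, q⟩ := h' hc s1 h1
    exact ⟨_, s2, σ2, e1.seq (.ite_false (by rw [v1, hc]) e2), by rw [v1]; omega, h2, q⟩
  · obtain ⟨t2, s2, σ2, e2, ht2, h2, q⟩ := h hc s1 h1
    exact ⟨_, s2, σ2, e1.seq (.ite_true (by rw [v1]; exact hc) e2), by rw [v1]; omega, h2, q⟩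

/-- The invariant `I i` refers to the state in which the counter already holds `i`, which explains
the assignments in `h0` and in the postcondition. The number of rounds may be exponential in `s`:
only its binary length enters the cost of a single round. -/
theorem for_ {x y : ℕ} (hxy : x ≠ y) {P : Prog} {T cnt : ℕ} (hcnt : σ.var y = cnt)
    (hs : cnt ≤ 2 ^ s) (I : ℕ → St → Prop) (h0 : I 0 (σ.setVar x 0))
    (hstep : ∀ i < cnt, ∀ σ', I i σ' → σ'.var x = i → σ'.var y = cnt →
      Triple D P σ' T fun σ'' =>
        σ''.var x = i ∧ σ''.var y = cnt ∧ I (i + 1) (σ''.setVar x (i + 1))) :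
    Triple D (.for_ x y P) σ (cnt * (T + 4 * s + 10) + 2 * s + 10) (I cnt) := fun st hst => by
  set body : Prog := .seq P <| .seq (.const (tmp 0) 1) <|
      .seq (.add (2 * x) (2 * x) (tmp 0)) (.sub (tmp 0) (2 * y) (2 * x)) with hbody
  have ksize : ∀ a ≤ cnt, Nat.size a ≤ s + 1 := fun a ha => size_le_of_le_two_pow (ha.trans hs)
  have loop : ∀ j i st σ', i + j = cnt → Rep D st σ' → I i σ' → σ'.var x = i →
      σ'.var y = cnt → st.reg (tmp 0) = j →
      ∃ t st' σ'', Exec (.loop (tmp 0) body) st t st' ∧ t ≤ j * (T + 4 * s + 10) + 1 ∧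
        Rep D st' σ'' ∧ I cnt σ'' := by
    intro j
    induction j with
    | zero =>
      intro i st σ' hi hr hI _ _ hj
      refine ⟨_, st, σ', .loop_zero hj, by rw [hj, Nat.size_zero]; omega, hr, ?_⟩
      rw [Nat.add_zero] at hi; rw [← hi]; exact hI
    | succ j ihj =>
      intro i st σ' hi hr hI hx hy hj
      obtain ⟨t1, s1, σ1, e1, ht1, h1, x1, y1, I1⟩ := hstep i (by omega) σ' hI hx hy st hr
      have e2 := Exec.const s1 (tmp 0) 1
      have h2 := h1.setTmp 0 1
      set s2 := s1.setReg (tmp 0) 1 with hs2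
      have e3 := Exec.add s2 (2 * x) (2 * x) (tmp 0)
      have r2 : s2.reg (tmp 0) = 1 := by simp [hs2, setReg_reg]
      rw [h2.var, x1, r2] at e3
      have h3 := h2.setVar x (i + 1)
      set s3 := s2.setReg (2 * x) (i + 1) with hs3
      have e4 := Exec.sub s3 (tmp 0) (2 * y) (2 * x)
      have vx : (σ1.setVar x (i + 1)).var x = i + 1 := by simp [St.setVar_var]
      have vy : (σ1.setVar x (i + 1)).var y = cnt := by simp [St.setVar_var, hxy.symm, y1]
      rw [h3.var, h3.var, vx, vy] at e4
      have h4 := h3.setTmp 0 (cnt - (i + 1))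
      obtain ⟨t5, s5, σ5, e5, ht5, h5, I5⟩ := ihj (i + 1) _ _ (by omega) h4 I1 vx vy
        (by rw [setReg_reg, if_pos rfl]; omega)
      refine ⟨_, s5, σ5, .loop_step (by omega) (e1.seq (e2.seq (e3.seq e4))) e5, ?_, h5, I5⟩
      have k1 := ksize (st.reg (tmp 0)) (by omega)
      have k2 := ksize i (by omega)
      have k3 := ksize cnt le_rfl
      have k4 := ksize (i + 1) (by omega)
      have k5 : Nat.size 1 = 1 := Nat.size_one
      rw [Nat.succ_mul]
      omega
  have e1 := Exec.const st (2 * x) 0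
  have h1 := hst.setVar x 0
  set s1 := st.setReg (2 * x) 0 with hs1
  have vx : (σ.setVar x 0).var x = 0 := by simp [St.setVar_var]
  have vy : (σ.setVar x 0).var y = cnt := by simp [St.setVar_var, hxy.symm, hcnt]
  have e2 := Exec.sub s1 (tmp 0) (2 * y) (2 * x)
  rw [h1.var, h1.var, vx, vy] at e2
  have h2 := h1.setTmp 0 (cnt - 0)
  obtain ⟨t3, s3, σ3, e3, ht3, h3, I3⟩ := loop cnt 0 _ _ (by omega) h2 h0 vx vy
    (by rw [setReg_reg, if_pos rfl]; omega)
  refine ⟨_, s3, σ3, e1.seq (e2.seq e3), ?_, h3, I3⟩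
  have k3 := ksize cnt le_rfl
  have k4 := ksize 0 (by omega)
  have k5 : Nat.size 0 = 0 := Nat.size_zero
  omega

end Triple

end RAM

namespace RAM

open Finset

/-! ### Logical connectives and counting -/

open Classical in
/-- The number of `i < n` that satisfy `P`. -/
noncomputable def count (n : ℕ) (P : ℕ → Prop) : ℕ := ((range n).filter P).card

theorem count_eq_card (n : ℕ) (P : ℕ → Prop) [DecidablePred P] :
    count n P = ((range n).filter P).card := by
  unfold count
  congr

theorem count_le (n : ℕ) (P : ℕ → Prop) : count n P ≤ n := by
  classical
  exact (card_filter_le _ _).trans (card_range n).le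

theorem count_congr {n : ℕ} {P Q : ℕ → Prop} (h : ∀ i < n, P i ↔ Q i) : count n P = count n Q := by
  classical
  exact congrArg card (filter_congr fun i hi => h i (mem_range.1 hi))

theorem count_succ (n : ℕ) (P : ℕ → Prop) [Decidable (P n)] :
    count (n + 1) P = count n P + if P n then 1 else 0 := by
  classical
  unfold count
  rw [range_add_one, filter_insert]
  split_ifs
  · rw [card_insert_of_notMem (by simp)]
  · rfl

namespace Expr

/-- An expression holds in a state if its value is not `0`. -/
def Holds (e : Expr) (σ : St) : Prop := e.eval σ ≠ 0

/-- Sum. -/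
abbrev add (a b : Expr) : Expr := .op .add a b
/-- Truncated difference. -/
abbrev sub (a b : Expr) : Expr := .op .sub a b
/-- Product, and conjunction. -/
abbrev mul (a b : Expr) : Expr := .op .mul a b
/-- Quotient. -/
abbrev div (a b : Expr) : Expr := .op .div a b
/-- Negation. -/
abbrev not (a : Expr) : Expr := .sub (.cst 1) a
/-- Disjunction. -/
abbrev or (a b : Expr) : Expr := .not (.not (.add a b))
/-- Comparison. -/
abbrev le (a b : Expr) : Expr := .not (.sub a b)
/-- Equality. -/
abbrev eq (a b : Expr) : Expr := .not (.add (.sub a b) (.sub b a))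
/-- Remainder. -/
abbrev mod (a b : Expr) : Expr := .sub a (.mul b (.div a b))
/-- Bounded existential quantifier. -/
abbrev ex (x : ℕ) (a b : Expr) : Expr := .not (.not (.fold false x a b))
/-- Bounded universal quantifier. -/
abbrev all (x : ℕ) (a b : Expr) : Expr := .not (.not (.fold true x a b))
/-- The number of `x < a` for which `b` holds. -/
abbrev num (x : ℕ) (a b : Expr) : Expr := .fold false x a (.not (.not b))
/-- Power of two. -/
abbrev two (a : Expr) : Expr := .fold true 15 a (.cst 2)
/-- The bit of `a` with index `j`. -/
abbrev bit (a j : Expr) : Expr := .not (.not (.mod (.div a (.two j)) (.cst 2)))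

variable (a b : Expr) (σ : St)

theorem eval_cst (n : ℕ) : (cst n).eval σ = n := rfl
theorem eval_var (x : ℕ) : (var x).eval σ = σ.var x := rfl
theorem eval_inp : (inp a).eval σ = σ.inp (a.eval σ) := rfl
theorem eval_arr (c : Fin 4) : (arr c a).eval σ = σ.arr c (a.eval σ) := rfl
theorem eval_add : (add a b).eval σ = a.eval σ + b.eval σ := rfl
theorem eval_sub : (sub a b).eval σ = a.eval σ - b.eval σ := rfl
theorem eval_mul : (mul a b).eval σ = a.eval σ * b.eval σ := rfl
theorem eval_div : (div a b).eval σ = a.eval σ / b.eval σ := rfl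
theorem eval_mod : (mod a b).eval σ = a.eval σ % b.eval σ := by
  rw [eval_sub, eval_mul, eval_div]
  have := Nat.mod_add_div (a.eval σ) (b.eval σ)
  omega

theorem eval_two : (two a).eval σ = 2 ^ a.eval σ := by simp [eval, big]

theorem eval_prod (x : ℕ) :
    (fold true x a b).eval σ = ∏ i ∈ range (a.eval σ), b.eval (σ.setVar x i) := by
  simp [eval, big]

theorem holds_not : (not a).Holds σ ↔ ¬ a.Holds σ := by
  simp only [Holds, eval_sub, eval_cst]; omega

theorem holds_mul : (mul a b).Holds σ ↔ a.Holds σ ∧ b.Holds σ := by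
  simp [Holds, eval_mul]

theorem holds_or : (or a b).Holds σ ↔ a.Holds σ ∨ b.Holds σ := by
  simp only [Holds, eval_sub, eval_cst, eval_add]; omega

theorem holds_le : (le a b).Holds σ ↔ a.eval σ ≤ b.eval σ := by
  simp only [Holds, eval_sub, eval_cst]; omega

theorem holds_eq : (eq a b).Holds σ ↔ a.eval σ = b.eval σ := by
  simp only [Holds, eval_sub, eval_cst, eval_add]; omega

theorem holds_ex (x : ℕ) :
    (ex x a b).Holds σ ↔ ∃ i < a.eval σ, b.Holds (σ.setVar x i) := by
  rw [holds_not, holds_not, not_not]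
  simp [Holds, eval, big, Finset.sum_eq_zero_iff]

theorem holds_all (x : ℕ) :
    (all x a b).Holds σ ↔ ∀ i < a.eval σ, b.Holds (σ.setVar x i) := by
  rw [holds_not, holds_not, not_not]
  simp [Holds, eval, big, Finset.prod_eq_zero_iff]

theorem holds_bit : (bit a b).Holds σ ↔ (a.eval σ).testBit (b.eval σ) = true := by
  rw [holds_not, holds_not, not_not, Holds, eval_mod, eval_div, eval_two, eval_cst,
    Nat.testBit_eq_decide_div_mod_eq, decide_eq_true_eq]
  omega

theorem eval_le_ite : (le a b).eval σ = if a.eval σ ≤ b.eval σ then 1 else 0 := by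
  rw [eval_sub, eval_cst, eval_sub]
  split_ifs <;> omega

open Classical in
theorem eval_not_eq : (not a).eval σ = if a.Holds σ then 0 else 1 := by
  rw [eval_sub, eval_cst]
  split_ifs with h
  · exact Nat.sub_eq_zero_of_le (Nat.one_le_iff_ne_zero.2 h)
  · rw [not_not.1 h]

theorem eval_num (x : ℕ) :
    (num x a b).eval σ = count (a.eval σ) fun i => b.Holds (σ.setVar x i) := by
  classical
  have h : ∀ i, (not (not b)).eval (σ.setVar x i) = if b.Holds (σ.setVar x i) then 1 else 0 := by
    intro i
    rw [eval_not_eq, holds_not]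
    by_cases hb : b.Holds (σ.setVar x i) <;> simp [hb]
  simp only [eval, big, Bool.false_eq_true, if_false, count] at h ⊢
  simp only [h, Finset.sum_boole, Nat.cast_id]

open Classical in
theorem eval_bit : (bit a b).eval σ = if (a.eval σ).testBit (b.eval σ) = true then 1 else 0 := by
  have := holds_bit a b σ
  rw [Holds] at this
  split_ifs with h
  · have h1 := this.2 h
    rw [eval_sub, eval_cst] at h1 ⊢
    omega
  · exact not_not.1 (mt this.1 h)

end Expr

end RAM

namespace HappyColoring

open Finset RAM

/-! ### Sets as bit masks -/

/-- The number whose binary digits indicate the set `S`. -/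
def code (S : Finset ℕ) : ℕ := ∑ i ∈ S, 2 ^ i

/-- The set of the binary digits of `q` with index below `N`. -/
def bits (N q : ℕ) : Finset ℕ := (range N).filter fun i => q.testBit i = true

theorem code_lt {N : ℕ} {S : Finset ℕ} (h : S ⊆ range N) : code S < 2 ^ N :=
  Nat.geomSum_lt le_rfl fun _ hi => mem_range.1 (h hi)

/-- Adding the elements in increasing order, each new power of two exceeds the sum of the earlier
ones, so no carry occurs. -/
theorem testBit_code (S : Finset ℕ) : ∀ t, (code S).testBit t = decide (t ∈ S) := by
  induction S using Finset.induction_on_max with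
  | empty => simp [code]
  | insert a S hlt ih =>
    intro t
    have ha : a ∉ S := fun h => lt_irrefl _ (hlt a h)
    have hc : code S < 2 ^ a := code_lt fun i hi => mem_range.2 (hlt i hi)
    have he : code (insert a S) = 2 ^ a + code S := by rw [code, sum_insert ha, code]
    rw [he]
    rcases lt_trichotomy t a with h | h | h
    · rw [Nat.testBit_two_pow_add_gt h, ih]
      simp [h.ne]
    · subst h
      rw [Nat.testBit_two_pow_add_eq, Nat.testBit_lt_two_pow hc]
      simp
    · have h1 : 2 ^ a + code S < 2 ^ t := calc
        2 ^ a + code S < 2 ^ (a + 1) := by rw [pow_succ]; omega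
        _ ≤ 2 ^ t := Nat.pow_le_pow_right two_pos h
      rw [Nat.testBit_lt_two_pow h1]
      have : t ∉ S := fun hs => absurd (hlt t hs) (by omega)
      simp [this, h.ne']

theorem bits_code {N : ℕ} {S : Finset ℕ} (h : S ⊆ range N) : bits N (code S) = S := by
  ext i
  simp only [bits, mem_filter, testBit_code, decide_eq_true_eq]
  exact ⟨fun h => h.2, fun hi => ⟨h hi, hi⟩⟩

theorem code_bits {N q : ℕ} (h : q < 2 ^ N) : code (bits N q) = q := by
  apply Nat.eq_of_testBit_eq
  intro i
  rw [testBit_code]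
  by_cases hi : i < N
  · simp [bits, hi]
  · rw [Nat.testBit_lt_two_pow (h.trans_le (Nat.pow_le_pow_right two_pos (not_lt.1 hi)))]
    simp [bits, hi]

theorem bits_subset (N q : ℕ) : bits N q ⊆ range N := filter_subset _ _

theorem count_testBit (N q : ℕ) : count N (fun i => q.testBit i = true) = (bits N q).card := by
  unfold count bits
  congr

theorem sum_range_two_pow {M : Type*} [AddCommMonoid M] (N : ℕ) (f : ℕ → M) :
    ∑ q ∈ range (2 ^ N), f q = ∑ S ∈ (range N).powerset, f (code S) := by
  refine sum_bij' (fun q _ => bits N q) (fun S _ => code S) ?_ ?_ ?_ ?_ ?_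
  · exact fun q _ => mem_powerset.2 (bits_subset N q)
  · exact fun S hS => mem_range.2 (code_lt (mem_powerset.1 hS))
  · exact fun q hq => code_bits (mem_range.1 hq)
  · exact fun S hS => bits_code (mem_powerset.1 hS)
  · exact fun q hq => by rw [code_bits (mem_range.1 hq)]

/-! ### The zeta transform -/

/-- The `j`-th stage of the zeta transform of `a`. -/
def zeta (a : ℕ → ℕ) : ℕ → ℕ → ℕ
  | 0, q => a q
  | j + 1, q => zeta a j q + if q.testBit j = true then zeta a j (q - 2 ^ j) else 0

theorem testBit_sub_two_pow {q j i : ℕ} (h : q.testBit j = true) (hi : i < j) :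
    (q - 2 ^ j).testBit i = q.testBit i := by
  have hq : 2 ^ j ≤ q := Nat.ge_two_pow_of_testBit h
  conv_rhs => rw [← Nat.add_sub_cancel' hq, Nat.testBit_two_pow_add_gt hi]

/-- Stage `j` lets every bit below `j` that is set in `q` be kept or cleared; `R` is the set of
cleared bits. -/
theorem zeta_eq_sum (a : ℕ → ℕ) (j : ℕ) : ∀ q,
    zeta a j q = ∑ R ∈ (bits j q).powerset, a (q - code R) := by
  induction j with
  | zero => intro q; simp [zeta, bits, code]
  | succ j ih =>
    intro q
    rw [zeta, ih]
    by_cases h : q.testBit j = true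
    · have hb : bits (j + 1) q = insert j (bits j q) := by
        rw [bits, range_add_one, filter_insert, if_pos h, bits]
      have hb' : bits j (q - 2 ^ j) = bits j q :=
        filter_congr fun i hi => by rw [testBit_sub_two_pow h (mem_range.1 hi)]
      rw [if_pos h, ih, hb, sum_powerset_insert (by simp [bits]), hb']
      congr 1
      refine sum_congr rfl fun R hR => ?_
      have hj : j ∉ R := fun hj => by simpa [bits] using mem_powerset.1 hR hj
      rw [code, code, sum_insert hj, Nat.sub_sub]
    · have hb : bits (j + 1) q = bits j q := by
        rw [bits, range_add_one, filter_insert, if_neg h, bits]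
      rw [if_neg h, hb, add_zero]

theorem zeta_le (a : ℕ → ℕ) (B j q : ℕ) (h : ∀ q' ≤ q, a q' ≤ B) : zeta a j q ≤ 2 ^ j * B := by
  rw [zeta_eq_sum]
  refine (sum_le_card_nsmul _ _ B fun R _ => h _ (Nat.sub_le _ _)).trans ?_
  rw [smul_eq_mul, card_powerset]
  refine Nat.mul_le_mul_right _ (Nat.pow_le_pow_right two_pos ?_)
  exact (card_le_card (bits_subset j q)).trans (card_range j).le

theorem code_sdiff {R S : Finset ℕ} (h : R ⊆ S) : code S = code (S \ R) + code R :=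
  (sum_sdiff h).symm

/-- The stages touch only the lowest `N` bits, so the multiple of `2 ^ N` is inert. Thus `k` tables
stored one after another are transformed simultaneously. The sum is reindexed from the cleared bits
to the kept ones by complementation in `S`. -/
theorem zeta_code (a : ℕ → ℕ) {N : ℕ} {S : Finset ℕ} (hS : S ⊆ range N) (i : ℕ) :
    zeta a N (i * 2 ^ N + code S) = ∑ R ∈ S.powerset, a (i * 2 ^ N + code R) := by
  have hb : bits N (i * 2 ^ N + code S) = S := by
    ext t
    simp only [bits, mem_filter, mem_range]
    rw [mul_comm, Nat.testBit_two_pow_mul_add _ (code_lt hS), testBit_code]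
    constructor
    · rintro ⟨h1, h2⟩
      simpa [h1] using h2
    · intro ht
      have := mem_range.1 (hS ht)
      simp [this, ht]
  rw [zeta_eq_sum, hb]
  refine sum_bij' (fun R _ => S \ R) (fun R _ => S \ R) ?_ ?_ ?_ ?_ ?_
  · exact fun R _ => mem_powerset.2 sdiff_subset
  · exact fun R _ => mem_powerset.2 sdiff_subset
  · exact fun R hR => Finset.sdiff_sdiff_eq_self (mem_powerset.1 hR)
  · exact fun R hR => Finset.sdiff_sdiff_eq_self (mem_powerset.1 hR)
  · intro R hR
    rw [code_sdiff (mem_powerset.1 hR)]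
    congr 1
    omega

/-! ### Inclusion and exclusion over covers -/

/-- The `k`-tuples of subsets of `U` that cover `U`. -/
def covers (k : ℕ) (U : Finset ℕ) : Finset (Fin k → Finset ℕ) :=
  (Fintype.piFinset fun _ => U.powerset).filter fun X => univ.biUnion X = U

theorem card_covers_le (k N : ℕ) : (covers k (range N)).card ≤ 2 ^ (k * N) := by
  refine (card_filter_le _ _).trans ?_
  rw [Fintype.card_piFinset]
  simp [← pow_mul, mul_comm]

/-- Complementation in `U` maps the sets between `V` and `U` to the subsets of `U \ V`, with the
sign becoming the parity of the complement. An alternating sum over a power set vanishes unless the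
ground set is empty. -/
theorem sum_Icc_neg_one_pow {U V : Finset ℕ} (hV : V ⊆ U) :
    ∑ S ∈ U.powerset.filter (V ⊆ ·), (-1 : ℤ) ^ (U.card + S.card) = if V = U then 1 else 0 := by
  have h : ∑ S ∈ U.powerset.filter (V ⊆ ·), (-1 : ℤ) ^ (U.card + S.card) =
      ∑ R ∈ (U \ V).powerset, (-1 : ℤ) ^ R.card := by
    refine sum_bij' (fun S _ => U \ S) (fun R _ => U \ R) ?_ ?_ ?_ ?_ ?_
    · intro S hS
      rw [mem_filter, mem_powerset] at hS
      exact mem_powerset.2 (sdiff_subset_sdiff Subset.rfl hS.2)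
    · intro R hR
      rw [mem_powerset] at hR
      rw [mem_filter, mem_powerset]
      refine ⟨sdiff_subset, fun v hv => mem_sdiff.2 ⟨hV hv, fun hr => ?_⟩⟩
      exact (mem_sdiff.1 (hR hr)).2 hv
    · intro S hS
      exact Finset.sdiff_sdiff_eq_self (mem_powerset.1 (mem_filter.1 hS).1)
    · intro R hR
      exact Finset.sdiff_sdiff_eq_self ((mem_powerset.1 hR).trans sdiff_subset)
    · intro S hS
      have hSU := mem_powerset.1 (mem_filter.1 hS).1
      have hc := card_sdiff_add_card_eq_card hSU
      rw [← hc, show (U \ S).card + S.card + S.card = (U \ S).card + 2 * S.card by ring, pow_add,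
        pow_mul]
      simp
  rw [h, sum_powerset_neg_one_pow_card]
  congr 1
  rw [sdiff_eq_empty_iff_subset]
  exact propext ⟨fun h => hV.antisymm h, fun h => h ▸ Subset.rfl⟩

/-- After the product is expanded, a tuple `X` contributes for each `S` that contains its union. By
`sum_Icc_neg_one_pow` the signs cancel unless this union is all of `U`. -/
theorem sum_powerset_prod_eq_sum_covers (k : ℕ) (U : Finset ℕ) (α : Fin k → Finset ℕ → ℤ) :
    ∑ S ∈ U.powerset, (-1 : ℤ) ^ (U.card + S.card) * ∏ i, ∑ R ∈ S.powerset, α i R =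
      ∑ X ∈ covers k U, ∏ i, α i (X i) := by
  have h1 : ∀ S ∈ U.powerset, (-1 : ℤ) ^ (U.card + S.card) * ∏ i, ∑ R ∈ S.powerset, α i R =
      ∑ X ∈ Fintype.piFinset fun _ : Fin k => U.powerset,
        if univ.biUnion X ⊆ S then (-1 : ℤ) ^ (U.card + S.card) * ∏ i, α i (X i) else 0 := by
    intro S hS
    rw [prod_univ_sum, mul_sum, ← sum_filter]
    refine sum_congr ?_ fun _ _ => rfl
    ext X
    simp only [Fintype.mem_piFinset, mem_powerset, mem_filter, biUnion_subset, mem_univ,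
      true_imp_iff]
    exact ⟨fun h => ⟨fun i => (h i).trans (mem_powerset.1 hS), h⟩, fun h => h.2⟩
  rw [sum_congr rfl h1, sum_comm, covers, sum_filter]
  refine sum_congr rfl fun X hX => ?_
  have hXU : univ.biUnion X ⊆ U := by
    simpa [biUnion_subset, Fintype.mem_piFinset] using hX
  rw [← sum_filter, ← sum_mul, sum_Icc_neg_one_pow hXU]
  split_ifs <;> simp

/-- The part of the alternating sum with even or odd index. -/
def altSum (k N : ℕ) (A : ℕ → ℕ) (p : ℕ) : ℕ :=
  ∑ Y ∈ (range (2 ^ N)).filter fun Y => (N + (bits N Y).card) % 2 = p,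
    ∏ i ∈ range k, A (i * 2 ^ N + Y)

/-- The machine has no negative numbers, so the terms of either sign are collected separately. The
integer difference is a sum of natural numbers, hence the truncated subtraction is exact. -/
theorem altSum_sub_altSum (k N : ℕ) (a : ℕ → ℕ) :
    altSum k N (zeta a N) 0 - altSum k N (zeta a N) 1 =
      ∑ X ∈ covers k (range N), ∏ i : Fin k, a (i * 2 ^ N + code (X i)) := by
  have h : (altSum k N (zeta a N) 0 : ℤ) - altSum k N (zeta a N) 1 =
      ∑ X ∈ covers k (range N), ∏ i : Fin k, (a (i * 2 ^ N + code (X i)) : ℤ) := by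
    rw [← sum_powerset_prod_eq_sum_covers k (range N)
      (fun i R => (a (i * 2 ^ N + code R) : ℤ))]
    have h0 : ∀ S ∈ (range N).powerset,
        (-1 : ℤ) ^ ((range N).card + S.card) *
          ∏ i : Fin k, ∑ R ∈ S.powerset, (a (i * 2 ^ N + code R) : ℤ) =
        (-1 : ℤ) ^ (N + (bits N (code S)).card) *
          ((∏ i ∈ range k, zeta a N (i * 2 ^ N + code S) : ℕ) : ℤ) := by
      intro S hS
      rw [bits_code (mem_powerset.1 hS), card_range, prod_range]
      simp only [zeta_code a (mem_powerset.1 hS)]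
      push_cast
      rfl
    rw [sum_congr rfl h0, ← sum_range_two_pow N fun Y => (-1 : ℤ) ^ (N + (bits N Y).card) *
          ((∏ i ∈ range k, zeta a N (i * 2 ^ N + Y) : ℕ) : ℤ)]
    rw [altSum, altSum, sum_filter, sum_filter]
    push_cast
    rw [← sum_sub_distrib]
    refine sum_congr rfl fun Y _ => ?_
    rcases Nat.mod_two_eq_zero_or_one (N + (bits N Y).card) with hp | hp
    · rw [Even.neg_one_pow (Nat.even_iff.2 hp)]
      simp [hp]
    · rw [Odd.neg_one_pow (Nat.odd_iff.2 hp)]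
      simp [hp]
  have h2 : (altSum k N (zeta a N) 0 : ℤ) = altSum k N (zeta a N) 1 +
      ((∑ X ∈ covers k (range N), ∏ i : Fin k, a (i * 2 ^ N + code (X i)) : ℕ) : ℤ) := by
    push_cast
    linarith
  have h3 : altSum k N (zeta a N) 0 = altSum k N (zeta a N) 1 +
      ∑ X ∈ covers k (range N), ∏ i : Fin k, a (i * 2 ^ N + code (X i)) := by
    exact_mod_cast h2
  omega

/-- There are fewer than `2 ^ b` covers, so those of weight below `T` together stay below `2 ^ (b *
T)`: no carry reaches the position of the threshold. -/
theorem two_pow_le_sum_covers_iff {k N b T : ℕ} (hb : k * N < b) (w : (Fin k → Finset ℕ) → ℕ) :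
    2 ^ (b * T) ≤ ∑ X ∈ covers k (range N), 2 ^ (b * w X) ↔
      ∃ X ∈ covers k (range N), T ≤ w X := by
  constructor
  · intro h
    by_contra! hlt
    have h1 : ∀ X ∈ covers k (range N), 2 ^ (b * w X) * 2 ^ b ≤ 2 ^ (b * T) := fun X hX => by
      rw [← pow_add, ← Nat.mul_succ]
      exact Nat.pow_le_pow_right two_pos (Nat.mul_le_mul_left _ (hlt X hX))
    have h2 := sum_le_card_nsmul _ _ _ h1
    rw [← sum_mul, smul_eq_mul] at h2
    have h3 : (covers k (range N)).card < 2 ^ b :=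
      (card_covers_le k N).trans_lt (Nat.pow_lt_pow_right one_lt_two hb)
    have h4 : 2 ^ (b * T) * 2 ^ b ≤ (covers k (range N)).card * 2 ^ (b * T) :=
      (Nat.mul_le_mul_right _ h).trans h2
    have h5 : 0 < 2 ^ (b * T) := by positivity
    nlinarith
  · rintro ⟨X, hX, hT⟩
    calc 2 ^ (b * T) ≤ 2 ^ (b * w X) :=
          Nat.pow_le_pow_right two_pos (Nat.mul_le_mul_left _ hT)
      _ ≤ _ := single_le_sum (f := fun X => 2 ^ (b * w X)) (fun _ _ => Nat.zero_le _) hX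

end HappyColoring

namespace HappyColoring

open Finset RAM

/-! ### Monochromatic hyperedges -/

/-- A hypergraph with vertices `v < n` and hyperedges `e < m`, and a partial vertex coloring, where
`0` means uncolored and `i + 1` stands for the color `i`. -/
structure Hyper where
  n : ℕ
  m : ℕ
  col : ℕ → ℕ
  mem : ℕ → ℕ → Prop

namespace Hyper

variable (d : Hyper)

/-- The number of uncolored vertices before `v`. -/
noncomputable def rank (v : ℕ) : ℕ := count v fun u => d.col u = 0

/-- The number of uncolored vertices. -/
noncomputable def free : ℕ := d.rank d.n

/-- The hyperedge `e` is nonempty. -/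
def Active (e : ℕ) : Prop := ∃ v < d.n, d.mem e v

/-- All vertices of the hyperedge `e` satisfy `P`. -/
def Within (P : ℕ → Prop) (e : ℕ) : Prop := ∀ v < d.n, d.mem e v → P v

/-- The number of nonempty hyperedges all of whose vertices satisfy `P`. -/
noncomputable def inside (P : ℕ → Prop) : ℕ := count d.m fun e => d.Active e ∧ d.Within P e

/-- The vertex `v` gets color `i` if the uncolored vertices in the mask `X` do. -/
def InClass (i X v : ℕ) : Prop := d.col v = i + 1 ∨ d.col v = 0 ∧ X.testBit (d.rank v) = true

/-- The full colorings that extend the partial coloring. -/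
def IsColoring (k : ℕ) (χ : ℕ → ℕ) : Prop :=
  ∀ v < d.n, χ v < k ∧ (d.col v ≠ 0 → χ v + 1 = d.col v)

/-- The number of nonempty monochromatic hyperedges. -/
noncomputable def mono (χ : ℕ → ℕ) : ℕ :=
  count d.m fun e => d.Active e ∧ ∃ i, d.Within (χ · = i) e

variable {d}

theorem rank_succ (v : ℕ) [Decidable (d.col v = 0)] :
    d.rank (v + 1) = d.rank v + if d.col v = 0 then 1 else 0 := count_succ ..

theorem rank_mono {u v : ℕ} (h : u ≤ v) : d.rank u ≤ d.rank v := by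
  induction v, h using Nat.le_induction with
  | base => exact le_rfl
  | succ v _ ih => rw [rank_succ]; omega

theorem rank_lt {u v : ℕ} (h : u < v) (hu : d.col u = 0) : d.rank u < d.rank v := by
  have h1 : d.rank (u + 1) ≤ d.rank v := rank_mono h
  have h2 := d.rank_succ u
  rw [if_pos hu] at h2
  exact lt_of_lt_of_le (by omega) h1

theorem rank_inj {u v : ℕ} (hu : d.col u = 0) (hv : d.col v = 0) (h : d.rank u = d.rank v) :
    u = v := by
  rcases lt_trichotomy u v with h1 | h1 | h1
  · exact absurd h (rank_lt h1 hu).ne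
  · exact h1
  · exact absurd h (rank_lt h1 hv).ne'

/-- Together with `rank_inj` this makes the rank a bijection from the uncolored vertices to the
numbers below `free`, so masks with `free` bits stand for sets of uncolored vertices. -/
theorem exists_rank_eq {j : ℕ} : ∀ n, j < d.rank n → ∃ v < n, d.col v = 0 ∧ d.rank v = j
  | 0, h => by simp [rank, count] at h
  | n + 1, h => by
    by_cases hj : j < d.rank n
    · obtain ⟨v, h1, h2⟩ := exists_rank_eq n hj
      exact ⟨v, by omega, h2⟩
    · rw [rank_succ] at h
      split_ifs at h with hc
      · exact ⟨n, by omega, hc, by omega⟩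
      · omega

theorem inside_le (P : ℕ → Prop) : d.inside P ≤ d.m := count_le _ _

theorem inside_congr {P Q : ℕ → Prop} (h : ∀ v < d.n, P v ↔ Q v) : d.inside P = d.inside Q :=
  count_congr fun _ _ => and_congr_right fun _ => forall₂_congr fun v hv =>
    imp_congr_right fun _ => h v hv

/-- A nonempty hyperedge cannot lie inside two color classes, so the sets counted on the right are
disjoint. An empty one would be counted once for each color, which is why only active hyperedges
count. -/
theorem mono_eq_sum {k : ℕ} {χ : ℕ → ℕ} (h : ∀ v < d.n, χ v < k) :
    d.mono χ = ∑ i ∈ range k, d.inside (χ · = i) := by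
  classical
  unfold mono inside count
  rw [← card_biUnion]
  · congr 1
    ext e
    simp only [mem_filter, mem_range, mem_biUnion]
    constructor
    · rintro ⟨he, ⟨v, hv, hev⟩, i, hi⟩
      exact ⟨i, by rw [← hi v hv hev]; exact h v hv, he, ⟨v, hv, hev⟩, hi⟩
    · rintro ⟨i, _, he, ha, hi⟩
      exact ⟨he, ha, i, hi⟩
  · intro i _ j _ hij
    rw [Function.onFun, disjoint_left]
    intro e h1 h2
    simp only [mem_filter] at h1 h2
    obtain ⟨-, ⟨v, hv, hev⟩, hi⟩ := h1
    exact hij ((hi v hv hev).symm.trans (h2.2.2 v hv hev))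

/-- The ranks of the uncolored vertices that get color `i`. -/
noncomputable def colorClass (d : Hyper) (χ : ℕ → ℕ) (i : ℕ) : Finset ℕ := by
  classical exact
    (range d.free).filter fun j => ∃ v < d.n, d.col v = 0 ∧ d.rank v = j ∧ χ v = i

theorem mem_colorClass {χ : ℕ → ℕ} {i v : ℕ} (hv : v < d.n) (hc : d.col v = 0) :
    d.rank v ∈ d.colorClass χ i ↔ χ v = i := by
  classical
  rw [colorClass, mem_filter]
  constructor
  · rintro ⟨-, u, -, hu, huv, rfl⟩
    rw [rank_inj hu hc huv]
  · exact fun h => ⟨mem_range.2 (rank_lt hv hc), v, hv, hc, rfl, h⟩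

theorem colorClass_subset (χ : ℕ → ℕ) (i : ℕ) : d.colorClass χ i ⊆ range d.free := by
  classical
  exact filter_subset _ _

theorem inClass_colorClass {k : ℕ} {χ : ℕ → ℕ} (hχ : d.IsColoring k χ) {i v : ℕ} (hv : v < d.n) :
    d.InClass i (code (d.colorClass χ i)) v ↔ χ v = i := by
  rw [InClass, testBit_code, decide_eq_true_eq]
  by_cases hc : d.col v = 0
  · rw [mem_colorClass hv hc]
    simp [hc]
  · have := (hχ v hv).2 hc
    simp only [hc, false_and, or_false]
    omega

theorem existsUnique_color {k : ℕ} {χ : ℕ → ℕ} (hχ : d.IsColoring k χ) {j : ℕ}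
    (hj : j < d.free) : ∃ i < k, ∀ i', j ∈ d.colorClass χ i' ↔ i' = i := by
  obtain ⟨v, hv, hc, rfl⟩ := exists_rank_eq _ hj
  exact ⟨χ v, (hχ v hv).1, fun i' => (mem_colorClass hv hc).trans eq_comm⟩

theorem sum_card_eq {k N : ℕ} {X : Fin k → Finset ℕ} (h : ∀ i, X i ⊆ range N) :
    ∑ i, (X i).card = ∑ j ∈ range N, (univ.filter fun i => j ∈ X i).card := by
  refine Eq.trans (sum_congr rfl fun i _ => congrArg card ?_)
    (sum_card_bipartiteAbove_eq_sum_card_bipartiteBelow fun (i : Fin k) j => j ∈ X i)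
  exact (filter_mem_eq_inter.trans (inter_eq_right.2 (h i))).symm

theorem sum_card_colorClass {k : ℕ} {χ : ℕ → ℕ} (hχ : d.IsColoring k χ) :
    ∑ i : Fin k, (d.colorClass χ i).card = d.free := by
  rw [sum_card_eq (X := fun i : Fin k => d.colorClass χ i) fun i => colorClass_subset χ i]
  have hone : ∀ j ∈ range d.free,
      (univ.filter fun i : Fin k => j ∈ d.colorClass χ i).card = 1 := by
    intro j hj
    obtain ⟨i, hi, h⟩ := existsUnique_color hχ (mem_range.1 hj)
    refine card_eq_one.2 ⟨⟨i, hi⟩, ?_⟩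
    ext i'
    simp [h, Fin.ext_iff]
  rw [sum_congr rfl hone]
  simp

/-- In a cover the class sizes add up to at least `free`, with equality exactly for partitions.
Hence the penalty terms reach `(k * d.m + 1) * ((k - 1) * d.free)` only for partitions, and a
deficit cannot be made up by the at most `k * d.m` units that the hyperedges contribute. -/
theorem exists_cover_iff {k : ℕ} (hk : 0 < k) (hcol : ∀ v < d.n, d.col v ≤ k) (ℓ : ℕ) :
    (∃ X ∈ covers k (range d.free), (k * d.m + 1) * ((k - 1) * d.free) + ℓ ≤
      ∑ i : Fin k, (d.inside (d.InClass i (code (X i))) +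
        (k * d.m + 1) * (d.free - (X i).card))) ↔
    ∃ χ, d.IsColoring k χ ∧ ℓ ≤ d.mono χ := by
  have hPQ : ∀ X : Fin k → Finset ℕ, (∀ i, X i ⊆ range d.free) →
      ∑ i, (d.free - (X i).card) + ∑ i, (X i).card = (k - 1) * d.free + d.free := by
    intro X hX
    have h1 : ∀ i, d.free - (X i).card + (X i).card = d.free := fun i =>
      Nat.sub_add_cancel ((card_le_card (hX i)).trans (card_range _).le)
    rw [← sum_add_distrib, sum_congr rfl fun i _ => h1 i, sum_const, card_univ, Fintype.card_fin,
      smul_eq_mul, ← Nat.succ_mul, Nat.succ_eq_add_one, Nat.sub_add_cancel hk]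
  constructor
  · rintro ⟨X, hX, hT⟩
    rw [covers, mem_filter, Fintype.mem_piFinset] at hX
    obtain ⟨hXs, hXU⟩ := hX
    replace hXs : ∀ i, X i ⊆ range d.free := fun i => mem_powerset.1 (hXs i)
    have hpq := hPQ X hXs
    rw [sum_add_distrib, ← mul_sum] at hT
    have hsum := sum_card_eq hXs
    have hone : ∀ j ∈ range d.free, 1 ≤ (univ.filter fun i => j ∈ X i).card := by
      intro j hj
      rw [← hXU] at hj
      obtain ⟨i, -, hi⟩ := mem_biUnion.1 hj
      exact card_pos.2 ⟨i, by simpa using hi⟩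
    have hge : d.free ≤ ∑ i, (X i).card := by
      rw [hsum]
      simpa using sum_le_sum hone
    have hf : ∑ i : Fin k, d.inside (d.InClass i (code (X i))) ≤ k * d.m := by
      refine (sum_le_card_nsmul _ _ d.m fun i _ => inside_le _).trans ?_
      simp
    -- One surplus element costs `k * d.m + 1`, which exceeds the bound `hf` on the rest of the
    -- weight.
    have heq : ∑ i, (X i).card = d.free := by
      by_contra hne
      have h1 : ∑ i, (d.free - (X i).card) + 1 ≤ (k - 1) * d.free := by omega
      have h2 := Nat.mul_le_mul_left (k * d.m + 1) h1
      rw [Nat.mul_succ] at h2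
      omega
    -- The penalty terms now cancel against the threshold. Since all multiplicities are at least one
    -- and their sum is `free`, each uncolored vertex lies in exactly one class.
    have hP : ∑ i, (d.free - (X i).card) = (k - 1) * d.free := by omega
    rw [hP] at hT
    have huniq : ∀ j ∈ range d.free, 1 = (univ.filter fun i => j ∈ X i).card := by
      refine (sum_eq_sum_iff_of_le hone).1 ?_
      rw [← hsum, heq]
      simp
    have hex : ∀ j, ∃ i : Fin k, j < d.free → ∀ i', j ∈ X i' ↔ i' = i := by
      intro j
      by_cases hj : j < d.free
      · obtain ⟨i, hi⟩ := card_eq_one.1 (huniq j (mem_range.2 hj)).symm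
        refine ⟨i, fun _ i' => ?_⟩
        rw [← mem_singleton, ← hi]
        simp
      · exact ⟨⟨0, hk⟩, fun h => absurd h hj⟩
    choose g hg using hex
    refine ⟨fun v => if d.col v = 0 then g (d.rank v) else d.col v - 1, ?_, ?_⟩
    · intro v hv
      by_cases hc : d.col v = 0
      · simp [hc]
      · simp only [hc, if_false]
        have := hcol v hv
        omega
    · rw [mono_eq_sum (k := k), sum_range]
      · have hℓ : ℓ ≤ ∑ i : Fin k, d.inside (d.InClass i (code (X i))) := by omega
        refine hℓ.trans (sum_le_sum fun i _ => (inside_congr fun v hv => ?_).le)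
        rw [InClass, testBit_code, decide_eq_true_eq]
        by_cases hc : d.col v = 0
        · simp only [hc, if_true, true_and]
          rw [hg _ (rank_lt hv hc), Fin.ext_iff]
          omega
        · simp only [hc, if_false, false_and, or_false]
          omega
      · intro v hv
        by_cases hc : d.col v = 0
        · simp [hc]
        · simp only [hc, if_false]
          have := hcol v hv
          omega
  · rintro ⟨χ, hχ, hℓ⟩
    refine ⟨fun i => d.colorClass χ i, ?_, ?_⟩
    · rw [covers, mem_filter, Fintype.mem_piFinset]
      refine ⟨fun i => mem_powerset.2 (colorClass_subset χ i), ?_⟩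
      refine Subset.antisymm (biUnion_subset.2 fun i _ => colorClass_subset χ i) fun j hj => ?_
      obtain ⟨i, hi, h⟩ := existsUnique_color hχ (mem_range.1 hj)
      exact mem_biUnion.2 ⟨⟨i, hi⟩, mem_univ _, (h i).2 rfl⟩
    · have hpq := hPQ (fun i => d.colorClass χ i) fun i => colorClass_subset χ i
      have hsum := sum_card_colorClass hχ
      have hP : ∑ i : Fin k, (d.free - (d.colorClass χ i).card) = (k - 1) * d.free := by omega
      rw [sum_add_distrib, ← mul_sum, hP]
      rw [mono_eq_sum (fun v hv => (hχ v hv).1), sum_range] at hℓ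
      rw [sum_congr rfl fun (i : Fin k) _ =>
        inside_congr fun v hv => inClass_colorClass hχ (i := i) hv]
      omega

end Hyper

end HappyColoring

namespace HappyColoring

open Finset RAM

/-! ### Maximum bipartite matchings by an auction -/

/-- The state of the auction: the owner of every item (`0` for none, `l + 1` for the bidder `l`)
and its price. -/
structure Auction where
  owner : ℕ → ℕ
  price : ℕ → ℕ

namespace Auction

/-- The bidder `l` is without an item and can bid for `r`, a cheapest item among those it wants. -/
def Bids (m : ℕ) (adj : ℕ → ℕ → Prop) (s : Auction) (l r : ℕ) : Prop :=
  adj l r ∧ (¬ ∃ r' < m, s.owner r' = l + 1) ∧ s.price r ≤ m ∧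
    ∀ r' < m, adj l r' → s.price r ≤ s.price r'

/-- The bidder `l` gets the item `r`. -/
def give (s : Auction) (l r : ℕ) : Auction where
  owner := Function.update s.owner r (l + 1)
  price := Function.update s.price r (s.price r + 1)

open Classical in
/-- Let the bidder `l` bid for the item `r` if it can. -/
noncomputable def step (m : ℕ) (adj : ℕ → ℕ → Prop) (s : Auction) (l r : ℕ) : Auction :=
  if Bids m adj s l r then s.give l r else s

/-- The auction after `t` rounds. -/
noncomputable def run (m : ℕ) (adj : ℕ → ℕ → Prop) : ℕ → Auction
  | 0 => ⟨fun _ => 0, fun _ => 0⟩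
  | t + 1 => step m adj (run m adj t) (t / m % m) (t % m)

/-- The invariant of the auction. -/
structure Inv (m : ℕ) (adj : ℕ → ℕ → Prop) (s : Auction) : Prop where
  price_le : ∀ r, s.price r ≤ m + 1
  price_pos : ∀ r, s.price r ≠ 0 → s.owner r ≠ 0
  owner_adj : ∀ r l, s.owner r = l + 1 → l < m ∧ adj l r ∧
    ∀ r' < m, adj l r' → s.price r ≤ s.price r' + 1
  owner_inj : ∀ r < m, ∀ r' < m, s.owner r = s.owner r' → s.owner r ≠ 0 → r = r'

variable {m : ℕ} {adj : ℕ → ℕ → Prop} {s : Auction}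

/-- The item was a cheapest one for its new owner, so after the increase it is at most one above the
cheapest. For other owners the slack only grows, since no price falls. The bidder held nothing
before, so nobody owns two items. -/
theorem Inv.give (h : Inv m adj s) {l r : ℕ} (hl : l < m) (hb : Bids m adj s l r) :
    Inv m adj (s.give l r) := by
  obtain ⟨hadj, hun, hp, hmin⟩ := hb
  refine ⟨fun r' => ?_, fun r' h0 => ?_, fun r' l' h0 => ?_, fun r₁ h₁ r₂ h₂ heq h0 => ?_⟩
  · simp only [Auction.give, Function.update_apply]
    split_ifs
    · omega
    · exact h.price_le r'
  · simp only [Auction.give, Function.update_apply] at h0 ⊢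
    split_ifs at h0 ⊢
    · omega
    · exact h.price_pos r' h0
  · simp only [Auction.give, Function.update_apply] at h0 ⊢
    split_ifs at h0 with e
    · obtain rfl : l = l' := by omega
      subst e
      refine ⟨hl, hadj, fun r₂ h₂ ha => ?_⟩
      have := hmin r₂ h₂ ha
      split_ifs <;> omega
    · obtain ⟨k1, k2, k3⟩ := h.owner_adj r' l' h0
      refine ⟨k1, k2, fun r₂ h₂ ha => ?_⟩
      have := k3 r₂ h₂ ha
      rw [if_neg e]
      split_ifs with e2
      · subst e2; omega
      · exact this
  · simp only [Auction.give, Function.update_apply] at heq h0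
    split_ifs at heq h0 with e1 e2 e2
    · rw [e1, e2]
    · exact absurd ⟨r₂, h₂, heq.symm⟩ hun
    · exact absurd ⟨r₁, h₁, heq⟩ hun
    · exact h.owner_inj r₁ h₁ r₂ h₂ heq h0

theorem inv_run (hm : 0 < m) (t : ℕ) : Inv m adj (run m adj t) := by
  induction t with
  | zero => exact ⟨by simp [run], by simp [run], by simp [run], by simp [run]⟩
  | succ t ih =>
    rw [run, step]
    split_ifs with h
    · exact ih.give (Nat.mod_lt _ hm) h
    · exact ih

/-- The sum of the prices. -/
def total (m : ℕ) (s : Auction) : ℕ := ∑ r ∈ range m, s.price r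

theorem total_give {l r : ℕ} (hr : r < m) : total m (s.give l r) = total m s + 1 := by
  simp only [total, give]
  rw [sum_update_of_mem (mem_range.2 hr), ← add_sum_erase _ _ (mem_range.2 hr),
    sdiff_singleton_eq_erase]
  ring

theorem total_step_le (hm : 0 < m) (t : ℕ) :
    total m (run m adj t) ≤ total m (run m adj (t + 1)) := by
  rw [run, step]
  split_ifs
  · rw [total_give (Nat.mod_lt _ hm)]; omega
  · exact le_rfl

theorem total_mono (hm : 0 < m) {t t' : ℕ} (h : t ≤ t') :
    total m (run m adj t) ≤ total m (run m adj t') :=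
  monotone_nat_of_le_succ (f := fun t => total m (run m adj t)) (total_step_le hm) h

/-- No bidder can bid. -/
def Stable (m : ℕ) (adj : ℕ → ℕ → Prop) (s : Auction) : Prop :=
  ∀ l < m, ∀ r < m, ¬ Bids m adj s l r

theorem stable_step (hm : 0 < m) {t : ℕ} (h : Stable m adj (run m adj t)) :
    run m adj (t + 1) = run m adj t := by
  rw [run, step, if_neg (h _ (Nat.mod_lt _ hm) _ (Nat.mod_lt _ hm))]

theorem stable_add (hm : 0 < m) {t : ℕ} (h : Stable m adj (run m adj t)) (j : ℕ) :
    run m adj (t + j) = run m adj t := by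
  induction j with
  | zero => rfl
  | succ j ih => rw [← add_assoc, stable_step hm (by rw [ih]; exact h), ih]

/-- A sweep of `m * m` rounds tries every pair. If the total did not rise, no bid occurred and the
state was constant throughout, so a possible bid would have been made when its pair was tried. -/
theorem total_lt_of_not_stable (hm : 0 < m) {s : ℕ}
    (h : ¬ Stable m adj (run m adj (s * (m * m)))) :
    total m (run m adj (s * (m * m))) < total m (run m adj ((s + 1) * (m * m))) := by
  by_contra hle
  apply h
  have hconst : ∀ j ≤ m * m, run m adj (s * (m * m) + j) = run m adj (s * (m * m)) := by
    intro j
    induction j with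
    | zero => simp
    | succ j ih =>
      intro hj
      rw [← ih (by omega), ← add_assoc, run, step]
      split_ifs with hb
      · exfalso
        have h1 := total_give (s := run m adj (s * (m * m) + j)) (l := (s * (m * m) + j) / m % m)
          (Nat.mod_lt (s * (m * m) + j) hm)
        have h2 : run m adj (s * (m * m) + j + 1) = (run m adj (s * (m * m) + j)).give
            ((s * (m * m) + j) / m % m) ((s * (m * m) + j) % m) := by rw [run, step, if_pos hb]
        rw [← h2, ih (by omega)] at h1
        have h3 := total_mono (adj := adj) hm
          (show s * (m * m) + j + 1 ≤ (s + 1) * (m * m) by rw [Nat.succ_mul]; omega)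
        omega
      · rfl
  intro l hl r hr hb
  -- The round with this offset in the sweep is the one that tries the pair of `l` and `r`.
  have hlt : l * m + r < m * m := by nlinarith
  have h1 := hconst (l * m + r + 1) hlt
  rw [← add_assoc, run, hconst _ hlt.le] at h1
  have e1 : (s * (m * m) + (l * m + r)) % m = r := by
    rw [show s * (m * m) + (l * m + r) = r + m * (s * m + l) by ring, Nat.add_mul_mod_self_left,
      Nat.mod_eq_of_lt hr]
  have e2 : (s * (m * m) + (l * m + r)) / m % m = l := by
    rw [show s * (m * m) + (l * m + r) = r + m * (l + m * s) by ring,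
      Nat.add_mul_div_left _ _ hm, Nat.div_eq_of_lt hr, zero_add, Nat.add_mul_mod_self_left,
      Nat.mod_eq_of_lt hl]
  rw [e1, e2, step, if_pos hb] at h1
  have h2 := total_give (s := run m adj (s * (m * m))) (l := l) hr
  rw [h1] at h2
  omega

/-- Every sweep that starts from an unstable state raises the sum of the prices, which cannot exceed
`m * (m + 1)`. Once stable, the auction no longer changes. -/
theorem stable_run (hm : 0 < m) :
    Stable m adj (run m adj ((m * (m + 1) + 1) * (m * m))) := by
  by_contra h
  have hs : ∀ s ≤ m * (m + 1) + 1, s ≤ total m (run m adj (s * (m * m))) := by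
    intro s
    induction s with
    | zero => exact fun _ => Nat.zero_le _
    | succ s ih =>
      intro hs
      refine (ih (by omega)).trans_lt (total_lt_of_not_stable hm fun hst => h ?_)
      obtain ⟨j, hj⟩ := Nat.exists_eq_add_of_le
        (Nat.mul_le_mul_right (m * m) ((Nat.le_succ s).trans hs))
      rw [hj, stable_add hm hst]
      exact hst
  have h1 := hs _ le_rfl
  have h2 : total m (run m adj ((m * (m + 1) + 1) * (m * m))) ≤ m * (m + 1) := by
    refine (sum_le_card_nsmul _ _ (m + 1) fun r _ => (inv_run hm _).price_le r).trans ?_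
    simp
  omega

/-- The sold items and their owners form a matching, and every matched pair has an end outside the
independent set. Pairs whose item is outside `B` are charged to that item, the others to their
bidder, who is outside `A`. -/
theorem sold_add_card_le (h : Inv m adj s) {L R A B : Finset ℕ} (hA : A ⊆ L) (hB : B ⊆ R)
    (hadj : ∀ l r, adj l r → l ∈ L ∧ r ∈ R) (hind : ∀ l ∈ A, ∀ r ∈ B, ¬ adj l r) :
    A.card + B.card + ((range m).filter (s.owner · ≠ 0)).card ≤ L.card + R.card := by
  classical
  have h1 : ∀ r, s.owner r ≠ 0 → adj (s.owner r - 1) r := fun r hr =>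
    (h.owner_adj r _ (by omega)).2.1
  have h2 : (((range m).filter (s.owner · ≠ 0)).filter (· ∉ B)).card ≤ (R \ B).card :=
    card_le_card fun r hr => by
      simp only [mem_filter, mem_range] at hr
      exact mem_sdiff.2 ⟨(hadj _ _ (h1 r hr.1.2)).2, hr.2⟩
  have h3 : (((range m).filter (s.owner · ≠ 0)).filter (¬ · ∉ B)).card ≤ (L \ A).card := by
    refine card_le_card_of_injOn (fun r => s.owner r - 1) (fun r hr => ?_) ?_
    · simp only [coe_filter, Set.mem_ofPred_eq, mem_filter, mem_range, not_not] at hr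
      exact mem_sdiff.2 ⟨(hadj _ _ (h1 r hr.1.2)).1, fun hA' => hind _ hA' r hr.2 (h1 r hr.1.2)⟩
    · intro r hr r' hr' heq
      simp only [coe_filter, Set.mem_ofPred_eq, mem_filter, mem_range] at hr hr' heq
      exact h.owner_inj r hr.1.1 r' hr'.1.1 (by omega) hr.1.2
  have h4 := card_filter_add_card_filter_not (s := (range m).filter (s.owner · ≠ 0)) (· ∉ B)
  have h5 := card_sdiff_add_card_eq_card hA
  have h6 := card_sdiff_add_card_eq_card hB
  omega

/-- This is the hard direction of König's theorem: a gap in the prices yields a vertex cover no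
larger than the matching. The cover consists of the sold items above the gap and of the owners of
sold items not above it; the independent set is what remains. -/
theorem exists_card_le_sold_add (h : Inv m adj s) (hst : Stable m adj s) {L R : Finset ℕ}
    (hadj : ∀ l r, adj l r → l < m ∧ r < m) :
    ∃ A ⊆ L, ∃ B ⊆ R, (∀ l ∈ A, ∀ r ∈ B, ¬ adj l r) ∧
      L.card + R.card ≤ A.card + B.card + ((range m).filter (s.owner · ≠ 0)).card := by
  classical
  -- The `m` prices cannot occupy all `m + 1` values from `1` to `m + 1`.
  obtain ⟨t, ht, hgap⟩ : ∃ t ∈ Icc 1 (m + 1), t ∉ (range m).image s.price := by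
    by_contra! hc
    have := card_le_card (show Icc 1 (m + 1) ⊆ (range m).image s.price from hc)
    rw [Nat.card_Icc] at this
    have h2 := this.trans card_image_le
    rw [card_range] at h2
    omega
  rw [mem_Icc] at ht
  replace hgap : ∀ r < m, s.price r ≠ t := fun r hr he =>
    hgap (mem_image.2 ⟨r, mem_range.2 hr, he⟩)
  set S := (range m).filter (s.owner · ≠ 0) with hS
  set CR := S.filter (t < s.price ·) with hCR
  set CL := (S.filter (¬ t < s.price ·)).image (s.owner · - 1) with hCL
  refine ⟨L \ CL, sdiff_subset, R \ CR, sdiff_subset, fun l hl r hr ha => ?_, ?_⟩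
  · obtain ⟨hlm, hrm⟩ := hadj l r ha
    have hle : s.price r ≤ t := by
      by_contra hlt
      exact (mem_sdiff.1 hr).2 (mem_filter.2 ⟨mem_filter.2
        ⟨mem_range.2 hrm, h.price_pos r (by omega)⟩, not_le.1 hlt⟩)
    have hne := hgap r hrm
    -- The item `r` is priced below the gap. If `l` owns an item, that item costs at most one more
    -- than `r`, hence not more than `t`, so `l` is in the cover. If `l` owns nothing, its cheapest
    -- item costs at most `m`, so it could still bid, against stability.
    by_cases ho : ∃ r' < m, s.owner r' = l + 1
    · obtain ⟨r', hr', ho⟩ := ho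
      have hp := (h.owner_adj r' l ho).2.2 r hrm ha
      have hne' := hgap r' hr'
      refine (mem_sdiff.1 hl).2 (mem_image.2 ⟨r', mem_filter.2 ⟨mem_filter.2
        ⟨mem_range.2 hr', by omega⟩, by omega⟩, by omega⟩)
    · obtain ⟨r', hr', hmin⟩ := exists_min_image ((range m).filter (adj l)) s.price
        ⟨r, mem_filter.2 ⟨mem_range.2 hrm, ha⟩⟩
      rw [mem_filter, mem_range] at hr'
      have h1 := hmin r (mem_filter.2 ⟨mem_range.2 hrm, ha⟩)
      exact hst l hlm r' hr'.1 ⟨hr'.2, ho, by omega,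
        fun r₂ h₂ ha₂ => hmin r₂ (mem_filter.2 ⟨mem_range.2 h₂, ha₂⟩)⟩
  · have h1 : CL.card ≤ (S.filter (¬ t < s.price ·)).card := card_image_le
    have h2 := card_filter_add_card_filter_not (s := S) (t < s.price ·)
    rw [← hCR] at h2
    have h3 := le_card_sdiff CL L
    have h4 := le_card_sdiff CR R
    omega

/-- The number of items that the auction sells decides which sizes of independent sets occur. -/
theorem exists_independent_iff {okL okR : ℕ → Prop}
    (hadj : ∀ l r, adj l r → (l < m ∧ okL l) ∧ r < m ∧ okR r) (q : ℕ) :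
    q + count m (fun r => (run m adj ((m * (m + 1) + 1) * (m * m))).owner r ≠ 0) ≤
        count m okL + count m okR ↔
      ∃ A B : ℕ → Prop, (∀ l < m, A l → okL l) ∧ (∀ r < m, B r → okR r) ∧
        (∀ l < m, ∀ r < m, A l → B r → ¬ adj l r) ∧ q ≤ count m A + count m B := by
  classical
  -- For `m = 0` the remainders in `run` need not be below `m`, so `inv_run` is not available; but
  -- then all counts are zero.
  rcases Nat.eq_zero_or_pos m with rfl | hm
  · simp only [count, range_zero, filter_empty, card_empty]
    exact ⟨fun h => ⟨fun _ => False, fun _ => False, by simp, by simp, by simp, by omega⟩,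
      fun ⟨_, _, _, _, _, h⟩ => by omega⟩
  have hinv := inv_run (adj := adj) hm ((m * (m + 1) + 1) * (m * m))
  constructor
  · intro hq
    obtain ⟨A, hA, B, hB, hind, hcard⟩ := exists_card_le_sold_add hinv (stable_run hm)
      (L := (range m).filter okL) (R := (range m).filter okR)
      fun l r ha => ⟨(hadj l r ha).1.1, (hadj l r ha).2.1⟩
    refine ⟨(· ∈ A), (· ∈ B), fun l _ hl => (mem_filter.1 (hA hl)).2,
      fun r _ hr => (mem_filter.1 (hB hr)).2, fun l _ r _ hl hr => hind l hl r hr, ?_⟩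
    have e1 : (range m).filter (· ∈ A) = A :=
      filter_mem_eq_inter.trans (inter_eq_right.2 (hA.trans (filter_subset _ _)))
    have e2 : (range m).filter (· ∈ B) = B :=
      filter_mem_eq_inter.trans (inter_eq_right.2 (hB.trans (filter_subset _ _)))
    have e3 : count m (· ∈ A) = A.card := by rw [count_eq_card, e1]
    have e4 : count m (· ∈ B) = B.card := by rw [count_eq_card, e2]
    rw [e3, e4]
    simp only [count_eq_card] at hq
    omega
  · rintro ⟨A, B, hA, hB, hind, hq⟩
    have := sold_add_card_le hinv (L := (range m).filter okL) (R := (range m).filter okR)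
      (A := (range m).filter A) (B := (range m).filter B)
      (fun l hl => by
        rw [mem_filter, mem_range] at hl ⊢
        exact ⟨hl.1, hA l hl.1 hl.2⟩)
      (fun r hr => by
        rw [mem_filter, mem_range] at hr ⊢
        exact ⟨hr.1, hB r hr.1 hr.2⟩)
      (fun l r ha => by simpa using hadj l r ha)
      (fun l hl r hr => by
        rw [mem_filter, mem_range] at hl hr
        exact hind l hl.1 r hr.1 hl.2 hr.2)
    simp only [count_eq_card] at hq ⊢
    omega

end Auction

end HappyColoring

namespace HappyColoring

open Finset RAM

namespace Hyper

variable (d : Hyper)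

/-! ### Three colors, one of them on a prescribed set -/

/-- The hyperedge `e` can get color `c` if the mask `X` is reserved for another color. -/
def CanBe (X c e : ℕ) : Prop :=
  d.Active e ∧ d.Within (fun v => d.col v = c + 1 ∨ d.col v = 0 ∧ ¬ X.testBit (d.rank v) = true) e

/-- The hyperedges `l` and `r` cannot get the two colors other than `i` at the same time,
although either of them can. -/
def Conflict (i X l r : ℕ) : Prop :=
  (l < d.m ∧ d.CanBe X ((i + 1) % 3) l) ∧ (r < d.m ∧ d.CanBe X ((i + 2) % 3) r) ∧
    ∃ v < d.n, d.mem l v ∧ d.mem r v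

variable {d}

theorem sum_three (f : ℕ → ℕ) {i : ℕ} (hi : i < 3) :
    ∑ j ∈ range 3, f j = f i + (f ((i + 1) % 3) + f ((i + 2) % 3)) := by
  interval_cases i <;> simp [sum_range_succ] <;> ring

/-- The smallest of the three classes has at most a third of the uncolored vertices; call it `S`.
Given `S`, hyperedges wanting the two different remaining colors obstruct each other only by sharing
a vertex, so the families `A` and `B` can be realized together as soon as they contain no
conflicting pair. -/
theorem exists_three_coloring_iff (hcol : ∀ v < d.n, d.col v ≤ 3) (ℓ : ℕ) :
    (∃ χ, d.IsColoring 3 χ ∧ ℓ ≤ d.mono χ) ↔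
    ∃ i < 3, ∃ S ⊆ range d.free, 3 * S.card ≤ d.free ∧
      ∃ A B : ℕ → Prop, (∀ l < d.m, A l → d.CanBe (code S) ((i + 1) % 3) l) ∧
        (∀ r < d.m, B r → d.CanBe (code S) ((i + 2) % 3) r) ∧
        (∀ l < d.m, ∀ r < d.m, A l → B r → ¬ d.Conflict i (code S) l r) ∧
        ℓ - d.inside (d.InClass i (code S)) ≤ count d.m A + count d.m B := by
  constructor
  · rintro ⟨χ, hχ, hℓ⟩
    obtain ⟨i, hi⟩ : ∃ i : Fin 3, 3 * (d.colorClass χ i).card ≤ d.free := by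
      by_contra! hc
      have h := sum_card_colorClass hχ
      rw [Fin.sum_univ_three] at h
      have := hc 0
      have := hc 1
      have := hc 2
      omega
    have hin := fun v hv => inClass_colorClass hχ (i := i) (v := v) hv
    have hcan : ∀ c : ℕ, c ≠ i → ∀ e, d.Active e ∧ d.Within (χ · = c) e →
        d.CanBe (code (d.colorClass χ i)) c e := by
      rintro c hc e ⟨ha, hw⟩
      refine ⟨ha, fun v hv hev => ?_⟩
      have h1 := hw v hv hev
      by_cases h0 : d.col v = 0
      · refine Or.inr ⟨h0, fun hb => hc ?_⟩
        exact h1.symm.trans ((hin v hv).1 (Or.inr ⟨h0, hb⟩))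
      · have := (hχ v hv).2 h0
        exact Or.inl (by omega)
    refine ⟨i, i.isLt, d.colorClass χ i, colorClass_subset χ i, hi,
      fun e => d.Active e ∧ d.Within (χ · = (i + 1) % 3) e,
      fun e => d.Active e ∧ d.Within (χ · = (i + 2) % 3) e,
      fun e _ => hcan _ (by omega) e, fun e _ => hcan _ (by omega) e, ?_, ?_⟩
    · rintro l - r - ⟨-, hl⟩ ⟨-, hr⟩ ⟨-, -, v, hv, h1, h2⟩
      have h3 := hl v hv h1
      have h4 := hr v hv h2
      omega
    · rw [mono_eq_sum fun v hv => (hχ v hv).1, sum_three _ i.isLt] at hℓ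
      rw [inside_congr hin]
      exact Nat.sub_le_iff_le_add'.2 hℓ
  · rintro ⟨i, hi, S, -, -, A, B, hA, hB, hind, hℓ⟩
    classical
    -- Uncolored vertices outside `S` get the first remaining color if some hyperedge of `A` needs
    -- them, and the other one by default. The hyperedges of `B` are then satisfied because they
    -- avoid all hyperedges of `A`.
    set χ : ℕ → ℕ := fun v => if d.col v ≠ 0 then d.col v - 1 else
      if (code S).testBit (d.rank v) = true then i else
        if ∃ l < d.m, A l ∧ d.mem l v then (i + 1) % 3 else (i + 2) % 3 with hχ
    have hlt : ∀ v < d.n, χ v < 3 := by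
      intro v hv
      have := hcol v hv
      simp only [hχ]
      split_ifs <;> omega
    refine ⟨χ, fun v hv => ⟨hlt v hv, fun h => ?_⟩, ?_⟩
    · simp only [hχ, if_pos h]
      omega
    · rw [mono_eq_sum hlt, sum_three _ hi]
      refine (Nat.sub_le_iff_le_add'.1 hℓ).trans (Nat.add_le_add ?_ (Nat.add_le_add ?_ ?_))
      · rw [inside, count_eq_card, inside, count_eq_card]
        refine card_le_card fun e he => ?_
        rw [mem_filter, mem_range] at he ⊢
        obtain ⟨he, ha, hw⟩ := he
        refine ⟨he, ha, fun v hv hev => ?_⟩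
        rcases hw v hv hev with h | ⟨h1, h2⟩
        · simp [hχ, h]
        · simp only [hχ, h1, h2, ne_eq, not_true, if_false, if_true]
      · rw [count_eq_card, inside, count_eq_card]
        refine card_le_card fun e he => ?_
        rw [mem_filter, mem_range] at he ⊢
        obtain ⟨ha, hw⟩ := hA e he.1 he.2
        refine ⟨he.1, ha, fun v hv hev => ?_⟩
        rcases hw v hv hev with h | ⟨h1, h2⟩
        · simp [hχ, h]
        · simp only [hχ, h1, ne_eq, not_true, if_false]
          rw [if_neg h2, if_pos ⟨e, he.1, he.2, hev⟩]
      · rw [count_eq_card, inside, count_eq_card]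
        refine card_le_card fun e he => ?_
        rw [mem_filter, mem_range] at he ⊢
        obtain ⟨ha, hw⟩ := hB e he.1 he.2
        refine ⟨he.1, ha, fun v hv hev => ?_⟩
        rcases hw v hv hev with h | ⟨h1, h2⟩
        · simp [hχ, h]
        · simp only [hχ, h1, ne_eq, not_true, if_false]
          rw [if_neg h2, if_neg]
          rintro ⟨l, hl, hAl, hlv⟩
          exact hind l hl e he.1 hAl he.2
            ⟨⟨hl, hA l hl hAl⟩, ⟨he.1, hB e he.1 he.2⟩, v, hv, hlv, hev⟩

end Hyper

/-! ### The number of small sets -/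

/-- The subsets of `range N` with at most `N / 3` elements. -/
def smallSets (N : ℕ) : Finset (Finset ℕ) := (range N).powerset.filter fun S => 3 * S.card ≤ N

/-- Weigh each set by `(1 / 2) ^ |S|`. All subsets together weigh `(3 / 2) ^ N`, and each small set
weighs at least `(1 / 2) ^ (N / 3)`. The ratio `1 / 2` is that of a third to its complement, the
optimal choice for this argument. -/
theorem card_smallSets_le (N : ℕ) : ((smallSets N).card : ℝ) ≤ (1.89 : ℝ) ^ N := by
  have h1 : ((smallSets N).card : ℝ) * (1 / 2) ^ (N / 3) ≤ (3 / 2) ^ N := calc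
    _ = ∑ S ∈ smallSets N, (1 / 2 : ℝ) ^ (N / 3) := by rw [sum_const, nsmul_eq_mul]
    _ ≤ ∑ S ∈ smallSets N, (1 / 2 : ℝ) ^ S.card := sum_le_sum fun S hS =>
        pow_le_pow_of_le_one (by norm_num) (by norm_num) (by
          have := (mem_filter.1 hS).2
          omega)
    _ ≤ ∑ S ∈ (range N).powerset, (1 / 2 : ℝ) ^ S.card :=
        sum_le_sum_of_subset_of_nonneg (filter_subset _ _) fun _ _ _ => by positivity
    _ = (3 / 2) ^ N := by
        have h := sum_pow_mul_eq_add_pow (1 / 2 : ℝ) 1 (range N)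
        simp only [one_pow, mul_one, card_range] at h
        rw [h]
        norm_num
  have h2 : ((smallSets N).card : ℝ) ≤ (3 / 2) ^ N * 2 ^ (N / 3) := by
    have h3 : (1 / 2 : ℝ) ^ (N / 3) * 2 ^ (N / 3) = 1 := by rw [← mul_pow]; norm_num
    calc ((smallSets N).card : ℝ)
        = (smallSets N).card * (1 / 2) ^ (N / 3) * 2 ^ (N / 3) := by rw [mul_assoc, h3, mul_one]
      _ ≤ _ := mul_le_mul_of_nonneg_right h1 (by positivity)
  -- Cubes remove the rounding in `N / 3`. What remains is `27 / 4 = 6.75 ≤ 6.751269 = 1.89 ^ 3`.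
  refine le_of_pow_le_pow_left₀ three_ne_zero (by positivity) ?_
  calc ((smallSets N).card : ℝ) ^ 3 ≤ ((3 / 2) ^ N * 2 ^ (N / 3)) ^ 3 :=
        pow_le_pow_left₀ (by positivity) h2 3
    _ = (27 / 8) ^ N * 2 ^ (N / 3 * 3) := by
        rw [mul_pow, ← pow_mul, ← pow_mul, mul_comm N 3, pow_mul]; norm_num
    _ ≤ (27 / 8) ^ N * 2 ^ N := by
        refine mul_le_mul_of_nonneg_left (pow_le_pow_right₀ one_le_two ?_) (by positivity)
        omega
    _ = (27 / 8 * 2) ^ N := (mul_pow _ _ _).symm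
    _ ≤ (1.89 ^ 3) ^ N := pow_le_pow_left₀ (by norm_num) (by norm_num) N
    _ = (1.89 ^ N) ^ 3 := by rw [← pow_mul, ← pow_mul, mul_comm]

end HappyColoring

namespace HappyColoring

open Finset RAM Expr

/-! ### Expressions for hypergraphs -/

/-- Expressions that describe a hypergraph in terms of the input, with variable `1` for the number
of vertices. -/
structure HyperExpr where
  size : Expr
  mem : Expr → Expr → Expr
  sizeFn : ℕ → ℕ
  memFn : (ℕ → ℕ) → ℕ → ℕ → Prop
  size_ok : size.ok = true
  mem_ok : ∀ e v, e.ok = true → v.ok = true → (mem e v).ok = true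
  eval_size : ∀ σ : St, σ.var 1 = σ.inp 0 → size.eval σ = sizeFn (σ.inp 0)
  holds_mem : ∀ (σ : St) (e v : Expr), σ.var 1 = σ.inp 0 →
    ((mem e v).Holds σ ↔ memFn σ.inp (e.eval σ) (v.eval σ))

namespace HyperExpr

/-- The hypergraph that is described by the input `w`. -/
def hyper (H : HyperExpr) (w : ℕ → ℕ) : Hyper where
  n := w 0
  m := H.sizeFn (w 0)
  col v := w (3 + v)
  mem := H.memFn w

/-- The threshold, capped at `m + 1`, and `0` if it is negative. -/
def thr (H : HyperExpr) (w : ℕ → ℕ) : ℕ := if w 1 = 0 then min (H.sizeFn (w 0) + 1) (w 2) else 0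

/-- The variables `1`, …, `4` hold the parameters of the instance. -/
structure Env (H : HyperExpr) (w : ℕ → ℕ) (σ : St) : Prop where
  inp : σ.inp = w
  n : σ.var 1 = w 0
  m : σ.var 2 = H.sizeFn (w 0)
  free : σ.var 3 = (H.hyper w).free
  thr : σ.var 4 = H.thr w

/-- The color code of the vertex `v`. -/
def colE (v : Expr) : Expr := .inp (.add (.cst 3) v)

/-- The number of uncolored vertices before `v`. -/
def rankE (v : Expr) : Expr := .num 7 v (.not (colE (.var 7)))

/-- The bit of the mask in variable `20` that belongs to the vertex `v`. -/
def maskE (v : Expr) : Expr := .bit (.var 20) (rankE v)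

/-- The vertex in variable `6` gets the color in variable `10`. -/
def inClassE : Expr :=
  .or (.eq (colE (.var 6)) (.add (.var 10) (.cst 1))) (.mul (.not (colE (.var 6))) (maskE (.var 6)))

/-- The vertex in variable `6` can get color `c` without being in the mask. -/
def freeE (c : Expr) : Expr :=
  .or (.eq (colE (.var 6)) (.add c (.cst 1))) (.mul (.not (colE (.var 6))) (.not (maskE (.var 6))))

variable (H : HyperExpr) {w : ℕ → ℕ} {σ : St}

/-- The hyperedge in variable `x` is not empty, and all its vertices satisfy `P`. -/
def withinE (x : ℕ) (P : Expr) : Expr :=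
  .mul (.ex 6 (.var 1) (H.mem (.var x) (.var 6)))
    (.all 6 (.var 1) (.or (.not (H.mem (.var x) (.var 6))) P))

/-- The number of nonempty hyperedges all of whose vertices satisfy `P`. -/
def insideE (P : Expr) : Expr := .num 5 (.var 2) (H.withinE 5 P)

/-- The number of bits of a mask. -/
def popE (X : Expr) : Expr := .num 8 (.var 3) (.bit X (.var 8))

variable {H}

theorem Env.setVar (h : H.Env w σ) {x : ℕ} (v : ℕ) (hx : x = 0 ∨ 4 < x) :
    H.Env w (σ.setVar x v) where
  inp := h.inp
  n := by rw [St.setVar_var, if_neg (by omega), h.n]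
  m := by rw [St.setVar_var, if_neg (by omega), h.m]
  free := by rw [St.setVar_var, if_neg (by omega), h.free]
  thr := by rw [St.setVar_var, if_neg (by omega), h.thr]

theorem Env.setArr (h : H.Env w σ) (a : Fin 4) (i v : ℕ) : H.Env w (σ.setArr a i v) where
  inp := h.inp
  n := h.n
  m := h.m
  free := h.free
  thr := h.thr

theorem Env.var_one (h : H.Env w σ) : σ.var 1 = σ.inp 0 := by rw [h.n, h.inp]

theorem eval_colE (hw : σ.inp = w) (v : Expr) :
    (colE v).eval σ = (H.hyper w).col (v.eval σ) := by
  rw [colE, eval_inp, eval_add, eval_cst, hw]; rfl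

theorem eval_rankE (hw : σ.inp = w) (v : Expr) :
    (rankE v).eval σ = (H.hyper w).rank (v.eval σ) := by
  rw [rankE, eval_num]
  refine count_congr fun u _ => ?_
  rw [holds_not, Holds, eval_colE (H := H) (σ := σ.setVar 7 u) hw, not_not, eval_var,
    St.setVar_var, if_pos rfl]

theorem holds_maskE (hw : σ.inp = w) (v : Expr) :
    (maskE v).Holds σ ↔ (σ.var 20).testBit ((H.hyper w).rank (v.eval σ)) = true := by
  rw [maskE, holds_bit, eval_rankE (H := H) hw, eval_var]

theorem holds_inClassE (hw : σ.inp = w) :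
    inClassE.Holds σ ↔ (H.hyper w).InClass (σ.var 10) (σ.var 20) (σ.var 6) := by
  rw [inClassE, holds_or, holds_eq, holds_mul, holds_not, holds_maskE (H := H) hw, Holds,
    eval_colE (H := H) hw, not_not]
  rfl

theorem holds_freeE (hw : σ.inp = w) (c : Expr) :
    (freeE c).Holds σ ↔ (H.hyper w).col (σ.var 6) = c.eval σ + 1 ∨
      (H.hyper w).col (σ.var 6) = 0 ∧
        ¬ (σ.var 20).testBit ((H.hyper w).rank (σ.var 6)) = true := by
  rw [freeE, holds_or, holds_eq, holds_mul, holds_not, holds_not, holds_maskE (H := H) hw, Holds,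
    eval_colE (H := H) hw, not_not]
  rfl

theorem Env.holds_mem (h : H.Env w σ) (e v : Expr) :
    (H.mem e v).Holds σ ↔ (H.hyper w).mem (e.eval σ) (v.eval σ) := by
  rw [H.holds_mem _ _ _ h.var_one, h.inp]; rfl

theorem Env.holds_withinE (h : H.Env w σ) {x : ℕ} (hx : x ≠ 6) {P : Expr} {Q : ℕ → Prop}
    (hP : ∀ v, P.Holds (σ.setVar 6 v) ↔ Q v) :
    (H.withinE x P).Holds σ ↔
      (H.hyper w).Active (σ.var x) ∧ (H.hyper w).Within Q (σ.var x) := by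
  have hm : ∀ v, (H.mem (.var x) (.var 6)).Holds (σ.setVar 6 v) ↔
      (H.hyper w).mem (σ.var x) v := fun v => by
    rw [(h.setVar v (by omega)).holds_mem, eval_var, eval_var, St.setVar_var, St.setVar_var,
      if_pos rfl, if_neg hx]
  rw [withinE, holds_mul, holds_ex, holds_all]
  rw [eval_var, h.n]
  refine and_congr (exists_congr fun v => and_congr_right fun _ => hm v)
    (forall₂_congr fun v _ => ?_)
  rw [holds_or, holds_not, hm, hP]
  exact imp_iff_not_or.symm

theorem Env.eval_insideE (h : H.Env w σ) {P : Expr} {Q : ℕ → Prop}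
    (hP : ∀ e v, P.Holds ((σ.setVar 5 e).setVar 6 v) ↔ Q v) :
    (H.insideE P).eval σ = (H.hyper w).inside Q := by
  rw [insideE, eval_num, eval_var, h.m]
  refine count_congr fun e _ => ?_
  rw [(h.setVar e (by omega)).holds_withinE (by omega) (hP e), St.setVar_var, if_pos rfl]

theorem Env.eval_inside_inClassE (h : H.Env w σ) :
    (H.insideE inClassE).eval σ =
      (H.hyper w).inside ((H.hyper w).InClass (σ.var 10) (σ.var 20)) := by
  refine h.eval_insideE fun e v => ?_
  rw [holds_inClassE (H := H) (σ := (σ.setVar 5 e).setVar 6 v) h.inp]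
  simp [St.setVar_var]

theorem Env.eval_popE (h : H.Env w σ) {x : ℕ} (hx : x ≠ 8) :
    (popE (.var x)).eval σ = (bits (H.hyper w).free (σ.var x)).card := by
  rw [popE, eval_num, eval_var, h.free, ← count_testBit]
  refine count_congr fun j _ => ?_
  rw [holds_bit, eval_var, eval_var, St.setVar_var, St.setVar_var, if_pos rfl, if_neg hx]

theorem free_le (d : Hyper) : d.free ≤ d.n := count_le _ _

theorem thr_le : H.thr w ≤ H.sizeFn (w 0) + 1 := by
  unfold thr
  split_ifs
  · exact min_le_left _ _
  · exact Nat.zero_le _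

/-! ### Reading the parameters -/

/-- The capped threshold. -/
def thrE : Expr :=
  .mul (.not (.inp (.cst 1))) (.sub (.add (.var 2) (.cst 1))
    (.sub (.add (.var 2) (.cst 1)) (.inp (.cst 2))))

variable (H)

/-- Read the parameters of the instance. -/
def prelude : Prog :=
  .seq (.assign 1 (.inp (.cst 0))) <| .seq (.assign 2 H.size) <|
    .seq (.assign 3 (rankE (.var 1))) (.assign 4 thrE)

end HyperExpr

end HappyColoring

/-! ### Time bounds for single commands, and the initial state -/

namespace RAM

/-- The time bound for an assignment. -/
def assignTime (e : Expr) (s : ℕ) : ℕ := e.tm s + e.bd s + 3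

/-- The time bound for a write access. -/
def writeTime (i e : Expr) (s : ℕ) : ℕ :=
  i.tm s + e.tm s + 9 * i.bd s + e.bd s + 2 * s + 70

theorem polyBdd_assignTime (e : Expr) : PolyBdd (assignTime e) :=
  (e.polyBdd_tm.add e.polyBdd_bd).add (.const 3)

theorem polyBdd_writeTime (i e : Expr) : PolyBdd (writeTime i e) :=
  ((((i.polyBdd_tm.add e.polyBdd_tm).add (.mul (.const 9) i.polyBdd_bd)).add e.polyBdd_bd).add
    (.mul (.const 2) .id)).add (.const 70)

/-- The initial abstract state with input `w`. -/
def St.start (w : ℕ → ℕ) : St := ⟨fun _ => 0, fun _ _ => 0, w⟩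

end RAM

namespace HappyColoring.HyperExpr

open Finset RAM Expr

variable (H : HyperExpr) {w : ℕ → ℕ} {D s : ℕ}

/-- The time bound for reading the parameters. -/
def preludeTime (s : ℕ) : ℕ :=
  assignTime (.inp (.cst 0)) s + (assignTime H.size s +
    (assignTime (rankE (.var 1)) s + assignTime thrE s))

theorem polyBdd_preludeTime : PolyBdd H.preludeTime :=
  (polyBdd_assignTime _).add ((polyBdd_assignTime _).add
    ((polyBdd_assignTime _).add (polyBdd_assignTime _)))

theorem triple_prelude (hw : ∀ i, w i ≤ 2 ^ s) (hD : D ≤ 2 ^ s) (hn : w 0 ≤ s)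
    (hm : H.sizeFn (w 0) + 1 ≤ s) :
    Triple D H.prelude (St.start w) (H.preludeTime s) fun σ =>
      H.Env w σ ∧ Bdd s σ ∧ σ.arr = fun _ _ => 0 := by
  have hb : Bdd s (St.start w) :=
    ⟨fun _ _ => Nat.zero_le _, fun _ => Nat.zero_le _, hw, fun _ _ _ => Nat.zero_le _,
      fun _ _ => Nat.zero_le _⟩
  set σ1 := (St.start w).setVar 1 (w 0) with h1
  have hb1 : Bdd s σ1 := hb.setSmall hn
  have hv1 : σ1.var 1 = w 0 := by simp [h1, St.setVar_var]
  have hi1 : σ1.inp = w := rfl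
  set σ2 := σ1.setVar 2 (H.sizeFn (w 0)) with h2
  have hb2 : Bdd s σ2 := hb1.setSmall (by omega)
  have hi2 : σ2.inp = w := rfl
  set σ3 := σ2.setVar 3 (H.hyper w).free with h3
  have hfree := free_le (H.hyper w)
  have hb3 : Bdd s σ3 := hb2.setSmall (hfree.trans hn)
  refine .seq (Triple.assign hb hD 1 rfl (Q := fun σ => σ = σ1) ?_) ?_
  · rw [eval_inp, eval_cst]; rfl
  rintro _ rfl
  refine .seq (Triple.assign hb1 hD 2 H.size_ok (Q := fun σ => σ = σ2) ?_) ?_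
  · rw [H.eval_size _ hv1]; rfl
  rintro _ rfl
  refine .seq (Triple.assign hb2 hD 3 rfl (Q := fun σ => σ = σ3) ?_) ?_
  · rw [eval_rankE (H := H) hi2, eval_var, h2, St.setVar_var, if_neg (by omega), hv1]; rfl
  rintro _ rfl
  -- With truncated subtraction `a - (a - b)` is the minimum of `a` and `b`; the factor `1 - w 1`
  -- replaces a negative threshold by `0`.
  have hv : thrE.eval σ3 = H.thr w := by
    have e2 : σ3.var 2 = H.sizeFn (w 0) := by simp [h3, h2, St.setVar_var]
    have e3 : σ3.inp = w := rfl
    simp only [thrE, eval_mul, eval_sub, eval_cst, eval_inp, eval_add, eval_var, e2, e3, thr]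
    split_ifs with h
    · rw [h, Nat.sub_zero, one_mul]; omega
    · rw [Nat.sub_eq_zero_of_le (Nat.one_le_iff_ne_zero.2 h), zero_mul]
  refine Triple.assign hb3 hD 4 rfl ?_
  rw [hv]
  refine ⟨⟨rfl, ?_, ?_, ?_, ?_⟩, hb3.setSmall (thr_le.trans hm), rfl⟩
  · simp [h3, h2, h1, St.setVar_var]
  · simp [h3, h2, St.setVar_var]
  · simp [h3, St.setVar_var]
  · simp [St.setVar_var]

end HappyColoring.HyperExpr

namespace HappyColoring.HyperExpr

open Finset RAM Expr

variable (H : HyperExpr) (k : ℕ)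

/-! ### Any number of colors: inclusion and exclusion -/

/-- The base two logarithm of the formal variable of the generating functions. -/
def baseE : Expr := .add (.mul (.cst k) (.var 3)) (.cst 1)

/-- The penalty for a vertex that is colored twice. -/
def penaltyE : Expr := .add (.mul (.cst k) (.var 2)) (.cst 1)

/-- The weight of the mask in variable `20` as a class of the color in variable `10`. -/
def weightE : Expr :=
  .add (H.insideE inClassE) (.mul (penaltyE k) (.sub (.var 3) (popE (.var 20))))

/-- Initialize the table entry with index `q`. -/
def initTable : Prog :=
  .seq (.assign 10 (.div (.var 17) (.var 16))) <|
    .seq (.assign 20 (.mod (.var 17) (.var 16))) <|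
      .write 3 (.var 17) (.two (.mul (baseE k) (H.weightE k)))

/-- The entry with index `q` after the next stage of the zeta transform. -/
def zetaE : Expr :=
  .add (.arr 3 (.var 17)) (.mul (.bit (.var 17) (.var 9))
    (.arr 3 (.sub (.var 17) (.two (.var 9)))))

/-- The product of the table entries for the mask in variable `17`. -/
def prodE : Expr :=
  .fold true 10 (.cst k) (.arr 3 (.add (.mul (.var 10) (.var 16)) (.var 17)))

/-- Add the product to one of the two alternating sums. -/
def accumulate : Prog :=
  .cond (.mod (.add (.var 3) (popE (.var 17))) (.cst 2))
    (.assign 23 (.add (.var 23) (prodE k))) (.assign 22 (.add (.var 22) (prodE k)))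

/-- The comparison that gives the answer. -/
def answerE : Expr :=
  .le (.two (.mul (baseE k) (.add (.mul (penaltyE k) (.mul (.cst (k - 1)) (.var 3))) (.var 4))))
    (.sub (.var 22) (.var 23))

/-- The algorithm for an arbitrary number `k` of colors. -/
def coverProg : Prog :=
  .seq H.prelude <| .seq (.assign 16 (.two (.var 3))) <|
    .seq (.assign 21 (.mul (.cst k) (.var 16))) <|
    .seq (.for_ 17 21 (H.initTable k)) <|
    .seq (.for_ 9 3 (.for_ 17 21 (.write 3 (.var 17) zetaE))) <|
    .seq (.assign 22 (.cst 0)) <| .seq (.assign 23 (.cst 0)) <|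
    .seq (.for_ 17 16 (accumulate k)) (.assign 0 (answerE k))

/-- The weight of the mask `X` as a class of color `i`. -/
noncomputable def weight (d : Hyper) (i X : ℕ) : ℕ :=
  d.inside (d.InClass i X) + (k * d.m + 1) * (d.free - (bits d.free X).card)

/-- The initial table. -/
noncomputable def table (d : Hyper) (q : ℕ) : ℕ :=
  2 ^ ((k * d.free + 1) * weight k d (q / 2 ^ d.free) (q % 2 ^ d.free))

/-- The binary logarithm of a bound for the initial table. -/
def tableBd (n m : ℕ) : ℕ := (k * n + 1) * (m + (k * m + 1) * n)

/-- The binary logarithm of a bound for all numbers that the algorithm computes. -/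
def coverBd (n m : ℕ) : ℕ := k + n + m + 2 + n + k * (n + tableBd k n m)

variable {H k} {w : ℕ → ℕ} {D s : ℕ} {σ : St}

theorem weight_le (d : Hyper) (i X : ℕ) : weight k d i X ≤ d.m + (k * d.m + 1) * d.n :=
  Nat.add_le_add (Hyper.inside_le _)
    (Nat.mul_le_mul_left _ ((Nat.sub_le _ _).trans (free_le d)))

theorem table_le (d : Hyper) (q : ℕ) : table k d q ≤ 2 ^ tableBd k d.n d.m :=
  Nat.pow_le_pow_right two_pos (Nat.mul_le_mul
    (Nat.succ_le_succ (Nat.mul_le_mul_left _ (free_le d))) (weight_le d _ _))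

theorem zeta_table_le (d : Hyper) {j : ℕ} (hj : j ≤ d.free) (q : ℕ) :
    zeta (table k d) j q ≤ 2 ^ (d.n + tableBd k d.n d.m) := by
  refine (zeta_le _ _ j q fun q' _ => table_le d q').trans ?_
  rw [← pow_add]
  exact Nat.pow_le_pow_right two_pos (Nat.add_le_add_right (hj.trans (free_le d)) _)

theorem Env.eval_weightE (h : H.Env w σ) :
    (H.weightE k).eval σ = weight k (H.hyper w) (σ.var 10) (σ.var 20) := by
  rw [weightE, eval_add, eval_mul, eval_sub, h.eval_inside_inClassE, h.eval_popE (by omega),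
    penaltyE, eval_add, eval_mul, eval_var, eval_var, eval_cst, eval_cst, h.m, h.free]
  rfl

theorem weightE_ok : (H.weightE k).ok = true := by
  have h := H.mem_ok (.var 5) (.var 6) rfl rfl
  simp [weightE, insideE, withinE, Expr.ok, h, inClassE, colE, maskE, rankE, penaltyE, popE,
    Expr.small]

theorem weightE_small : (H.weightE k).small = true := by
  simp [weightE, insideE, Expr.small, penaltyE]

theorem initE_ok : (Expr.two (.mul (baseE k) (H.weightE k))).ok = true := by
  simp [Expr.ok, weightE_ok, Expr.small, weightE_small, baseE]

/-- The table after the initialization and during the zeta transform. -/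
structure TableEnv (H : HyperExpr) (k : ℕ) (w : ℕ → ℕ) (s : ℕ) (σ : St) : Prop where
  env : H.Env w σ
  bdd : Bdd s σ
  pow : σ.var 16 = 2 ^ (H.hyper w).free
  len : σ.var 21 = k * 2 ^ (H.hyper w).free

theorem TableEnv.setVar (h : TableEnv H k w s σ) {x v : ℕ}
    (hx : x = 0 ∨ 4 < x ∧ x ≠ 16 ∧ x ≠ 21) (hv : v ≤ 2 ^ s) (hv' : x < 16 → v ≤ s) :
    TableEnv H k w s (σ.setVar x v) where
  env := h.env.setVar v (by omega)
  bdd := h.bdd.setVar hv hv'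
  pow := by rw [St.setVar_var, if_neg (by omega), h.pow]
  len := by rw [St.setVar_var, if_neg (by omega), h.len]

theorem TableEnv.setArr (h : TableEnv H k w s σ) (i : ℕ) {v : ℕ} (hv : v ≤ 2 ^ s) :
    TableEnv H k w s (σ.setArr 3 i v) where
  env := h.env.setArr _ _ _
  bdd := h.bdd.setArr hv (by simp)
  pow := h.pow
  len := h.len

/-- The time bound for the initialization of a table entry. -/
def initTime (H : HyperExpr) (k s : ℕ) : ℕ :=
  assignTime (.div (.var 17) (.var 16)) s + (assignTime (.mod (.var 17) (.var 16)) s +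
    writeTime (.var 17) (.two (.mul (baseE k) (H.weightE k))) s)

/-- The `k` tables lie one after another: quotient and remainder of the index by `2 ^ free` are the
color and the mask. -/
theorem triple_initTable (hD : D ≤ 2 ^ s) (hs : coverBd k (H.hyper w).n (H.hyper w).m ≤ s)
    (h : TableEnv H k w s σ) {q : ℕ} (hq : σ.var 17 = q) (hlt : q < k * 2 ^ (H.hyper w).free)
    (harr : ∀ q' < q, σ.arr 3 q' = table k (H.hyper w) q') :
    Triple D (H.initTable k) σ (initTime H k s) fun σ' =>
      σ'.var 17 = q ∧ TableEnv H k w s σ' ∧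
        ∀ q' < q + 1, σ'.arr 3 q' = table k (H.hyper w) q' := by
  have hpos : 0 < 2 ^ (H.hyper w).free := by positivity
  have hk : k ≤ s := by unfold coverBd at hs; omega
  have hn : (H.hyper w).free ≤ s := (free_le _).trans (by unfold coverBd at hs; omega)
  have h1 := h.setVar (x := 10) (v := q / 2 ^ (H.hyper w).free) (by omega)
    ((Nat.div_lt_of_lt_mul (by rwa [mul_comm])).le.trans (hk.trans Nat.lt_two_pow_self.le))
    fun _ => (Nat.div_lt_of_lt_mul (by rwa [mul_comm])).le.trans hk
  have h2 := h1.setVar (x := 20) (v := q % 2 ^ (H.hyper w).free) (by omega)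
    ((Nat.mod_lt _ hpos).le.trans (Nat.pow_le_pow_right two_pos hn)) (by omega)
  set σ1 := σ.setVar 10 (q / 2 ^ (H.hyper w).free) with hσ1
  set σ2 := σ1.setVar 20 (q % 2 ^ (H.hyper w).free) with hσ2
  refine .seq (Triple.assign h.bdd hD 10 rfl (Q := fun σ' => σ' = σ1) ?_) ?_
  · rw [eval_div, eval_var, eval_var, hq, h.pow]
  rintro _ rfl
  have hq1 : σ1.var 17 = q := by simp [hσ1, St.setVar_var, hq]
  refine .seq (Triple.assign h1.bdd hD 20 rfl (Q := fun σ' => σ' = σ2) ?_) ?_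
  · rw [eval_mod, eval_var, eval_var, hq1, h1.pow]
  rintro _ rfl
  have hq2 : σ2.var 17 = q := by simp [hσ2, St.setVar_var, hq1]
  have hi2 : σ2.var 10 = q / 2 ^ (H.hyper w).free := by simp [hσ2, hσ1, St.setVar_var]
  have hX2 : σ2.var 20 = q % 2 ^ (H.hyper w).free := by simp [hσ2, St.setVar_var]
  have hval : (Expr.two (.mul (baseE k) (H.weightE k))).eval σ2 = table k (H.hyper w) q := by
    rw [eval_two, eval_mul, h2.env.eval_weightE, hi2, hX2, baseE, eval_add, eval_mul, eval_var,
      eval_cst, eval_cst, h2.env.free]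
    rfl
  refine Triple.write h2.bdd hD 3 rfl initE_ok ?_
  rw [hval, eval_var, hq2]
  refine ⟨hq2, h2.setArr _ ((table_le _ _).trans (Nat.pow_le_pow_right two_pos ?_)),
    fun q' hq' => ?_⟩
  · unfold coverBd at hs
    -- If `k` were zero there would be no index `q` to initialize.
    have : tableBd k (H.hyper w).n (H.hyper w).m ≤
        k * ((H.hyper w).n + tableBd k (H.hyper w).n (H.hyper w).m) := by
      rcases Nat.eq_zero_or_pos k with rfl | hk0
      · simp at hlt
      · exact (Nat.le_add_left _ _).trans (Nat.le_mul_of_pos_left _ hk0)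
    omega
  · rw [St.setArr_arr]
    by_cases e : q' = q
    · simp [e]
    · rw [if_neg (by simp [e])]
      exact harr q' (by omega)

theorem testBit_sub_two_pow_self {q j : ℕ} (h : q.testBit j = true) :
    (q - 2 ^ j).testBit j = false := by
  have hq : 2 ^ j ≤ q := Nat.ge_two_pow_of_testBit h
  rw [← Nat.add_sub_cancel' hq, Nat.testBit_two_pow_add_eq] at h
  simpa using h

/-- Stage `j` leaves entries without bit `j` unchanged. Therefore the transform can overwrite its
table in place: it does not matter that this entry was processed earlier. -/
theorem zeta_succ_sub (a : ℕ → ℕ) {q j : ℕ} (h : q.testBit j = true) :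
    zeta a (j + 1) (q - 2 ^ j) = zeta a j (q - 2 ^ j) := by
  rw [zeta, if_neg (by rw [testBit_sub_two_pow_self h]; simp), add_zero]

theorem two_pow_sub_le {d : Hyper} (hk : 0 < k) (hs : coverBd k d.n d.m ≤ s) :
    2 ^ (d.n + tableBd k d.n d.m) ≤ 2 ^ s := by
  refine Nat.pow_le_pow_right two_pos ?_
  unfold coverBd at hs
  have := Nat.le_mul_of_pos_left (d.n + tableBd k d.n d.m) hk
  omega

theorem triple_zeta (hD : D ≤ 2 ^ s) (hk : 0 < k)
    (hs : coverBd k (H.hyper w).n (H.hyper w).m ≤ s)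
    (h : TableEnv H k w s σ) {q j : ℕ} (hq : σ.var 17 = q) (hj : σ.var 9 = j)
    (hlt : j < (H.hyper w).free)
    (harr : ∀ q', q' < k * 2 ^ (H.hyper w).free →
      σ.arr 3 q' = zeta (table k (H.hyper w)) (if q' < q then j + 1 else j) q')
    (hqlt : q < k * 2 ^ (H.hyper w).free) :
    Triple D (.write 3 (.var 17) zetaE) σ (writeTime (.var 17) zetaE s) fun σ' =>
      σ'.var 17 = q ∧ σ'.var 9 = j ∧ TableEnv H k w s σ' ∧
        ∀ q', q' < k * 2 ^ (H.hyper w).free →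
          σ'.arr 3 q' = zeta (table k (H.hyper w)) (if q' < q + 1 then j + 1 else j) q' := by
  have hval : zetaE.eval σ = zeta (table k (H.hyper w)) (j + 1) q := by
    have h1 := harr q hqlt
    have h2 := harr (q - 2 ^ j) ((Nat.sub_le _ _).trans_lt hqlt)
    rw [if_neg (lt_irrefl q)] at h1
    rw [zetaE, eval_add, eval_mul, eval_arr, eval_arr, eval_bit, eval_sub, eval_two, eval_var,
      eval_var, hq, hj, h1, zeta]
    -- If the bit is set, the second entry read lies below `q` and is already at stage `j + 1`,
    -- which by `zeta_succ_sub` equals stage `j`. If not, the index is meaningless, but the factor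
    -- is `0`.
    by_cases hb : q.testBit j = true
    · have h3 : q - 2 ^ j < q := by
        have h4 := Nat.ge_two_pow_of_testBit hb
        have : 0 < 2 ^ j := by positivity
        omega
      rw [if_pos h3, zeta_succ_sub _ hb] at h2
      rw [h2, if_pos hb, if_pos hb, one_mul]
    · rw [if_neg hb, if_neg hb, zero_mul]
  refine Triple.write h.bdd hD 3 rfl rfl ?_
  rw [hval, eval_var, hq]
  refine ⟨hq, hj, h.setArr _ ((zeta_table_le _ hlt q).trans (two_pow_sub_le hk hs)),
    fun q' hq' => ?_⟩
  rw [St.setArr_arr]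
  by_cases e : q' = q
  · subst e
    rw [if_pos ⟨rfl, rfl⟩, if_pos (by omega)]
  · rw [if_neg (by simp [e]), harr q' hq']
    by_cases h1 : q' < q
    · rw [if_pos h1, if_pos (by omega)]
    · rw [if_neg h1, if_neg (by omega)]

/-- The time bound for one stage of the zeta transform, with `F` masks. -/
def zetaTime (k F s : ℕ) : ℕ := k * F * (writeTime (.var 17) zetaE s + 4 * s + 10) + 2 * s + 10

theorem two_pow_free_le {d : Hyper} (hs : coverBd k d.n d.m ≤ s) :
    k * 2 ^ d.free ≤ 2 ^ s := by
  calc k * 2 ^ d.free ≤ 2 ^ k * 2 ^ d.free := Nat.mul_le_mul_right _ Nat.lt_two_pow_self.le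
    _ = 2 ^ (k + d.free) := (pow_add _ _ _).symm
    _ ≤ 2 ^ s := Nat.pow_le_pow_right two_pos (by
      have := free_le d
      unfold coverBd at hs
      omega)

theorem triple_zetaStage (hD : D ≤ 2 ^ s) (hk : 0 < k)
    (hs : coverBd k (H.hyper w).n (H.hyper w).m ≤ s)
    (h : TableEnv H k w s σ) {j : ℕ} (hj : σ.var 9 = j) (hlt : j < (H.hyper w).free)
    (harr : ∀ q', q' < k * 2 ^ (H.hyper w).free →
      σ.arr 3 q' = zeta (table k (H.hyper w)) j q') :
    Triple D (.for_ 17 21 (.write 3 (.var 17) zetaE)) σ (zetaTime k (2 ^ (H.hyper w).free) s)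
      fun σ' => σ'.var 9 = j ∧ TableEnv H k w s σ' ∧
        ∀ q', q' < k * 2 ^ (H.hyper w).free →
          σ'.arr 3 q' = zeta (table k (H.hyper w)) (j + 1) q' := by
  have hF := two_pow_free_le hs
  refine (Triple.for_ (by omega) h.len hF (fun q σ' => σ'.var 9 = j ∧ TableEnv H k w s σ' ∧
      ∀ q', q' < k * 2 ^ (H.hyper w).free →
        σ'.arr 3 q' = zeta (table k (H.hyper w)) (if q' < q then j + 1 else j) q') ?_ ?_).conseq
      le_rfl ?_
  · exact ⟨by simp [St.setVar_var, hj], h.setVar (by omega) (Nat.zero_le _) (by omega),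
      fun q' hq' => by rw [if_neg (Nat.not_lt_zero _)]; exact harr q' hq'⟩
  · rintro q hq σ' ⟨hj', h', harr'⟩ hq' -
    refine (triple_zeta hD hk hs h' hq' hj' hlt harr' hq).conseq le_rfl ?_
    rintro σ'' ⟨hq2, hj2, h2, harr2⟩
    exact ⟨hq2, h2.len, by simp [St.setVar_var, hj2],
      h2.setVar (by omega) (Nat.succ_le_of_lt (hq.trans_le hF)) (by omega), harr2⟩
  · rintro σ' ⟨hj', h', harr'⟩
    exact ⟨hj', h', fun q' hq' => by rw [harr' q' hq', if_pos hq']⟩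

/-! ### Accumulating the alternating sum -/

/-- The partial sums of the alternating sum. -/
noncomputable def partialSum (k N : ℕ) (A : ℕ → ℕ) (p t : ℕ) : ℕ :=
  ∑ Y ∈ (range t).filter fun Y => (N + (bits N Y).card) % 2 = p,
    ∏ i ∈ range k, A (i * 2 ^ N + Y)

theorem partialSum_succ (k N : ℕ) (A : ℕ → ℕ) (p t : ℕ) :
    partialSum k N A p (t + 1) = partialSum k N A p t +
      if (N + (bits N t).card) % 2 = p then ∏ i ∈ range k, A (i * 2 ^ N + t) else 0 := by
  unfold partialSum
  rw [range_add_one, filter_insert]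
  split_ifs
  · rw [sum_insert (by simp), add_comm]
  · rfl

theorem partialSum_zeta_le {d : Hyper} (hs : coverBd k d.n d.m ≤ s) {t : ℕ} (ht : t ≤ 2 ^ d.free)
    (p : ℕ) : partialSum k d.free (zeta (table k d) d.free) p t ≤ 2 ^ s := by
  have h1 : ∀ Y, ∏ i ∈ range k, zeta (table k d) d.free (i * 2 ^ d.free + Y) ≤
      2 ^ (k * (d.n + tableBd k d.n d.m)) := fun Y => by
    refine (prod_le_pow_card _ _ _ fun i _ => zeta_table_le d le_rfl _).trans ?_
    rw [card_range, ← pow_mul, mul_comm]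
  refine (sum_le_card_nsmul _ _ _ fun Y _ => h1 Y).trans ?_
  rw [smul_eq_mul]
  calc _ ≤ 2 ^ d.free * 2 ^ (k * (d.n + tableBd k d.n d.m)) :=
        Nat.mul_le_mul_right _ ((card_filter_le _ _).trans ((card_range t).le.trans ht))
    _ = 2 ^ (d.free + k * (d.n + tableBd k d.n d.m)) := (pow_add _ _ _).symm
    _ ≤ 2 ^ s := Nat.pow_le_pow_right two_pos (by
      have := free_le d
      unfold coverBd at hs
      omega)

/-- The time bound for the accumulation of one product. -/
def accTime (k s : ℕ) : ℕ :=
  (Expr.mod (.add (.var 3) (popE (.var 17))) (.cst 2)).tm s +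
    (Expr.mod (.add (.var 3) (popE (.var 17))) (.cst 2)).bd s + 2 +
    (assignTime (.add (.var 23) (prodE k)) s + assignTime (.add (.var 22) (prodE k)) s)

/-- The state during the summation. -/
structure SumEnv (H : HyperExpr) (k : ℕ) (w : ℕ → ℕ) (s t : ℕ) (σ : St) : Prop
    extends TableEnv H k w s σ where
  arr : ∀ q, q < k * 2 ^ (H.hyper w).free →
    σ.arr 3 q = zeta (table k (H.hyper w)) (H.hyper w).free q
  even : σ.var 22 =
    partialSum k (H.hyper w).free (zeta (table k (H.hyper w)) (H.hyper w).free) 0 t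
  odd : σ.var 23 =
    partialSum k (H.hyper w).free (zeta (table k (H.hyper w)) (H.hyper w).free) 1 t

theorem triple_accumulate (hD : D ≤ 2 ^ s) (hs : coverBd k (H.hyper w).n (H.hyper w).m ≤ s)
    {t : ℕ} (h : SumEnv H k w s t σ) (ht : σ.var 17 = t) (hlt : t < 2 ^ (H.hyper w).free) :
    Triple D (accumulate k) σ (accTime k s) fun σ' =>
      σ'.var 17 = t ∧ SumEnv H k w s (t + 1) σ' := by
  set N := (H.hyper w).free with hN
  set A := zeta (table k (H.hyper w)) N with hA
  have hprod : (prodE k).eval σ = ∏ i ∈ range k, A (i * 2 ^ N + t) := by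
    rw [prodE, eval_prod, eval_cst]
    refine prod_congr rfl fun i hi => ?_
    have hi' := mem_range.1 hi
    rw [eval_arr, eval_add, eval_mul, eval_var, eval_var, eval_var, St.setVar_var, St.setVar_var,
      St.setVar_var, if_pos rfl, if_neg (by omega), if_neg (by omega), h.pow, ht, St.setVar_arr]
    refine h.arr _ ?_
    calc i * 2 ^ N + t < i * 2 ^ N + 2 ^ N := by omega
      _ = (i + 1) * 2 ^ N := by ring
      _ ≤ k * 2 ^ N := Nat.mul_le_mul_right _ hi'
  have hcond : (Expr.mod (.add (.var 3) (popE (.var 17))) (.cst 2)).eval σ =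
      (N + (bits N t).card) % 2 := by
    rw [eval_mod, eval_add, h.env.eval_popE (by omega), eval_var, eval_cst, h.env.free, ht]
  have hle : ∀ p, partialSum k N A p (t + 1) ≤ 2 ^ s := fun p =>
    partialSum_zeta_le hs (Nat.succ_le_of_lt hlt) p
  refine Triple.cond h.bdd hD rfl ?_ ?_
  · intro hne
    rw [hcond] at hne
    have hp : (N + (bits N t).card) % 2 = 1 := by omega
    have e1 := partialSum_succ k N A 1 t
    have e0 := partialSum_succ k N A 0 t
    rw [if_pos hp] at e1
    rw [if_neg (by omega)] at e0
    refine (Triple.assign h.bdd hD 23 (e := .add (.var 23) (prodE k)) rfl ?_).conseq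
      (Nat.le_add_right _ _) fun _ => id
    rw [eval_add, hprod, eval_var, h.odd, ← e1]
    refine ⟨by simp [St.setVar_var, ht], h.toTableEnv.setVar (by omega) (hle 1) (by omega), h.arr,
      ?_, ?_⟩
    · rw [St.setVar_var, if_neg (by omega), e0, h.even, add_zero]
    · rw [St.setVar_var, if_pos rfl]
  · intro hz
    rw [hcond] at hz
    have e1 := partialSum_succ k N A 1 t
    have e0 := partialSum_succ k N A 0 t
    rw [if_neg (by omega)] at e1
    rw [if_pos hz] at e0
    refine (Triple.assign h.bdd hD 22 (e := .add (.var 22) (prodE k)) rfl ?_).conseq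
      (Nat.le_add_left _ _) fun _ => id
    rw [eval_add, hprod, eval_var, h.even, ← e0]
    refine ⟨by simp [St.setVar_var, ht], h.toTableEnv.setVar (by omega) (hle 0) (by omega), h.arr,
      ?_, ?_⟩
    · rw [St.setVar_var, if_pos rfl]
    · rw [St.setVar_var, if_neg (by omega), e1, h.odd, add_zero]

/-- The product of the table entries of a cover is a power of the base whose exponent is the total
weight. This is a product of generating functions, evaluated at the base. -/
theorem sub_partialSum_eq (d : Hyper) :
    partialSum k d.free (zeta (table k d) d.free) 0 (2 ^ d.free) -
      partialSum k d.free (zeta (table k d) d.free) 1 (2 ^ d.free) =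
    ∑ X ∈ covers k (range d.free), 2 ^ ((k * d.free + 1) *
      ∑ i : Fin k, (d.inside (d.InClass i (code (X i))) +
        (k * d.m + 1) * (d.free - (X i).card))) := by
  refine (altSum_sub_altSum k d.free (table k d)).trans (sum_congr rfl fun X hX => ?_)
  rw [mul_sum, ← prod_pow_eq_pow_sum]
  refine prod_congr rfl fun i _ => ?_
  have hXi : X i ⊆ range d.free := by
    have := Fintype.mem_piFinset.1 (mem_filter.1 hX).1 i
    exact mem_powerset.1 this
  have hlt := code_lt hXi
  rw [table, weight, mul_comm (i : ℕ), Nat.mul_add_mod, Nat.mul_add_div (by positivity),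
    Nat.mod_eq_of_lt hlt, Nat.div_eq_of_lt hlt, add_zero, bits_code hXi]

/-- The time bound for the algorithm, up to the factor `2 ^ free`. -/
def coverTime (H : HyperExpr) (k s : ℕ) : ℕ :=
  H.preludeTime s + (assignTime (.two (.var 3)) s + (assignTime (.mul (.cst k) (.var 16)) s +
    ((k * (initTime H k s + 4 * s + 10) + 2 * s + 10) +
    ((s * (zetaTime k 1 s + 4 * s + 10) + 2 * s + 10) +
    (assignTime (.cst 0) s + (assignTime (.cst 0) s +
    (((accTime k s + 4 * s + 10) + 2 * s + 10) + assignTime (answerE k) s)))))))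

theorem polyBdd_coverTime : PolyBdd (coverTime H k) := by
  have hinit : PolyBdd (initTime H k) :=
    (polyBdd_assignTime _).add ((polyBdd_assignTime _).add (polyBdd_writeTime _ _))
  have hlin : ∀ a, PolyBdd fun s => a * s := fun a => .mul (.const a) .id
  have hzeta : PolyBdd (zetaTime k 1) :=
    (((PolyBdd.const (k * 1)).mul (((polyBdd_writeTime _ _).add (hlin 4)).add (.const 10))).add
      (hlin 2)).add (.const 10)
  have hacc : PolyBdd (accTime k) :=
    (((polyBdd_tm _).add (polyBdd_bd _)).add (.const 2)).add
      ((polyBdd_assignTime _).add (polyBdd_assignTime _))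
  exact H.polyBdd_preludeTime.add ((polyBdd_assignTime _).add ((polyBdd_assignTime _).add
    (((((PolyBdd.const k).mul ((hinit.add (hlin 4)).add (.const 10))).add (hlin 2)).add
      (.const 10)).add
    ((((PolyBdd.id.mul ((hzeta.add (hlin 4)).add (.const 10))).add (hlin 2)).add (.const 10)).add
    ((polyBdd_assignTime _).add ((polyBdd_assignTime _).add
    (((((hacc.add (hlin 4)).add (.const 10)).add (hlin 2)).add (.const 10)).add
      (polyBdd_assignTime _))))))))

/-- The loops over masks run at most `k * F` times, the loop over the bits at most `s` times, and
all else is only enlarged by the factor `F`. -/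
theorem time_le {F N s k i z a p q r t u v : ℕ} (hF : 0 < F) (hN : N ≤ s) :
    p + (q + (r + ((k * F * (i + 4 * s + 10) + 2 * s + 10) +
      ((N * ((k * F * (z + 4 * s + 10) + 2 * s + 10) + 4 * s + 10) + 2 * s + 10) +
      (t + (u + ((F * (a + 4 * s + 10) + 2 * s + 10) + v))))))) ≤
    F * (p + (q + (r + ((k * (i + 4 * s + 10) + 2 * s + 10) +
      ((s * ((k * 1 * (z + 4 * s + 10) + 2 * s + 10) + 4 * s + 10) + 2 * s + 10) +
      (t + (u + (((a + 4 * s + 10) + 2 * s + 10) + v)))))))) := by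
  have h : ∀ y, y ≤ F * y := fun y => Nat.le_mul_of_pos_left y hF
  simp only [mul_add F]
  have h1 : k * F * (i + 4 * s + 10) = F * (k * (i + 4 * s + 10)) := by ring
  have h2 : N * ((k * F * (z + 4 * s + 10) + 2 * s + 10) + 4 * s + 10) ≤
      F * (s * ((k * 1 * (z + 4 * s + 10) + 2 * s + 10) + 4 * s + 10)) := by
    rw [Nat.mul_left_comm]
    refine Nat.mul_le_mul hN ?_
    rw [mul_one, mul_add F, mul_add F, mul_add F, mul_add F]
    have h3 : k * F * (z + 4 * s + 10) = F * (k * (z + 4 * s + 10)) := by ring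
    have := h (2 * s)
    have := h 10
    have := h (4 * s)
    omega
  have h3 := h (2 * s)
  have h4 := h 10
  have := h p
  have := h q
  have := h r
  have := h t
  have := h u
  have := h v
  rw [h1]
  omega

open Classical in
theorem triple_coverProg (hk : 0 < k) (hw : ∀ i, w i ≤ 2 ^ s) (hD : D ≤ 2 ^ s)
    (hs : coverBd k (H.hyper w).n (H.hyper w).m ≤ s)
    (hcol : ∀ v < (H.hyper w).n, (H.hyper w).col v ≤ k) :
    Triple D (H.coverProg k) (St.start w) (2 ^ (H.hyper w).free * coverTime H k s) fun σ =>
      σ.var 0 =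
        if ∃ χ, (H.hyper w).IsColoring k χ ∧ H.thr w ≤ (H.hyper w).mono χ then 1 else 0 := by
  have hn : w 0 ≤ s := by
    have h : (H.hyper w).n ≤ s := by unfold coverBd at hs; omega
    exact h
  have hm : H.sizeFn (w 0) + 1 ≤ s := by
    have h : (H.hyper w).m + 1 ≤ s := by unfold coverBd at hs; omega
    exact h
  have hfree : (H.hyper w).free ≤ s := (free_le _).trans hn
  have hF := two_pow_free_le hs
  have hF1 : 2 ^ (H.hyper w).free ≤ 2 ^ s := Nat.pow_le_pow_right two_pos hfree
  refine Triple.conseq ?_ (time_le (p := H.preludeTime s) (by positivity) hfree) fun _ => id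
  refine .seq (H.triple_prelude hw hD hn hm) ?_
  rintro σ0 ⟨henv, hb, -⟩
  refine .seq (Triple.assign hb hD 16 rfl (Q := fun σ => H.Env w σ ∧ Bdd s σ ∧
    σ.var 16 = 2 ^ (H.hyper w).free) ?_) ?_
  · rw [eval_two, eval_var, henv.free]
    exact ⟨henv.setVar _ (by omega), hb.setVar hF1 (by omega), by simp [St.setVar_var]⟩
  rintro σ1 ⟨henv1, hb1, hp1⟩
  refine .seq (Triple.assign hb1 hD 21 rfl (Q := TableEnv H k w s) ?_) ?_
  · rw [eval_mul, eval_var, eval_cst, hp1]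
    exact ⟨henv1.setVar _ (by omega), hb1.setVar hF (by omega), by simp [St.setVar_var, hp1],
      by simp [St.setVar_var]⟩
  intro σ2 h2
  refine .seq (Triple.for_ (by omega) h2.len hF (T := initTime H k s) (fun t σ =>
    TableEnv H k w s σ ∧ ∀ q < t, σ.arr 3 q = table k (H.hyper w) q) ?_ ?_) ?_
  · exact ⟨h2.setVar (by omega) (Nat.zero_le _) (by omega), by omega⟩
  · rintro q hq σ ⟨h, harr⟩ hσq -
    refine (triple_initTable hD hs h hσq hq harr).conseq le_rfl ?_
    rintro σ' ⟨hq', h', harr'⟩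
    exact ⟨hq', h'.len, h'.setVar (by omega) (Nat.succ_le_of_lt (hq.trans_le hF)) (by omega),
      harr'⟩
  rintro σ3 ⟨h3, harr3⟩
  refine .seq (Triple.for_ (by omega) h3.env.free (hfree.trans Nat.lt_two_pow_self.le)
    (T := zetaTime k (2 ^ (H.hyper w).free) s) (fun j σ =>
    TableEnv H k w s σ ∧ ∀ q < k * 2 ^ (H.hyper w).free,
      σ.arr 3 q = zeta (table k (H.hyper w)) j q) ?_ ?_) ?_
  · exact ⟨h3.setVar (by omega) (Nat.zero_le _) (by omega), harr3⟩
  · rintro j hj σ ⟨h, harr⟩ hσj -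
    refine (triple_zetaStage hD hk hs h hσj hj harr).conseq le_rfl ?_
    rintro σ' ⟨hj', h', harr'⟩
    have hjs : j + 1 ≤ s := Nat.succ_le_of_lt (hj.trans_le hfree)
    exact ⟨hj', h'.env.free, h'.setVar (by omega) (hjs.trans Nat.lt_two_pow_self.le) fun _ => hjs,
      harr'⟩
  rintro σ4 ⟨h4, harr4⟩
  refine .seq (Triple.assign h4.bdd hD 22 rfl (Q := fun σ => TableEnv H k w s σ ∧
    (∀ q < k * 2 ^ (H.hyper w).free,
      σ.arr 3 q = zeta (table k (H.hyper w)) (H.hyper w).free q) ∧ σ.var 22 = 0) ?_) ?_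
  · exact ⟨h4.setVar (by omega) (Nat.zero_le _) (by omega), harr4, by simp [St.setVar_var, eval_cst]⟩
  rintro σ5 ⟨h5, harr5, hpos5⟩
  refine .seq (Triple.assign h5.bdd hD 23 rfl (Q := SumEnv H k w s 0) ?_) ?_
  · exact ⟨h5.setVar (by omega) (Nat.zero_le _) (by omega), harr5,
      by simp [St.setVar_var, hpos5, partialSum], by simp [St.setVar_var, eval_cst, partialSum]⟩
  intro σ6 h6
  refine .seq (Triple.for_ (by omega) h6.pow hF1 (T := accTime k s)
    (fun t σ => SumEnv H k w s t σ) ?_ ?_) ?_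
  · exact ⟨h6.toTableEnv.setVar (by omega) (Nat.zero_le _) (by omega), h6.arr,
      by simp [St.setVar_var, h6.even], by simp [St.setVar_var, h6.odd]⟩
  · intro t ht σ h hσt _
    refine (triple_accumulate hD hs h hσt ht).conseq le_rfl ?_
    rintro σ' ⟨ht', h'⟩
    exact ⟨ht', h'.pow, h'.toTableEnv.setVar (by omega) (Nat.succ_le_of_lt (ht.trans_le hF1))
      (by omega), h'.arr, by simp [St.setVar_var, h'.even], by simp [St.setVar_var, h'.odd]⟩
  intro σ7 h7
  refine Triple.assign h7.bdd hD 0 rfl ?_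
  -- The exponent of the base is `k * free + 1`, just above the bound `k * free` for the logarithm
  -- of the number of covers.
  have hiff := (two_pow_le_sum_covers_iff (k := k) (N := (H.hyper w).free)
    (Nat.lt_succ_self _) _).trans (Hyper.exists_cover_iff hk hcol (H.thr w))
  rw [← sub_partialSum_eq] at hiff
  rw [St.setVar_var, if_pos rfl, answerE, eval_le_ite]
  simp only [eval_two, eval_mul, eval_add, eval_sub, eval_var, eval_cst, baseE, penaltyE,
    h7.env.free, h7.env.m, h7.env.thr, h7.even, h7.odd]
  split_ifs with h1 h2 h2
  · rfl
  · exact absurd (hiff.1 h1) h2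
  · exact absurd (hiff.2 h2) h1
  · rfl

end HappyColoring.HyperExpr

namespace HappyColoring.HyperExpr

open Finset RAM Expr

variable (H : HyperExpr)

/-! ### Three colors: the matching for the two remaining colors -/

/-- The hyperedge in variable `x` can get the color after the color in variable `10`, or the one
after that. -/
def canE (c x : ℕ) : Expr := H.withinE x (freeE (.mod (.add (.var 10) (.cst c)) (.cst 3)))

/-- The hyperedges in the variables `x` and `y` are in conflict. -/
def conflictE (x y : ℕ) : Expr :=
  .mul (H.canE 1 x) (.mul (H.canE 2 y)
    (.ex 6 (.var 1) (.mul (H.mem (.var x) (.var 6)) (H.mem (.var y) (.var 6)))))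

/-- The bidder in variable `11` can bid for the item in variable `12`. -/
def bidsE : Expr :=
  .mul (H.conflictE 11 12) <|
    .mul (.not (.ex 13 (.var 2) (.eq (.arr 0 (.var 13)) (.add (.var 11) (.cst 1))))) <|
    .mul (.le (.arr 1 (.var 12)) (.var 2)) <|
      .all 13 (.var 2) (.or (.not (H.conflictE 11 13))
        (.le (.arr 1 (.var 12)) (.arr 1 (.var 13))))

/-- One round of the auction. -/
def auctionRound : Prog :=
  .seq (.assign 11 (.mod (.div (.var 9) (.var 2)) (.var 2))) <|
    .seq (.assign 12 (.mod (.var 9) (.var 2))) <|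
    .cond H.bidsE (.seq (.write 0 (.var 12) (.add (.var 11) (.cst 1)))
      (.write 1 (.var 12) (.add (.arr 1 (.var 12)) (.cst 1)))) .skip

/-- The number of rounds of the auction. -/
def roundsE : Expr :=
  .mul (.add (.mul (.var 2) (.add (.var 2) (.cst 1))) (.cst 1)) (.mul (.var 2) (.var 2))

/-- The auction that computes a maximum matching of the conflict graph. -/
def auctionProg : Prog :=
  .seq (.for_ 12 2 (.seq (.write 0 (.var 12) (.cst 0)) (.write 1 (.var 12) (.cst 0)))) <|
    .seq (.assign 14 roundsE) (.for_ 9 14 H.auctionRound)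

variable {H} {w : ℕ → ℕ} {D s : ℕ} {σ : St}

theorem Env.holds_canE (h : H.Env w σ) (c : ℕ) {x : ℕ} (hx : x ≠ 6) :
    (H.canE c x).Holds σ ↔
      (H.hyper w).CanBe (σ.var 20) ((σ.var 10 + c) % 3) (σ.var x) := by
  refine h.holds_withinE hx fun v => ?_
  rw [holds_freeE (H := H) (σ := σ.setVar 6 v) h.inp, eval_mod, eval_add, eval_var, eval_cst,
    eval_cst]
  simp [St.setVar_var]

/-- `Conflict` also requires both indices to be below `m`. The expression does not test this; it is
used only where the indices are known to be in range. -/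
theorem Env.holds_conflictE (h : H.Env w σ) {x y : ℕ} (hx : x ≠ 6) (hy : y ≠ 6)
    (hxm : σ.var x < (H.hyper w).m) (hym : σ.var y < (H.hyper w).m) :
    (H.conflictE x y).Holds σ ↔
      (H.hyper w).Conflict (σ.var 10) (σ.var 20) (σ.var x) (σ.var y) := by
  have he : ∀ v, (Expr.mul (H.mem (.var x) (.var 6)) (H.mem (.var y) (.var 6))).Holds
      (σ.setVar 6 v) ↔ (H.hyper w).mem (σ.var x) v ∧ (H.hyper w).mem (σ.var y) v := fun v => by
    rw [holds_mul, (h.setVar v (by omega)).holds_mem, (h.setVar v (by omega)).holds_mem, eval_var,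
      eval_var, eval_var, St.setVar_var, St.setVar_var, St.setVar_var, if_pos rfl, if_neg hx,
      if_neg hy]
  rw [conflictE, holds_mul, holds_mul, h.holds_canE 1 hx, h.holds_canE 2 hy, holds_ex, eval_var,
    h.n, Hyper.Conflict]
  simp only [he, hxm, hym, true_and]
  rfl

theorem canE_ok (c x : ℕ) : (H.canE c x).ok = true := by
  have h := H.mem_ok (.var x) (.var 6) rfl rfl
  simp [canE, withinE, freeE, Expr.ok, h, colE, maskE, rankE, Expr.small]

theorem conflictE_ok (x y : ℕ) : (H.conflictE x y).ok = true := by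
  have h1 := H.mem_ok (.var x) (.var 6) rfl rfl
  have h2 := H.mem_ok (.var y) (.var 6) rfl rfl
  simp [conflictE, Expr.ok, h1, h2, canE_ok, Expr.small]

theorem bidsE_ok : H.bidsE.ok = true := by
  simp [bidsE, Expr.ok, conflictE_ok, Expr.small]

/-- The arrays `0` and `1` hold the state of the auction. -/
def Holding (m : ℕ) (a : Auction) (σ : St) : Prop :=
  ∀ r < m, σ.arr 0 r = a.owner r ∧ σ.arr 1 r = a.price r

theorem Env.holds_bidsE (h : H.Env w σ) {a : Auction} (ha : Holding (H.hyper w).m a σ)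
    (hl : σ.var 11 < (H.hyper w).m) (hr : σ.var 12 < (H.hyper w).m) :
    H.bidsE.Holds σ ↔ Auction.Bids (H.hyper w).m
      ((H.hyper w).Conflict (σ.var 10) (σ.var 20)) a (σ.var 11) (σ.var 12) := by
  have hm : σ.var 2 = (H.hyper w).m := h.m
  rw [bidsE, holds_mul, h.holds_conflictE (by omega) (by omega) hl hr, holds_mul, holds_not,
    holds_ex, holds_mul, holds_le, holds_all, eval_var, eval_arr, eval_var, hm, (ha _ hr).2]
  refine and_congr_right fun _ => and_congr (not_congr (exists_congr fun r =>
    and_congr_right fun hrm => ?_)) (and_congr_right fun _ => forall₂_congr fun r hrm => ?_)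
  · rw [holds_eq, eval_arr, eval_add, eval_var, eval_var, eval_cst, St.setVar_var, St.setVar_var,
      if_pos rfl, if_neg (by omega), St.setVar_arr, (ha r hrm).1]
  · have e13 : (σ.setVar 13 r).var 13 = r := by simp [St.setVar_var]
    have e11 : (σ.setVar 13 r).var 11 = σ.var 11 := by simp [St.setVar_var]
    have e12 : (σ.setVar 13 r).var 12 = σ.var 12 := by simp [St.setVar_var]
    have e10 : (σ.setVar 13 r).var 10 = σ.var 10 := by simp [St.setVar_var]
    have e20 : (σ.setVar 13 r).var 20 = σ.var 20 := by simp [St.setVar_var]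
    rw [holds_or, holds_not, (h.setVar r (by omega)).holds_conflictE (by omega) (by omega)
      (by rw [e11]; exact hl) (by rw [e13]; exact hrm), holds_le, eval_arr, eval_arr, eval_var,
      eval_var, e13, e11, e12, e10, e20, St.setVar_arr, (ha r hrm).2, (ha _ hr).2]
    exact imp_iff_not_or.symm

/-- The states agree apart from the variables and arrays that the auction uses. -/
structure Agree (σ σ' : St) : Prop where
  var : ∀ x, x ≠ 9 → x ≠ 11 → x ≠ 12 → x ≠ 14 → σ'.var x = σ.var x
  arr : σ'.arr 3 = σ.arr 3
  inp : σ'.inp = σ.inp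

theorem Agree.refl (σ : St) : Agree σ σ := ⟨fun _ _ _ _ _ => rfl, rfl, rfl⟩

theorem Agree.setVar {σ' : St} (h : Agree σ σ') {x : ℕ} (v : ℕ)
    (hx : x = 9 ∨ x = 11 ∨ x = 12 ∨ x = 14) : Agree σ (σ'.setVar x v) where
  var y h1 h2 h3 h4 := by rw [St.setVar_var, if_neg (by omega), h.var y h1 h2 h3 h4]
  arr := h.arr
  inp := h.inp

theorem Agree.setArr {σ' : St} (h : Agree σ σ') {a : Fin 4} (i v : ℕ) (ha : a ≠ 3) :
    Agree σ (σ'.setArr a i v) where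
  var := h.var
  arr := by
    funext j
    rw [St.setArr_arr, if_neg (fun e => ha e.1.symm), h.arr]
  inp := h.inp

theorem Agree.env {σ' : St} (h : Agree σ σ') (he : H.Env w σ) : H.Env w σ' where
  inp := h.inp.trans he.inp
  n := (h.var 1 (by omega) (by omega) (by omega) (by omega)).trans he.n
  m := (h.var 2 (by omega) (by omega) (by omega) (by omega)).trans he.m
  free := (h.var 3 (by omega) (by omega) (by omega) (by omega)).trans he.free
  thr := (h.var 4 (by omega) (by omega) (by omega) (by omega)).trans he.thr

/-- The number of rounds of the auction. -/
def rounds (m : ℕ) : ℕ := (m * (m + 1) + 1) * (m * m)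

/-- The time bound for a round of the auction. -/
def roundTime (H : HyperExpr) (s : ℕ) : ℕ :=
  assignTime (.mod (.div (.var 9) (.var 2)) (.var 2)) s + (assignTime (.mod (.var 9) (.var 2)) s +
    (H.bidsE.tm s + H.bidsE.bd s + 2 + (writeTime (.var 12) (.add (.var 11) (.cst 1)) s +
      writeTime (.var 12) (.add (.arr 1 (.var 12)) (.cst 1)) s + 1)))

theorem triple_auctionRound {σ₀ : St} (hD : D ≤ 2 ^ s) (he₀ : H.Env w σ₀) (ha : Agree σ₀ σ)
    (hb : Bdd s σ) (hm : 0 < (H.hyper w).m) (hs : (H.hyper w).m + 1 ≤ s) {t : ℕ}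
    (ht : σ.var 9 = t)
    (hh : Holding (H.hyper w).m (Auction.run (H.hyper w).m
      ((H.hyper w).Conflict (σ₀.var 10) (σ₀.var 20)) t) σ) :
    Triple D H.auctionRound σ (roundTime H s) fun σ' =>
      σ'.var 9 = t ∧ σ'.var 14 = σ.var 14 ∧ Agree σ₀ σ' ∧ Bdd s σ' ∧
        Holding (H.hyper w).m (Auction.run (H.hyper w).m
          ((H.hyper w).Conflict (σ₀.var 10) (σ₀.var 20)) (t + 1)) σ' := by
  set m := (H.hyper w).m with hmdef
  set adj := (H.hyper w).Conflict (σ₀.var 10) (σ₀.var 20) with hadj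
  have hinv := Auction.inv_run (adj := adj) hm (t + 1)
  set σ1 := σ.setVar 11 (t / m % m) with h1
  set σ2 := σ1.setVar 12 (t % m) with h2
  have hl := Nat.mod_lt (t / m) hm
  have hr := Nat.mod_lt t hm
  have hb1 : Bdd s σ1 := hb.setSmall (by omega)
  have hb2 : Bdd s σ2 := hb1.setSmall (by omega)
  have hv2 : σ.var 2 = m := (ha.env he₀).m
  have ha2 : Agree σ₀ σ2 := (ha.setVar _ (by omega)).setVar _ (by omega)
  refine .seq (Triple.assign hb hD 11 rfl (Q := fun σ' => σ' = σ1) ?_) ?_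
  · rw [eval_mod, eval_div, eval_var, eval_var, ht, hv2]
  rintro _ rfl
  refine .seq (Triple.assign hb1 hD 12 rfl (Q := fun σ' => σ' = σ2) ?_) ?_
  · rw [eval_mod, eval_var, eval_var, h1, St.setVar_var, St.setVar_var, if_neg (by omega),
      if_neg (by omega), ht, hv2]
  rintro _ rfl
  have e11 : σ2.var 11 = t / m % m := by simp [h2, h1, St.setVar_var]
  have e12 : σ2.var 12 = t % m := by simp [h2, St.setVar_var]
  have e10 : σ2.var 10 = σ₀.var 10 := ha2.var 10 (by omega) (by omega) (by omega) (by omega)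
  have e20 : σ2.var 20 = σ₀.var 20 := ha2.var 20 (by omega) (by omega) (by omega) (by omega)
  have e9 : σ2.var 9 = t := by simp [h2, h1, St.setVar_var, ht]
  have e14 : σ2.var 14 = σ.var 14 := by simp [h2, h1, St.setVar_var]
  have hh2 : Holding m (Auction.run m adj t) σ2 := hh
  have hbids := (ha2.env he₀).holds_bidsE hh2 (by rw [e11]; exact hl) (by rw [e12]; exact hr)
  rw [e10, e20, e11, e12] at hbids
  refine Triple.cond hb2 hD bidsE_ok (fun hc => ?_) fun hc => ?_
  · have hrun : Auction.run m adj (t + 1) = (Auction.run m adj t).give (t / m % m) (t % m) := by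
      rw [Auction.run, Auction.step, if_pos (hbids.1 hc)]
    set σ3 := σ2.setArr 0 (t % m) (t / m % m + 1) with h3
    have hb3 : Bdd s σ3 := hb2.setArr ((by omega : _ ≤ s).trans Nat.lt_two_pow_self.le)
      fun _ => by omega
    refine Triple.conseq (.seq (Triple.write hb2 hD 0 (i := .var 12)
      (e := .add (.var 11) (.cst 1)) rfl rfl
      (Q := fun σ' => σ' = σ3) ?_) ?_) (Nat.le_succ _) fun _ => id
    · rw [eval_add, eval_var, eval_var, eval_cst, e11, e12]
    rintro _ rfl
    have hp : (Expr.add (.arr 1 (.var 12)) (.cst 1)).eval σ3 =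
        (Auction.run m adj t).price (t % m) + 1 := by
      rw [eval_add, eval_arr, eval_var, eval_cst, h3, St.setArr_arr, St.setArr_var, e12,
        if_neg (by simp), (hh2 _ hr).2]
    -- The invariant after the bid bounds the new price by `m + 1`, so the price array keeps small
    -- entries.
    have hp' : (Auction.run m adj t).price (t % m) + 1 ≤ s := by
      have := hinv.price_le (t % m)
      rw [hrun] at this
      simp only [Auction.give, Function.update_self] at this
      omega
    refine Triple.write hb3 hD 1 (i := .var 12) rfl rfl ?_
    rw [hp, eval_var, show σ3.var 12 = t % m from e12]
    refine ⟨e9, e14, (ha2.setArr _ _ (by decide)).setArr _ _ (by decide),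
      hb3.setArr (hp'.trans Nat.lt_two_pow_self.le) fun _ => hp', fun r hrm => ?_⟩
    rw [hrun]
    simp only [Auction.give, Function.update_apply, St.setArr_arr, h3]
    have := hh2 r hrm
    by_cases e : r = t % m
    · subst e; simp
    · simp [e, this]
  · refine (Triple.skip ?_).conseq (Nat.le_add_left _ _) fun _ => id
    have hrun : Auction.run m adj (t + 1) = Auction.run m adj t := by
      rw [Auction.run, Auction.step, if_neg (fun h => hbids.2 h hc)]
    exact ⟨e9, e14, ha2, hb2, by rw [hrun]; exact hh2⟩

/-- The time bound for the auction. -/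
def auctionTime (H : HyperExpr) (s : ℕ) : ℕ :=
  (s * (writeTime (.var 12) (.cst 0) s + writeTime (.var 12) (.cst 0) s + 4 * s + 10) +
    2 * s + 10) + (assignTime roundsE s + (s * (roundTime H s + 4 * s + 10) + 2 * s + 10))

theorem triple_auctionProg (hD : D ≤ 2 ^ s) (he : H.Env w σ) (hb : Bdd s σ)
    (hs : rounds (H.hyper w).m + (H.hyper w).m + 1 ≤ s) :
    Triple D H.auctionProg σ (auctionTime H s) fun σ' =>
      Agree σ σ' ∧ Bdd s σ' ∧ Holding (H.hyper w).m (Auction.run (H.hyper w).m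
          ((H.hyper w).Conflict (σ.var 10) (σ.var 20)) (rounds (H.hyper w).m)) σ' := by
  set m := (H.hyper w).m with hm
  set adj := (H.hyper w).Conflict (σ.var 10) (σ.var 20) with hadj
  have hms : m ≤ s := by omega
  have hrs : rounds m ≤ s := by omega
  have h2s : s ≤ 2 ^ s := Nat.lt_two_pow_self.le
  have for_le : ∀ {a T}, a ≤ s → a * (T + 4 * s + 10) + 2 * s + 10 ≤
      s * (T + 4 * s + 10) + 2 * s + 10 := fun {a T} ha => by
    have := Nat.mul_le_mul_right (T + 4 * s + 10) ha
    omega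
  -- The auction is run once for each color and mask, so what the previous run left in the two
  -- arrays has to be cleared.
  refine .seq ((Triple.for_ (by omega) he.m (hms.trans h2s) (fun t σ' => Agree σ σ' ∧ Bdd s σ' ∧
    ∀ r < t, σ'.arr 0 r = 0 ∧ σ'.arr 1 r = 0) ?_ ?_).conseq (for_le hms) fun _ => id) ?_
  · exact ⟨(Agree.refl σ).setVar _ (by omega), hb.setSmall (Nat.zero_le _), by omega⟩
  · rintro t ht σ1 ⟨ha1, hb1, hz1⟩ hv1 -
    refine .seq (Triple.write hb1 hD 0 (i := .var 12) (e := .cst 0) rfl rfl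
      (Q := fun σ' => σ' = σ1.setArr 0 t 0) ?_) ?_
    · rw [eval_var, hv1]; rfl
    rintro _ rfl
    have hb2 : Bdd s (σ1.setArr 0 t 0) := hb1.setArr (Nat.zero_le _) fun _ => Nat.zero_le _
    refine Triple.write hb2 hD 1 (i := .var 12) (e := .cst 0) rfl rfl ?_
    rw [eval_var, eval_cst, show (σ1.setArr 0 t 0).var 12 = t from hv1]
    have ha3 : Agree σ ((σ1.setArr 0 t 0).setArr 1 t 0) :=
      (ha1.setArr _ _ (by decide)).setArr _ _ (by decide)
    have hlt : t < m := ht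
    refine ⟨hv1, (ha3.env he).m, ha3.setVar _ (by omega),
      (hb2.setArr (Nat.zero_le _) fun _ => Nat.zero_le _).setSmall (by omega), fun r hr => ?_⟩
    simp only [St.setVar_arr, St.setArr_arr]
    by_cases e : r = t
    · simp [e]
    · simpa [e] using hz1 r (by omega)
  rintro σ1 ⟨ha1, hb1, hz1⟩
  refine .seq (Triple.assign hb1 hD 14 rfl (Q := fun σ' => Agree σ σ' ∧ Bdd s σ' ∧
    (∀ r < m, σ'.arr 0 r = 0 ∧ σ'.arr 1 r = 0) ∧ σ'.var 14 = rounds m) ?_) ?_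
  · have hev : roundsE.eval σ1 = rounds m := by
      simp only [roundsE, eval_mul, eval_add, eval_var, eval_cst, (ha1.env he).m]
      rfl
    rw [hev]
    exact ⟨ha1.setVar _ (by omega), hb1.setSmall hrs, hz1, by simp [St.setVar_var]⟩
  rintro σ2 ⟨ha2, hb2, hz2, hv2⟩
  refine (Triple.for_ (by omega) hv2 (hrs.trans h2s) (T := roundTime H s) (fun t σ' =>
    Agree σ σ' ∧ Bdd s σ' ∧ Holding m (Auction.run m adj t) σ') ?_ ?_).conseq (for_le hrs)
    fun _ => id
  · exact ⟨ha2.setVar _ (by omega), hb2.setSmall (Nat.zero_le _), hz2⟩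
  · rintro t ht σ3 ⟨ha3, hb3, hh3⟩ hv3 hv3'
    have hm0 : 0 < m := by
      rcases Nat.eq_zero_or_pos m with h0 | h0
      · rw [h0] at ht
        simp [rounds] at ht
      · exact h0
    refine (triple_auctionRound hD he ha3 hb3 hm0 (by omega) hv3 hh3).conseq le_rfl ?_
    rintro σ4 ⟨h1, h2, h3, h4, h5⟩
    exact ⟨h1, h2.trans hv3', h3.setVar _ (by omega), h4.setSmall (by omega), h5⟩

end HappyColoring.HyperExpr

namespace HappyColoring

open Finset RAM

/-! ### Enumeration of the small masks -/

/-- The first `c` entries of `a` enumerate the numbers that satisfy `P` without repetition. -/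
structure Lists (a : ℕ → ℕ) (c : ℕ) (P : ℕ → Prop) : Prop where
  inj : ∀ q < c, ∀ q' < c, a q = a q' → q = q'
  mem : ∀ X, (∃ q < c, a q = X) ↔ P X

theorem Lists.congr {a : ℕ → ℕ} {c : ℕ} {P Q : ℕ → Prop} (h : Lists a c P) (hPQ : ∀ X, P X ↔ Q X) :
    Lists a c Q := ⟨h.inj, fun X => (h.mem X).trans (hPQ X)⟩

theorem Lists.push {a b : ℕ → ℕ} {c X : ℕ} {P : ℕ → Prop} (h : Lists a c P) (hX : ¬ P X)
    (hb : ∀ q, b q = if q = c then X else a q) : Lists b (c + 1) fun Y => P Y ∨ Y = X where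
  inj q hq q' hq' heq := by
    rw [hb, hb] at heq
    split_ifs at heq with h1 h2 h2
    · rw [h1, h2]
    · exact absurd ((h.mem X).1 ⟨q', by omega, heq.symm⟩) hX
    · exact absurd ((h.mem X).1 ⟨q, by omega, heq⟩) hX
    · exact h.inj q (by omega) q' (by omega) heq
  mem Y := by
    rw [← h.mem Y]
    constructor
    · rintro ⟨q, hq, rfl⟩
      rw [hb]
      split_ifs with h1
      · exact Or.inr rfl
      · exact Or.inl ⟨q, by omega, rfl⟩
    · rintro (⟨q, hq, rfl⟩ | rfl)
      · exact ⟨q, by omega, by rw [hb, if_neg (by omega)]⟩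
      · exact ⟨c, by omega, by rw [hb, if_pos rfl]⟩

/-- The masks with at most `N / 3` bits. -/
def SmallMask (N X : ℕ) : Prop := 3 * (bits N X).card ≤ N

/-- A list of small masks without repetition is no longer than the number of small sets. This keeps
the enumeration within the time bound, where a pass through all `2 ^ N` masks would not be. -/
theorem Lists.length_le {N : ℕ} {a : ℕ → ℕ} {c : ℕ} {P : ℕ → Prop} (h : Lists a c P)
    (hP : ∀ X, P X → X < 2 ^ N ∧ SmallMask N X) : c ≤ (smallSets N).card := by
  rw [← card_range c]
  have ha : ∀ q < c, a q < 2 ^ N ∧ SmallMask N (a q) := fun q hq => hP _ ((h.mem _).1 ⟨q, hq, rfl⟩)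
  refine card_le_card_of_injOn (fun q => bits N (a q)) (fun q hq => ?_) fun q hq q' hq' heq => ?_
  · have hq := mem_range.1 (mem_coe.1 hq)
    exact mem_coe.2 (mem_filter.2 ⟨mem_powerset.2 (bits_subset _ _), (ha q hq).2⟩)
  · have hq := mem_range.1 (mem_coe.1 hq)
    have hq' := mem_range.1 (mem_coe.1 hq')
    refine h.inj q hq q' hq' ?_
    rw [← code_bits (ha q hq).1, ← code_bits (ha q' hq').1]
    exact congrArg code heq

theorem bits_add_two_pow {N X j : ℕ} (hX : X < 2 ^ j) (hj : j < N) :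
    bits N (X + 2 ^ j) = insert j (bits N X) := by
  have hXN : X < 2 ^ N := hX.trans (Nat.pow_lt_pow_right one_lt_two hj)
  have hs : insert j (bits N X) ⊆ range N :=
    insert_subset (mem_range.2 hj) (bits_subset _ _)
  have hn : j ∉ bits N X := fun h => by
    have := (mem_filter.1 h).2
    rw [Nat.testBit_lt_two_pow hX] at this
    exact absurd this (by simp)
  rw [← bits_code hs, code, sum_insert hn, ← code, code_bits hXN, add_comm]

theorem card_bits_add_two_pow {N X j : ℕ} (hX : X < 2 ^ j) (hj : j < N) :
    (bits N (X + 2 ^ j)).card = (bits N X).card + 1 := by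
  rw [bits_add_two_pow hX hj, card_insert_of_notMem]
  intro h
  have := (mem_filter.1 h).2
  rw [Nat.testBit_lt_two_pow hX] at this
  exact absurd this (by simp)

namespace HyperExpr

open Expr

/-- The condition for extending the mask in variable `20` by another bit. -/
def growE : Expr := .le (.mul (.cst 3) (.add (popE (.var 20)) (.cst 1))) (.var 3)

/-- Extend the mask with index `17` by the bit in variable `9`. -/
def growMask : Prog :=
  .seq (.assign 20 (.arr 3 (.var 17))) <|
    .cond growE (.seq (.write 3 (.var 18) (.add (.var 20) (.two (.var 9))))
      (.assign 18 (.add (.var 18) (.cst 1)))) .skip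

/-- Extend all masks by the bit in variable `9`. -/
def growAll : Prog := .seq (.assign 19 (.var 18)) (.for_ 17 19 growMask)

variable {H : HyperExpr} {w : ℕ → ℕ} {D s : ℕ} {σ : St}

/-- The time bound for extending a mask. -/
def growTime (s : ℕ) : ℕ :=
  assignTime (.arr 3 (.var 17)) s + (growE.tm s + growE.bd s + 2 +
    (writeTime (.var 18) (.add (.var 20) (.two (.var 9))) s +
      assignTime (.add (.var 18) (.cst 1)) s + 1))

/-- The masks that are listed when the bit `j` has been added to the first `t` entries of `a`. -/
def Grown (N j : ℕ) (a : ℕ → ℕ) (t X : ℕ) : Prop :=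
  X < 2 ^ j ∧ SmallMask N X ∨ ∃ q < t, X = a q + 2 ^ j ∧ SmallMask N X

/-- The state while the masks are extended by the bit `j`. -/
structure GrowEnv (H : HyperExpr) (w : ℕ → ℕ) (s j c : ℕ) (a : ℕ → ℕ) (t : ℕ) (σ : St) :
    Prop where
  env : H.Env w σ
  bdd : Bdd s σ
  bit : σ.var 9 = j
  len : σ.var 19 = c
  old : ∀ q < c, σ.arr 3 q = a q
  le : c ≤ σ.var 18
  lists : Lists (σ.arr 3) (σ.var 18) (Grown (H.hyper w).free j a t)

theorem card_smallSets_le_two_pow (N : ℕ) : (smallSets N).card ≤ 2 ^ N :=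
  (card_filter_le _ _).trans (by rw [card_powerset, card_range])

theorem Grown.lt {N j t X : ℕ} {a : ℕ → ℕ} (ha : ∀ q < t, a q < 2 ^ j) (hj : j < N)
    (h : Grown N j a t X) : X < 2 ^ N ∧ SmallMask N X := by
  have hle : 2 ^ (j + 1) ≤ 2 ^ N := Nat.pow_le_pow_right two_pos hj
  rw [pow_succ] at hle
  rcases h with ⟨h1, h2⟩ | ⟨q, hq, h1, h2⟩
  · exact ⟨by omega, h2⟩
  · have := ha q hq
    exact ⟨by omega, h2⟩

theorem GrowEnv.setVar {j c t : ℕ} {a : ℕ → ℕ} (h : GrowEnv H w s j c a t σ) {x v : ℕ}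
    (hx : x = 17 ∨ x = 20) (hv : v ≤ 2 ^ s) : GrowEnv H w s j c a t (σ.setVar x v) where
  env := h.env.setVar v (by omega)
  bdd := h.bdd.setVar hv (by omega)
  bit := by rw [St.setVar_var, if_neg (by omega), h.bit]
  len := by rw [St.setVar_var, if_neg (by omega), h.len]
  old := h.old
  le := by rw [St.setVar_var, if_neg (by omega)]; exact h.le
  lists := by rw [St.setVar_var, if_neg (by omega)]; exact h.lists

/-- New masks are appended behind the first `c` entries, which are the masks below `2 ^ j` and stay
as they are while the loop reads them. -/
theorem triple_growMask (hD : D ≤ 2 ^ s) (hs : (H.hyper w).free + 1 ≤ s) {j c t : ℕ} {a : ℕ → ℕ}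
    (hj : j < (H.hyper w).free) (ha : Lists a c fun X => X < 2 ^ j ∧ SmallMask (H.hyper w).free X)
    (h : GrowEnv H w s j c a t σ) (ht : σ.var 17 = t) (htc : t < c) :
    Triple D growMask σ (growTime s) fun σ' =>
      σ'.var 17 = t ∧ GrowEnv H w s j c a (t + 1) σ' := by
  set N := (H.hyper w).free with hN
  have haq : ∀ q < c, a q < 2 ^ j ∧ SmallMask N (a q) := fun q hq => (ha.mem _).1 ⟨q, hq, rfl⟩
  have hjN : 2 ^ (j + 1) ≤ 2 ^ N := Nat.pow_le_pow_right two_pos hj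
  have hNs : 2 ^ N + 2 ^ N ≤ 2 ^ s := by
    rw [← mul_two, ← pow_succ]
    exact Nat.pow_le_pow_right two_pos hs
  rw [pow_succ] at hjN
  have hat := haq t htc
  have h1 := h.setVar (x := 20) (v := a t) (by omega) (by omega)
  set σ1 := σ.setVar 20 (a t) with hσ1
  refine .seq (Triple.assign h.bdd hD 20 rfl (Q := fun σ' => σ' = σ1) ?_) ?_
  · rw [eval_arr, eval_var, ht, h.old t htc]
  rintro _ rfl
  have e17 : σ1.var 17 = t := by simp [hσ1, St.setVar_var, ht]
  have e20 : σ1.var 20 = a t := by simp [hσ1, St.setVar_var]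
  have hcond : growE.Holds σ1 ↔ SmallMask N (a t + 2 ^ j) := by
    rw [growE, holds_le, eval_mul, eval_add, h1.env.eval_popE (by omega), eval_cst, eval_cst,
      eval_var, h1.env.free, e20, SmallMask, card_bits_add_two_pow hat.1 hj]
  -- The list never exceeds the number of small sets, so its length and all indices into it fit into
  -- `s` bits.
  have hlen : ∀ {σ' : St} {t' : ℕ}, t' ≤ c →
      Lists (σ'.arr 3) (σ'.var 18) (Grown N j a t') → σ'.var 18 ≤ 2 ^ N := fun ht' hl =>
    (hl.length_le fun X hX => Grown.lt (fun q hq => (haq q (by omega)).1) hj hX).trans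
      (card_smallSets_le_two_pow N)
  refine Triple.cond h1.bdd hD rfl (fun hc => ?_) fun hc => ?_
  · have hsm := hcond.1 hc
    have hl18 := hlen htc.le h1.lists
    have hnew : ¬ Grown N j a t (a t + 2 ^ j) := by
      rintro (⟨h3, -⟩ | ⟨q, hq, h3, -⟩)
      · omega
      · have := ha.inj t htc q (by omega) (by omega)
        omega
    set σ2 := σ1.setArr 3 (σ1.var 18) (a t + 2 ^ j) with hσ2
    have hb2 : Bdd s σ2 := h1.bdd.setArr (by omega) (by simp)
    refine Triple.conseq (.seq (Triple.write h1.bdd hD 3 (i := .var 18)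
      (e := .add (.var 20) (.two (.var 9))) rfl rfl (Q := fun σ' => σ' = σ2) ?_) ?_)
      (Nat.le_succ _) fun _ => id
    · rw [eval_add, eval_two, eval_var, eval_var, eval_var, e20, h1.bit]
    rintro _ rfl
    refine Triple.assign hb2 hD 18 (e := .add (.var 18) (.cst 1)) rfl ?_
    rw [eval_add, eval_var, eval_cst]
    have e18 : σ2.var 18 = σ1.var 18 := rfl
    refine ⟨by simp [St.setVar_var, hσ2, e17], (h1.env.setArr _ _ _).setVar _ (by omega),
      hb2.setVar (by omega) (by omega), by simp [St.setVar_var, hσ2, h1.bit],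
      by simp [St.setVar_var, hσ2, h1.len], fun q hq => ?_, ?_, ?_⟩
    · rw [St.setVar_arr, hσ2, St.setArr_arr, if_neg, h1.old q hq]
      have := h1.le
      omega
    · rw [St.setVar_var, if_pos rfl, e18]
      exact h1.le.trans (Nat.le_succ _)
    · rw [St.setVar_var, if_pos rfl, e18]
      refine (h1.lists.push hnew fun q => ?_).congr fun X => ?_
      · rw [St.setVar_arr, hσ2, St.setArr_arr]
        simp
      · simp only [Grown]
        constructor
        · rintro ((h3 | ⟨q, hq, h3⟩) | rfl)
          · exact Or.inl h3
          · exact Or.inr ⟨q, by omega, h3⟩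
          · exact Or.inr ⟨t, by omega, rfl, hsm⟩
        · rintro (h3 | ⟨q, hq, h3, h4⟩)
          · exact Or.inl (Or.inl h3)
          · rcases Nat.lt_succ_iff_lt_or_eq.1 hq with hq | rfl
            · exact Or.inl (Or.inr ⟨q, hq, h3, h4⟩)
            · exact Or.inr h3
  · refine (Triple.skip ?_).conseq (Nat.le_add_left _ _) fun _ => id
    refine ⟨e17, h1.env, h1.bdd, h1.bit, h1.len, h1.old, h1.le, h1.lists.congr fun X => ?_⟩
    simp only [Grown]
    refine or_congr_right ⟨fun ⟨q, hq, h3⟩ => ⟨q, by omega, h3⟩, fun ⟨q, hq, h3, h4⟩ => ?_⟩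
    rcases Nat.lt_succ_iff_lt_or_eq.1 hq with hq | rfl
    · exact ⟨q, hq, h3, h4⟩
    · rw [h3] at h4
      exact absurd hc (hcond.2 h4)

/-- The state after the masks below `2 ^ j` have been listed. -/
structure MaskEnv (H : HyperExpr) (w : ℕ → ℕ) (s j : ℕ) (σ : St) : Prop where
  env : H.Env w σ
  bdd : Bdd s σ
  lists : Lists (σ.arr 3) (σ.var 18) fun X => X < 2 ^ j ∧ SmallMask (H.hyper w).free X

theorem MaskEnv.length_le {j : ℕ} (h : MaskEnv H w s j σ) (hj : j ≤ (H.hyper w).free) :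
    σ.var 18 ≤ (smallSets (H.hyper w).free).card :=
  h.lists.length_le fun _ hX =>
    ⟨hX.1.trans_le (Nat.pow_le_pow_right two_pos hj), hX.2⟩

theorem MaskEnv.setVar {j : ℕ} (h : MaskEnv H w s j σ) {x v : ℕ}
    (hx : x = 0 ∨ 4 < x ∧ x ≠ 18) (hv : v ≤ 2 ^ s) (hv' : x < 16 → v ≤ s) :
    MaskEnv H w s j (σ.setVar x v) where
  env := h.env.setVar v (by omega)
  bdd := h.bdd.setVar hv hv'
  lists := by rw [St.setVar_var, if_neg (by omega)]; exact h.lists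

/-- The time bound for adding a bit to all masks, with `C` masks. -/
def growAllTime (C s : ℕ) : ℕ :=
  assignTime (.var 18) s + (C * (growTime s + 4 * s + 10) + 2 * s + 10)

/-- Small masks are closed under removing bits, so a small mask with top bit `j` is the extension of
a small mask that is already listed. -/
theorem triple_growAll (hD : D ≤ 2 ^ s) (hs : (H.hyper w).free + 1 ≤ s) {j : ℕ}
    (hj : j < (H.hyper w).free) (h : MaskEnv H w s j σ) (hσj : σ.var 9 = j) :
    Triple D growAll σ (growAllTime (smallSets (H.hyper w).free).card s) fun σ' =>
      σ'.var 9 = j ∧ MaskEnv H w s (j + 1) σ' := by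
  have hc := h.length_le hj.le
  have hcs : σ.var 18 ≤ 2 ^ s := (hc.trans (card_smallSets_le_two_pow _)).trans
    (Nat.pow_le_pow_right two_pos (by omega))
  set c := σ.var 18 with hcdef
  have hlists := h.lists
  have haq : ∀ q < c, σ.arr 3 q < 2 ^ j ∧ SmallMask (H.hyper w).free (σ.arr 3 q) := fun q hq =>
    (hlists.mem _).1 ⟨q, hq, rfl⟩
  refine .seq (Triple.assign h.bdd hD 19 rfl
    (Q := fun σ' => GrowEnv H w s j c (σ.arr 3) 0 σ') ?_) ?_
  · rw [eval_var, ← hcdef]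
    refine ⟨h.env.setVar _ (by omega), h.bdd.setVar hcs (by omega), by simp [St.setVar_var, hσj],
      by simp [St.setVar_var], fun _ _ => rfl, by simp [St.setVar_var, ← hcdef], ?_⟩
    rw [St.setVar_var, if_neg (by omega), ← hcdef]
    exact hlists.congr fun X => by simp [Grown]
  intro σ1 h1
  refine (Triple.for_ (by omega) h1.len hcs (T := growTime s) (fun t σ' =>
    GrowEnv H w s j c (σ.arr 3) t σ') ?_ ?_).conseq ?_ ?_
  · exact h1.setVar (by omega) (Nat.zero_le _)
  · intro t ht σ2 h2 hσt _
    refine (triple_growMask hD hs hj hlists h2 hσt ht).conseq le_rfl ?_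
    rintro σ3 ⟨h3, h4⟩
    exact ⟨h3, h4.len, h4.setVar (by omega) (Nat.succ_le_of_lt (ht.trans_le hcs))⟩
  · have := Nat.mul_le_mul_right (growTime s + 4 * s + 10) hc
    omega
  · intro σ2 h2
    refine ⟨h2.bit, h2.env, h2.bdd, h2.lists.congr fun X => ?_⟩
    rw [Grown, pow_succ]
    constructor
    · rintro (⟨h3, h4⟩ | ⟨q, hq, h3, h4⟩)
      · exact ⟨by omega, h4⟩
      · have := (haq q hq).1
        exact ⟨by omega, h4⟩
    · rintro ⟨h3, h4⟩
      by_cases hX : X < 2 ^ j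
      · exact Or.inl ⟨hX, h4⟩
      · have hlt : X - 2 ^ j < 2 ^ j := by omega
        have he : X - 2 ^ j + 2 ^ j = X := by omega
        have hsm : SmallMask (H.hyper w).free (X - 2 ^ j) := by
          have := card_bits_add_two_pow hlt hj
          rw [he] at this
          unfold SmallMask at h4 ⊢
          omega
        obtain ⟨q, hq, hqX⟩ := (hlists.mem (X - 2 ^ j)).2 ⟨hlt, hsm⟩
        exact Or.inr ⟨q, hq, by omega, h4⟩

/-! ### Three colors: the algorithm -/

variable (H)

/-- The test for the color in variable `10` and the mask in variable `20`, given the result of the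
auction. -/
def testE : Expr :=
  .le (.add (.sub (.var 4) (H.insideE inClassE)) (.num 12 (.var 2) (.arr 0 (.var 12))))
    (.add (.num 5 (.var 2) (H.canE 1 5)) (.num 5 (.var 2) (H.canE 2 5)))

/-- The test of one color and one mask. -/
def testMask : Prog :=
  .seq (.assign 10 (.mod (.var 17) (.cst 3))) <|
    .seq (.assign 20 (.arr 3 (.div (.var 17) (.cst 3)))) <|
    .seq H.auctionProg (.assign 0 (.or (.var 0) H.testE))

/-- The algorithm for three colors. -/
def threeProg : Prog :=
  .seq H.prelude <| .seq (.assign 18 (.cst 1)) <| .seq (.for_ 9 3 growAll) <|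
    .seq (.assign 21 (.mul (.cst 3) (.var 18))) <| .seq (.assign 0 (.cst 0))
    (.for_ 17 21 H.testMask)

variable {H}

/-- The test for the color `i` and the mask `X`. -/
def Test (d : Hyper) (ℓ i X : ℕ) : Prop :=
  ℓ - d.inside (d.InClass i X) +
      count d.m (fun r => (Auction.run d.m (d.Conflict i X) (rounds d.m)).owner r ≠ 0) ≤
    count d.m (d.CanBe X ((i + 1) % 3)) + count d.m (d.CanBe X ((i + 2) % 3))

theorem Env.holds_testE (h : H.Env w σ)
    (hh : Holding (H.hyper w).m (Auction.run (H.hyper w).m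
      ((H.hyper w).Conflict (σ.var 10) (σ.var 20)) (rounds (H.hyper w).m)) σ) :
    H.testE.Holds σ ↔ Test (H.hyper w) (H.thr w) (σ.var 10) (σ.var 20) := by
  have hcan : ∀ c, (Expr.num 5 (.var 2) (H.canE c 5)).eval σ =
      count (H.hyper w).m ((H.hyper w).CanBe (σ.var 20) ((σ.var 10 + c) % 3)) := fun c => by
    rw [eval_num, eval_var, h.m]
    refine count_congr fun e _ => ?_
    rw [(h.setVar e (by omega)).holds_canE c (by omega)]
    simp [St.setVar_var]
  have hown : (Expr.num 12 (.var 2) (.arr 0 (.var 12))).eval σ = count (H.hyper w).m (fun r =>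
      (Auction.run (H.hyper w).m ((H.hyper w).Conflict (σ.var 10) (σ.var 20))
        (rounds (H.hyper w).m)).owner r ≠ 0) := by
    rw [eval_num, eval_var, h.m]
    refine count_congr fun r hr => ?_
    rw [Holds, eval_arr, eval_var, St.setVar_var, if_pos rfl, St.setVar_arr, (hh r hr).1]
  rw [testE, holds_le, eval_add, eval_add, eval_sub, h.eval_inside_inClassE, hcan, hcan, hown,
    eval_var, h.thr]
  rfl

theorem testE_ok : H.testE.ok = true := by
  have h := H.mem_ok (.var 5) (.var 6) rfl rfl
  simp [testE, canE, freeE, insideE, withinE, Expr.ok, h, inClassE, colE, maskE, rankE, Expr.small]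

/-- A single index below `3 * c` encodes the color as its remainder and the position in the list as
its quotient by 3. The search for two conflict-free families is replaced by counting sold items,
through `Auction.exists_independent_iff`. -/
theorem exists_three_coloring_iff_exists_test {d : Hyper} (hcol : ∀ v < d.n, d.col v ≤ 3) {ℓ c : ℕ}
    {a : ℕ → ℕ} (ha : Lists a c fun X => X < 2 ^ d.free ∧ SmallMask d.free X) :
    (∃ χ, d.IsColoring 3 χ ∧ ℓ ≤ d.mono χ) ↔ ∃ q < 3 * c, Test d ℓ (q % 3) (a (q / 3)) := by
  have htest : ∀ i X, Test d ℓ i X ↔ ∃ A B : ℕ → Prop,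
      (∀ l < d.m, A l → d.CanBe X ((i + 1) % 3) l) ∧
        (∀ r < d.m, B r → d.CanBe X ((i + 2) % 3) r) ∧
        (∀ l < d.m, ∀ r < d.m, A l → B r → ¬ d.Conflict i X l r) ∧
        ℓ - d.inside (d.InClass i X) ≤ count d.m A + count d.m B := fun i X =>
    Auction.exists_independent_iff (fun l r hlr => ⟨hlr.1, hlr.2.1⟩) _
  rw [Hyper.exists_three_coloring_iff hcol]
  simp only [← htest]
  constructor
  · rintro ⟨i, hi, S, hS, hcard, ht⟩
    obtain ⟨q, hq, hqS⟩ := (ha.mem (code S)).2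
      ⟨code_lt hS, by rw [SmallMask, bits_code hS]; exact hcard⟩
    refine ⟨3 * q + i, by omega, ?_⟩
    rw [show (3 * q + i) % 3 = i by omega, show (3 * q + i) / 3 = q by omega, hqS]
    exact ht
  · rintro ⟨q, hq, ht⟩
    obtain ⟨h1, h2⟩ := (ha.mem _).1 ⟨q / 3, by omega, rfl⟩
    exact ⟨q % 3, by omega, bits d.free (a (q / 3)), bits_subset _ _, h2,
      by rw [code_bits h1]; exact ht⟩

/-- The time bound for the test of one color and one mask. -/
def testTime (H : HyperExpr) (s : ℕ) : ℕ :=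
  assignTime (.mod (.var 17) (.cst 3)) s + (assignTime (.arr 3 (.div (.var 17) (.cst 3))) s +
    (auctionTime H s + assignTime (.or (.var 0) H.testE) s))

open Classical in
theorem triple_testMask (hD : D ≤ 2 ^ s) (hs : rounds (H.hyper w).m + (H.hyper w).m + 3 ≤ s)
    (henv : H.Env w σ) (hb : Bdd s σ) {q : ℕ} (hq : σ.var 17 = q) {P : Prop}
    (h0 : σ.var 0 = if P then 1 else 0) :
    Triple D H.testMask σ (testTime H s) fun σ' =>
      σ'.var 17 = q ∧ σ'.var 18 = σ.var 18 ∧ σ'.var 21 = σ.var 21 ∧ σ'.arr 3 = σ.arr 3 ∧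
        H.Env w σ' ∧ Bdd s σ' ∧
        σ'.var 0 = if P ∨ Test (H.hyper w) (H.thr w) (q % 3) (σ.arr 3 (q / 3)) then 1 else 0 := by
  set X := σ.arr 3 (q / 3) with hX
  have hi : q % 3 < 3 := Nat.mod_lt _ (by omega)
  set σ1 := σ.setVar 10 (q % 3) with h1
  set σ2 := σ1.setVar 20 X with h2
  have hb1 : Bdd s σ1 := hb.setSmall (by omega)
  have hb2 : Bdd s σ2 := hb1.setVar (hb.arr_le _ _) (by omega)
  have henv2 : H.Env w σ2 := (henv.setVar _ (by omega)).setVar _ (by omega)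
  refine .seq (Triple.assign hb hD 10 rfl (Q := fun σ' => σ' = σ1) ?_) ?_
  · rw [eval_mod, eval_var, eval_cst, hq]
  rintro _ rfl
  refine .seq (Triple.assign hb1 hD 20 rfl (Q := fun σ' => σ' = σ2) ?_) ?_
  · rw [eval_arr, eval_div, eval_var, eval_cst, show σ1.var 17 = q by simp [h1, St.setVar_var, hq]]
    rfl
  rintro _ rfl
  refine .seq (triple_auctionProg hD henv2 hb2 (by omega)) ?_
  rintro σ3 ⟨ha3, hb3, hh3⟩
  have henv3 := ha3.env henv2
  have e10 : σ3.var 10 = q % 3 := by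
    rw [ha3.var 10 (by omega) (by omega) (by omega) (by omega)]; simp [h2, h1, St.setVar_var]
  have e20 : σ3.var 20 = X := by
    rw [ha3.var 20 (by omega) (by omega) (by omega) (by omega)]; simp [h2, St.setVar_var]
  have keep : ∀ x, x ≠ 9 → x ≠ 10 → x ≠ 11 → x ≠ 12 → x ≠ 14 → x ≠ 20 →
      σ3.var x = σ.var x := fun x k1 k2 k3 k4 k5 k6 => by
    rw [ha3.var x k1 k3 k4 k5, h2, St.setVar_var, if_neg k6, h1, St.setVar_var, if_neg k2]
  have e10' : σ2.var 10 = q % 3 := by simp [h2, h1, St.setVar_var]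
  have e20' : σ2.var 20 = X := by simp [h2, St.setVar_var]
  have htest := henv3.holds_testE (by rw [e10, e20, ← e10', ← e20']; exact hh3)
  rw [e10, e20] at htest
  have hval : (Expr.or (.var 0) H.testE).eval σ3 =
      if P ∨ Test (H.hyper w) (H.thr w) (q % 3) X then 1 else 0 := by
    rw [eval_not_eq, holds_not, Expr.Holds, eval_add, eval_var,
      keep 0 (by omega) (by omega) (by omega) (by omega) (by omega) (by omega), h0]
    by_cases hP : P
    · simp [hP]
    · by_cases hT : Test (H.hyper w) (H.thr w) (q % 3) X
      · have h4 : H.testE.eval σ3 ≠ 0 := htest.2 hT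
        simp only [hP, hT, if_false, zero_add, false_or, if_true, h4, ne_eq, not_false_iff,
          not_true]
      · have h4 : H.testE.eval σ3 = 0 := not_not.1 (mt htest.1 hT)
        simp only [hP, hT, if_false, zero_add, false_or, h4, ne_eq, not_false_iff,
          not_true, if_true]
  refine Triple.assign hb3 hD 0 (by simp [Expr.ok, testE_ok]) ?_
  rw [hval]
  have hle : (if P ∨ Test (H.hyper w) (H.thr w) (q % 3) X then 1 else 0) ≤ s := by
    split_ifs <;> omega
  refine ⟨?_, ?_, ?_, ha3.arr, henv3.setVar _ (by omega), hb3.setSmall hle, by simp [St.setVar_var]⟩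
  all_goals rw [St.setVar_var, if_neg (by omega),
    keep _ (by omega) (by omega) (by omega) (by omega) (by omega) (by omega)]
  exact hq

/-- The time bound for the algorithm, up to the factor for the number of masks. -/
def threeTime (H : HyperExpr) (s : ℕ) : ℕ :=
  H.preludeTime s + (assignTime (.cst 1) s +
    ((s * (growAllTime 1 s + 4 * s + 10) + 2 * s + 10) + (assignTime (.mul (.cst 3) (.var 18)) s +
      (assignTime (.cst 0) s + (3 * (testTime H s + 4 * s + 10) + 2 * s + 10)))))

theorem polyBdd_threeTime : PolyBdd (threeTime H) := by
  have hlin : ∀ a, PolyBdd fun s => a * s := fun a => .mul (.const a) .id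
  have hfor : ∀ {f g}, PolyBdd f → PolyBdd g →
      PolyBdd fun s => f s * (g s + 4 * s + 10) + 2 * s + 10 := fun hf hg =>
    ((hf.mul ((hg.add (hlin 4)).add (.const 10))).add (hlin 2)).add (.const 10)
  have hcond : ∀ e : Expr, PolyBdd fun s => e.tm s + e.bd s + 2 := fun e =>
    (e.polyBdd_tm.add e.polyBdd_bd).add (.const 2)
  have hgrow : PolyBdd growTime := (polyBdd_assignTime _).add ((hcond _).add
    (((polyBdd_writeTime _ _).add (polyBdd_assignTime _)).add (.const 1)))
  have hgrowAll : PolyBdd (growAllTime 1) := (polyBdd_assignTime _).add (hfor (.const 1) hgrow)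
  have hround : PolyBdd (roundTime H) := (polyBdd_assignTime _).add ((polyBdd_assignTime _).add
    ((hcond _).add (((polyBdd_writeTime _ _).add (polyBdd_writeTime _ _)).add (.const 1))))
  have hauction : PolyBdd (auctionTime H) :=
    (hfor .id ((polyBdd_writeTime _ _).add (polyBdd_writeTime _ _))).add
      ((polyBdd_assignTime _).add (hfor .id hround))
  have htest : PolyBdd (testTime H) := (polyBdd_assignTime _).add ((polyBdd_assignTime _).add
    (hauction.add (polyBdd_assignTime _)))
  exact H.polyBdd_preludeTime.add ((polyBdd_assignTime _).add ((hfor .id hgrowAll).add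
    ((polyBdd_assignTime _).add ((polyBdd_assignTime _).add (hfor (.const 3) htest)))))

/-- The number `C` of small sets bounds every list length, and only `N ≤ s` bits are added. All
other summands are merely enlarged by the factor `C`. -/
theorem three_time_le {C c N s p q r u g a t : ℕ} (hC : 0 < C) (hc : c ≤ C) (hN : N ≤ s) :
    p + (q + ((N * ((a + (C * (g + 4 * s + 10) + 2 * s + 10)) + 4 * s + 10) + 2 * s + 10) +
      (r + (u + (3 * c * (t + 4 * s + 10) + 2 * s + 10))))) ≤
    C * (p + (q + ((s * ((a + (1 * (g + 4 * s + 10) + 2 * s + 10)) + 4 * s + 10) + 2 * s + 10) +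
      (r + (u + (3 * (t + 4 * s + 10) + 2 * s + 10)))))) := by
  have h : ∀ y, y ≤ C * y := fun y => Nat.le_mul_of_pos_left y hC
  have h1 : 3 * c * (t + 4 * s + 10) ≤ C * (3 * (t + 4 * s + 10)) := by
    rw [mul_comm 3 c, mul_assoc]
    exact Nat.mul_le_mul_right _ hc
  have h2 : N * ((a + (C * (g + 4 * s + 10) + 2 * s + 10)) + 4 * s + 10) ≤
      C * (s * ((a + (1 * (g + 4 * s + 10) + 2 * s + 10)) + 4 * s + 10)) := by
    rw [Nat.mul_left_comm]
    refine Nat.mul_le_mul hN ?_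
    have e := h (a + 2 * s + 10 + 4 * s + 10)
    linarith
  have e := h (p + q + 2 * s + 10 + r + u + 2 * s + 10)
  linarith

open Classical in
theorem triple_threeProg (hw : ∀ i, w i ≤ 2 ^ s) (hD : D ≤ 2 ^ s)
    (hs : rounds (H.hyper w).m + (H.hyper w).m + (H.hyper w).n + 3 ≤ s)
    (hcol : ∀ v < (H.hyper w).n, (H.hyper w).col v ≤ 3) :
    Triple D H.threeProg (St.start w) ((smallSets (H.hyper w).free).card * threeTime H s) fun σ =>
      σ.var 0 =
        if ∃ χ, (H.hyper w).IsColoring 3 χ ∧ H.thr w ≤ (H.hyper w).mono χ then 1 else 0 := by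
  obtain ⟨N, hN⟩ : ∃ N, N = (H.hyper w).free := ⟨_, rfl⟩
  have hNn : N ≤ (H.hyper w).n := hN ▸ free_le _
  have hn : w 0 ≤ s := (by omega : (H.hyper w).n ≤ s)
  have hm : H.sizeFn (w 0) + 1 ≤ s := (by omega : (H.hyper w).m + 1 ≤ s)
  have hC : 0 < (smallSets N).card := card_pos.2 ⟨∅, by simp [smallSets]⟩
  -- The final loop makes three passes over the list; its bound `3 * c` must still be below `2 ^ s`.
  have h4 : 2 ^ N * 4 ≤ 2 ^ s := by
    rw [show 4 = 2 ^ 2 by rfl, ← pow_add]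
    exact Nat.pow_le_pow_right two_pos (by omega)
  have hCN := card_smallSets_le_two_pow N
  have key : ∀ c, c ≤ (smallSets N).card → _ := fun c hc =>
    three_time_le (p := H.preludeTime s) (q := assignTime (.cst 1) s)
      (r := assignTime (.mul (.cst 3) (.var 18)) s) (u := assignTime (.cst 0) s) (g := growTime s)
      (a := assignTime (.var 18) s) (t := testTime H s) hC hc (show N ≤ s by omega)
  rw [← hN]
  refine Triple.conseq (T := H.preludeTime s + (assignTime (.cst 1) s +
    ((N * (growAllTime (smallSets N).card s + 4 * s + 10) + 2 * s + 10) +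
      (assignTime (.mul (.cst 3) (.var 18)) s + (assignTime (.cst 0) s +
        (3 * (smallSets N).card * (testTime H s + 4 * s + 10) + 2 * s + 10)))))) ?_ (key _ le_rfl)
    fun _ => id
  refine .seq (H.triple_prelude hw hD hn hm) ?_
  rintro σ0 ⟨henv, hb, harr⟩
  refine .seq (Triple.assign hb hD 18 rfl (Q := MaskEnv H w s 0) ?_) ?_
  · refine ⟨henv.setVar _ (by omega), hb.setVar Nat.one_le_two_pow (by omega), ?_⟩
    -- The enumeration starts with the empty mask alone. It needs no write, because the array is
    -- zero initially.
    have he : (σ0.setVar 18 ((cst 1).eval σ0)).var 18 = 1 := by simp [St.setVar_var, eval_cst]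
    rw [he, St.setVar_arr, harr]
    refine ⟨fun q hq q' hq' _ => by omega, fun X => ?_⟩
    constructor
    · rintro ⟨q, -, rfl⟩
      exact ⟨by simp, by simp [SmallMask, bits]⟩
    · rintro ⟨hX, -⟩
      exact ⟨0, one_pos, (Nat.lt_one_iff.1 (by simpa using hX)).symm⟩
  intro σ1 h1
  refine .seq (Triple.for_ (by omega) (h1.env.free.trans hN.symm)
    ((by omega : N ≤ s).trans Nat.lt_two_pow_self.le)
    (T := growAllTime (smallSets N).card s) (fun j σ => MaskEnv H w s j σ) ?_ ?_) ?_
  · exact h1.setVar (by omega) (Nat.zero_le _) fun _ => Nat.zero_le _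
  · intro j hj σ h hσj _
    rw [hN] at hj ⊢
    refine (triple_growAll hD (by omega) hj h hσj).conseq le_rfl ?_
    rintro σ' ⟨h2, h3⟩
    have hjs : j + 1 ≤ s := by omega
    exact ⟨h2, h3.env.free, h3.setVar (by omega) (hjs.trans Nat.lt_two_pow_self.le) fun _ => hjs⟩
  intro σ2 h2
  have hc : σ2.var 18 ≤ (smallSets N).card := hN ▸ h2.length_le hN.le
  have h3c : 3 * σ2.var 18 ≤ 2 ^ s := by omega
  have hlists := h2.lists
  obtain ⟨c, hcv⟩ : ∃ c, c = σ2.var 18 := ⟨_, rfl⟩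
  obtain ⟨a, hav⟩ : ∃ a, a = σ2.arr 3 := ⟨_, rfl⟩
  rw [← hcv] at hc h3c
  rw [← hcv, ← hav, hN] at hlists
  have hiff := exists_three_coloring_iff_exists_test hcol (ℓ := H.thr w) hlists
  have hsm : ∀ P : Prop, (if P then 1 else 0) ≤ s := fun P => by split_ifs <;> omega
  refine .seq (Triple.assign h2.bdd hD 21 rfl (Q := fun σ => H.Env w σ ∧ Bdd s σ ∧ σ.arr 3 = a ∧
    σ.var 21 = 3 * c) ?_) ?_
  · rw [eval_mul, eval_cst, eval_var, ← hcv]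
    exact ⟨h2.env.setVar _ (by omega), h2.bdd.setVar h3c (by omega), hav.symm,
      by simp [St.setVar_var]⟩
  rintro σ3 ⟨henv3, hb3, harr3, hlen3⟩
  refine .seq (Triple.assign hb3 hD 0 rfl (Q := fun σ => H.Env w σ ∧ Bdd s σ ∧ σ.arr 3 = a ∧
    σ.var 21 = 3 * c ∧ σ.var 0 = 0) ?_) ?_
  · exact ⟨henv3.setVar _ (by omega), hb3.setSmall (Nat.zero_le _), harr3,
      by simp [St.setVar_var, hlen3], by simp [St.setVar_var, eval_cst]⟩
  rintro σ4 ⟨henv4, hb4, harr4, hlen4, h04⟩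
  refine (Triple.for_ (by omega) hlen4 h3c (T := testTime H s) (fun t σ => H.Env w σ ∧ Bdd s σ ∧
    σ.arr 3 = a ∧ σ.var 0 =
      if ∃ q < t, Test (H.hyper w) (H.thr w) (q % 3) (a (q / 3)) then 1 else 0) ?_ ?_).conseq ?_ ?_
  · exact ⟨henv4.setVar _ (by omega), hb4.setVar (Nat.zero_le _) (by omega), harr4,
      by simp [St.setVar_var, h04]⟩
  · rintro t ht σ ⟨henv5, hb5, harr5, h05⟩ hσt hσc
    obtain ⟨P, hP⟩ : ∃ P : Prop,
        P ↔ ∃ q < t, Test (H.hyper w) (H.thr w) (q % 3) (a (q / 3)) := ⟨_, Iff.rfl⟩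
    refine (triple_testMask hD (by omega) henv5 hb5 hσt
      (h05.trans (if_congr hP.symm rfl rfl))).conseq le_rfl ?_
    rintro σ' ⟨k1, -, k3, k4, k5, k6, k7⟩
    refine ⟨k1, k3.trans hσc, k5.setVar _ (by omega), k6.setVar (by omega) (by omega),
      k4.trans harr5, ?_⟩
    rw [St.setVar_var, if_neg (by omega), k7, harr5]
    refine if_congr ?_ rfl rfl
    rw [hP]
    constructor
    · rintro (⟨q, hq, h⟩ | h)
      · exact ⟨q, by omega, h⟩
      · exact ⟨t, by omega, h⟩
    · rintro ⟨q, hq, h⟩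
      rcases Nat.lt_succ_iff_lt_or_eq.1 hq with hq | rfl
      · exact Or.inl ⟨q, hq, h⟩
      · exact Or.inr h
  · have := Nat.mul_le_mul_right (testTime H s + 4 * s + 10) (Nat.mul_le_mul_left 3 hc)
    omega
  · rintro σ5 ⟨-, -, -, h⟩
    rw [h]
    exact if_congr hiff.symm rfl rfl

end HyperExpr

end HappyColoring

namespace HappyColoring

open Finset RAM HyperExpr

/-! ### The encoding of instances -/

theorem le_inputSize {l : List ℕ} {a : ℕ} (h : a ∈ l) : Nat.size a + 1 ≤ inputSize l :=
  List.single_le_sum (fun _ _ => Nat.zero_le _) _ (List.mem_map.2 ⟨a, h, rfl⟩)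

theorem getD_le_two_pow (l : List ℕ) (i : ℕ) : l.getD i 0 ≤ 2 ^ inputSize l := by
  by_cases hi : i < l.length
  · rw [List.getD_eq_getElem _ _ hi]
    have h := le_inputSize (List.getElem_mem hi)
    exact (Nat.lt_size_self _).le.trans (Nat.pow_le_pow_right two_pos (by omega))
  · rw [List.getD_eq_default _ _ (not_lt.1 hi)]
    exact Nat.zero_le _

theorem length_le_inputSize (l : List ℕ) : l.length ≤ inputSize l := by
  unfold inputSize
  induction l with
  | nil => simp
  | cons a l ih => simp only [List.map_cons, List.sum_cons, List.length_cons]; omega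

namespace Inst

variable {k : ℕ} (I : Inst k)

/-- The input word with a given index. -/
noncomputable def word (i : ℕ) : ℕ := I.encode.getD i 0

open Classical in
-- Flattening the matrix into one `List.ofFn` over `Fin (n * n)` gives access to its entries by
-- index.
theorem encode_eq : I.encode =
    I.n :: (if I.threshold < 0 then 1 else 0) :: I.threshold.natAbs ::
      (List.ofFn (fun v => colorCode (I.precolor v)) ++
        List.ofFn fun e : Fin (I.n * I.n) => if I.graph.Adj e.divNat e.modNat then 1 else 0) := by
  have h : (List.ofFn fun e : Fin (I.n * I.n) =>
      if I.graph.Adj e.divNat e.modNat then 1 else 0) =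
      (List.finRange I.n).flatMap fun u => (List.finRange I.n).map fun v =>
        if I.graph.Adj u v then 1 else 0 := by
    rw [List.ofFn_mul, List.flatMap_def, ← List.ofFn_eq_map]
    congr 1
    refine congrArg _ (funext fun u => ?_)
    rw [← List.ofFn_eq_map]
    refine congrArg _ (funext fun v => ?_)
    have hn : 0 < I.n := u.pos
    have h1 : (⟨u * I.n + v, by
        exact Nat.lt_of_lt_of_le (Nat.add_lt_add_left v.2 _)
          (by rw [← Nat.succ_mul]; exact Nat.mul_le_mul_right _ u.2)⟩ :
        Fin (I.n * I.n)) = finProdFinEquiv (u, v) := by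
      ext; simp [finProdFinEquiv]; ring
    have h2 := finProdFinEquiv.symm_apply_apply (u, v)
    rw [h1]
    rw [finProdFinEquiv_symm_apply, Prod.mk.injEq] at h2
    rw [h2.1, h2.2]
  rw [h, encode, ← List.ofFn_eq_map]
  simp

theorem length_encode : I.encode.length = 3 + I.n + I.n * I.n := by
  rw [encode_eq]
  simp
  ring

theorem word_zero : I.word 0 = I.n := by rw [word, encode_eq]; rfl

open Classical in
theorem word_one : I.word 1 = if I.threshold < 0 then 1 else 0 := by rw [word, encode_eq]; rfl

theorem word_two : I.word 2 = I.threshold.natAbs := by rw [word, encode_eq]; rfl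

theorem word_color (v : Fin I.n) : I.word (3 + v) = colorCode (I.precolor v) := by
  rw [word, encode_eq, show 3 + (v : ℕ) = v + 1 + 1 + 1 by omega, List.getD_cons_succ,
    List.getD_cons_succ, List.getD_cons_succ, List.getD_append _ _ _ _ (by simp),
    List.getD_eq_getElem _ _ (by simp)]
  simp

theorem word_adj (u v : Fin I.n) : I.word (3 + I.n + u * I.n + v) ≠ 0 ↔ I.graph.Adj u v := by
  classical
  have he : (finProdFinEquiv (u, v) : Fin (I.n * I.n)).val = u * I.n + v := by
    simp [finProdFinEquiv]; ring
  have h2 := finProdFinEquiv.symm_apply_apply (u, v)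
  rw [finProdFinEquiv_symm_apply, Prod.mk.injEq] at h2
  have hlt := (finProdFinEquiv (u, v)).2
  rw [word, encode_eq, show 3 + I.n + u * I.n + (v : ℕ) = (I.n + (u * I.n + v)) + 1 + 1 + 1 by
    omega, List.getD_cons_succ, List.getD_cons_succ, List.getD_cons_succ,
    List.getD_append_right _ _ _ _ (by simp), List.length_ofFn, Nat.add_sub_cancel_left, ← he,
    List.getD_eq_getElem _ _ (by simpa using hlt)]
  simp only [List.getElem_ofFn, Fin.eta, h2.1, h2.2]
  simp

theorem word_le (i : ℕ) : I.word i ≤ 2 ^ inputSize I.encode := getD_le_two_pow _ _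

theorem length_le : I.encode.length ≤ inputSize I.encode := length_le_inputSize _

theorem n_le : I.n ≤ inputSize I.encode := by
  have := I.length_le
  rw [length_encode] at this
  omega

end Inst

/-! ### Loading the parameters -/

/-- Compute the length of the input. -/
def header : Prog :=
  .seq (.const 3 0) <| .seq (.load 3 3) <| .seq (.mul 1 3 3) <| .seq (.add 1 1 3) <|
    .seq (.const 3 3) (.add 1 1 3)

theorem size_le_self (a : ℕ) : Nat.size a ≤ a := Nat.size_le.2 Nat.lt_two_pow_self

/-- The length `n * n + n + 3` is computed from the first word. Besides register `1` only register
`3` is used, which is `tmp 0` and thus irrelevant for `Rep`. -/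
theorem Inst.exec_header {k : ℕ} (I : Inst k) : ∃ t st, Exec header (init I.encode) t st ∧
    t ≤ 20 + 10 * inputSize I.encode ∧ Rep I.encode.length st (St.start I.word) := by
  have hm : (init I.encode).mem = I.word := rfl
  have h0 := I.word_zero
  have hl := I.length_encode
  have hz := I.length_le
  refine ⟨_, _, .seq (.const ..) (.seq (.load ..) (.seq (.mul ..) (.seq (.add ..)
    (.seq (.const ..) (.add ..))))), ?_, ?_⟩
  · simp only [State.setReg, hm, Function.update_apply]
    norm_num [h0]
    have h1 := size_le_self I.n
    have h2 := size_le_self (I.n * I.n)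
    have h3 := size_le_self (I.n * I.n + I.n)
    have h4 := size_le_self 3
    omega
  · constructor
    · intro x
      simp only [setReg_reg]
      rw [if_neg (by omega), if_neg (by omega), if_neg (by omega), if_neg (by omega),
        if_neg (by omega), if_neg (by omega)]
      rfl
    · simp [State.setReg, hm, h0, hl]
      ring
    · intro i _
      rfl
    · intro i hi
      exact List.getD_eq_default _ _ hi
    · intro a i
      exact List.getD_eq_default _ _ (by omega)

/-! ### Happy colorings as monochromatic hyperedges -/

section

variable {k : ℕ} (I : Inst k) (H : HyperExpr)

theorem count_eq_ncard (n : ℕ) (P : ℕ → Prop) : count n P = {v : Fin n | P v}.ncard := by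
  classical
  have h : ((range n).filter P : Set ℕ) = Fin.val '' {v : Fin n | P v} := by
    ext x
    simp only [coe_filter, mem_range, Set.mem_ofPred_eq, Set.mem_image]
    exact ⟨fun h => ⟨⟨x, h.1⟩, h.2, rfl⟩, fun ⟨v, hv, e⟩ => e ▸ ⟨v.2, hv⟩⟩
  rw [count_eq_card, ← Set.ncard_coe_finset, h, Set.ncard_image_of_injective _ Fin.val_injective]

theorem colorCode_eq_zero {o : Option (Fin k)} : Inst.colorCode o = 0 ↔ o = none := by
  cases o <;> simp [Inst.colorCode]

theorem Inst.free_eq : (H.hyper I.word).free = I.uncolored := by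
  classical
  have h : (H.hyper I.word).free = count I.n fun v => I.word (3 + v) = 0 := by
    show count (I.word 0) _ = _
    rw [I.word_zero]
    rfl
  rw [h, count_eq_ncard, Inst.uncolored, ← Set.ncard_coe_finset]
  congr 1
  ext v
  simp [I.word_color, colorCode_eq_zero]

theorem Inst.col_le : ∀ v < (H.hyper I.word).n, (H.hyper I.word).col v ≤ k := by
  intro v hv
  have hv' : v < I.n := I.word_zero ▸ hv
  show I.word (3 + v) ≤ k
  rw [I.word_color ⟨v, hv'⟩]
  cases I.precolor ⟨v, hv'⟩ with
  | none => exact Nat.zero_le _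
  | some a => exact a.2

theorem Inst.isColoring_iff {c : Fin I.n → Fin k} {χ : ℕ → ℕ} (h : ∀ v : Fin I.n, χ v = c v) :
    (H.hyper I.word).IsColoring k χ ↔ I.Extends c := by
  have hcol : ∀ v : Fin I.n, (H.hyper I.word).col v = colorCode (I.precolor v) := I.word_color
  have hn : (H.hyper I.word).n = I.n := I.word_zero
  constructor
  · intro hχ v a hv
    have := (hχ v (v.2.trans_eq hn.symm)).2
    rw [hcol, hv, h] at this
    exact Fin.ext (Nat.succ_injective (this (Nat.succ_ne_zero _)))
  · intro hc v hv
    have hv' : v < I.n := hn ▸ hv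
    have h1 := h ⟨v, hv'⟩
    refine ⟨h1 ▸ (c ⟨v, hv'⟩).2, fun h0 => ?_⟩
    have h2 := hcol ⟨v, hv'⟩
    simp only at h1 h2
    rw [h2] at h0 ⊢
    cases hp : I.precolor ⟨v, hv'⟩ with
    | none => rw [hp] at h0; exact absurd rfl h0
    | some a => rw [h1, hc _ _ hp]; rfl

/-- No coloring has more than `m` monochromatic hyperedges, so capping at `m + 1` keeps impossible
thresholds impossible; a negative threshold is always met. -/
theorem Inst.thr_le_iff (χ : ℕ → ℕ) : H.thr I.word ≤ (H.hyper I.word).mono χ ↔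
    I.threshold ≤ ((H.hyper I.word).mono χ : ℤ) := by
  have hm : (H.hyper I.word).mono χ ≤ H.sizeFn (I.word 0) := count_le _ _
  have h1 := I.word_one
  rw [HyperExpr.thr, I.word_two]
  by_cases ht : I.threshold < 0
  · rw [if_pos ht] at h1
    rw [h1, if_neg one_ne_zero]
    exact iff_of_true (Nat.zero_le _) (by omega)
  · rw [if_neg ht] at h1
    rw [h1, if_pos rfl]
    omega

theorem Inst.exists_extends_iff {val : (Fin I.n → Fin k) → ℕ}
    (hval : ∀ (c : Fin I.n → Fin k) (χ : ℕ → ℕ), (∀ v : Fin I.n, χ v = c v) →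
      val c = (H.hyper I.word).mono χ) :
    (∃ c, I.Extends c ∧ I.threshold ≤ (val c : ℤ)) ↔
      ∃ χ, (H.hyper I.word).IsColoring k χ ∧ H.thr I.word ≤ (H.hyper I.word).mono χ := by
  constructor
  · rintro ⟨c, hc, ht⟩
    obtain ⟨χ, hχ⟩ : ∃ χ : ℕ → ℕ, ∀ v : Fin I.n, χ v = c v :=
      -- Values beyond the last vertex are never inspected, so `0` serves as a default.
      ⟨fun v => if h : v < I.n then c ⟨v, h⟩ else 0, fun v => by simp⟩
    exact ⟨χ, (I.isColoring_iff H hχ).2 hc, (I.thr_le_iff H _).2 (hval c _ hχ ▸ ht)⟩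
  · rintro ⟨χ, hχ, ht⟩
    have hn : (H.hyper I.word).n = I.n := I.word_zero
    have hc : ∀ v : Fin I.n, χ v = (⟨χ v, (hχ v (v.2.trans_eq hn.symm)).1⟩ : Fin k) := fun _ => rfl
    refine ⟨fun v => ⟨χ v, (hχ v (v.2.trans_eq hn.symm)).1⟩, (I.isColoring_iff H hc).1 hχ, ?_⟩
    rw [hval _ χ hc]
    exact (I.thr_le_iff H χ).1 ht

end

/-! ### The hypergraphs of closed neighborhoods and of edges -/

/-- The entry of the adjacency matrix. -/
def adjE (u v : Expr) : Expr :=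
  .inp (.add (.add (.add (.cst 3) (.var 1)) (.mul u (.var 1))) v)

theorem adjE_holds {σ : St} (h : σ.var 1 = σ.inp 0) (u v : Expr) : (adjE u v).Holds σ ↔
    σ.inp (3 + σ.inp 0 + u.eval σ * σ.inp 0 + v.eval σ) ≠ 0 := by
  rw [← h]
  rfl

/-- The closed neighborhoods of the vertices. -/
def vertexHyper : HyperExpr where
  size := .var 1
  mem e v := .or (.eq e v) (adjE e v)
  sizeFn n := n
  memFn w e v := e = v ∨ w (3 + w 0 + e * w 0 + v) ≠ 0
  size_ok := rfl
  mem_ok e v he hv := by simp [adjE, Expr.ok, he, hv]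
  eval_size _ h := h
  holds_mem σ e v h := by rw [Expr.holds_or, Expr.holds_eq, adjE_holds h]

/-- The edges; the number `u * n + v` stands for the pair of the vertices `u < v`. -/
def edgeHyper : HyperExpr where
  size := .mul (.var 1) (.var 1)
  mem e v := .mul (.mul (adjE (.div e (.var 1)) (.mod e (.var 1)))
    (.not (.le (.mod e (.var 1)) (.div e (.var 1)))))
    (.or (.eq v (.div e (.var 1))) (.eq v (.mod e (.var 1))))
  sizeFn n := n * n
  memFn w e v := (w (3 + w 0 + e / w 0 * w 0 + e % w 0) ≠ 0 ∧ e / w 0 < e % w 0) ∧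
    (v = e / w 0 ∨ v = e % w 0)
  size_ok := rfl
  mem_ok e v he hv := by simp [adjE, Expr.ok, he, hv]
  eval_size _ h := by rw [Expr.eval_mul, Expr.eval_var, h]
  holds_mem σ e v h := by
    rw [Expr.holds_mul, Expr.holds_mul, adjE_holds h, Expr.holds_not, Expr.holds_le,
      Expr.holds_or, Expr.holds_eq, Expr.holds_eq, Expr.eval_mod, Expr.eval_div, Expr.eval_var, h,
      not_le]

variable {k : ℕ}

/-- A vertex is happy exactly if its closed neighborhood is monochromatic; the vertex itself ensures
that this hyperedge is nonempty. -/
theorem happyVertices_eq_mono (I : Inst k) (c : Fin I.n → Fin k) (χ : ℕ → ℕ)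
    (h : ∀ v : Fin I.n, χ v = c v) : happyVertices I.graph c = (vertexHyper.hyper I.word).mono χ := by
  have hn : (vertexHyper.hyper I.word).n = I.n := I.word_zero
  have hm : (vertexHyper.hyper I.word).m = I.n := I.word_zero
  have hmem : ∀ u v : Fin I.n, (vertexHyper.hyper I.word).mem u v ↔ u = v ∨ I.graph.Adj u v := by
    intro u v
    show (u : ℕ) = v ∨ I.word (3 + I.word 0 + u * I.word 0 + v) ≠ 0 ↔ _
    rw [I.word_zero, I.word_adj, Fin.val_inj]
  rw [Hyper.mono, hm, count_eq_ncard]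
  refine congrArg Set.ncard (Set.ext fun v => ?_)
  constructor
  · intro hv
    refine ⟨⟨v, v.2.trans_eq hn.symm, (hmem v v).2 (.inl rfl)⟩, χ v, fun u hu huv => ?_⟩
    rcases (hmem v ⟨u, hn ▸ hu⟩).1 huv with e | e
    · rw [e]
    · have := hv _ e
      rw [h v, ← this]
      exact h ⟨u, hn ▸ hu⟩
  · rintro ⟨-, i, hi⟩ u hu
    have h1 := hi u (u.2.trans_eq hn.symm) ((hmem v u).2 (.inr hu))
    have h2 := hi v (v.2.trans_eq hn.symm) ((hmem v v).2 (.inl rfl))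
    exact Fin.ext ((h _).symm.trans (h1.trans (h2.symm.trans (h _))))

/-- Each edge is represented once, by its increasing pair of endpoints. The other indices below `n *
n` give empty hyperedges, which `mono` ignores. -/
theorem happyEdges_eq_mono (I : Inst k) (c : Fin I.n → Fin k) (χ : ℕ → ℕ)
    (h : ∀ v : Fin I.n, χ v = c v) : happyEdges I.graph c = (edgeHyper.hyper I.word).mono χ := by
  have hn : (edgeHyper.hyper I.word).n = I.n := I.word_zero
  have hm : (edgeHyper.hyper I.word).m = I.n * I.n := by
    show I.word 0 * I.word 0 = _
    rw [I.word_zero]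
  have hmem : ∀ (e : Fin (I.n * I.n)) (v : Fin I.n), (edgeHyper.hyper I.word).mem e v ↔
      (I.graph.Adj e.divNat e.modNat ∧ e.divNat < e.modNat) ∧ (v = e.divNat ∨ v = e.modNat) := by
    intro e v
    show (I.word (3 + I.word 0 + e / I.word 0 * I.word 0 + e % I.word 0) ≠ 0 ∧
      (e : ℕ) / I.word 0 < e % I.word 0) ∧ ((v : ℕ) = e / I.word 0 ∨ (v : ℕ) = e % I.word 0) ↔ _
    have h1 := I.word_adj e.divNat e.modNat
    rw [I.word_zero, ← h1, Fin.lt_def, ← Fin.val_inj, ← Fin.val_inj]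
    rfl
  have key : ∀ e : Fin (I.n * I.n), ((edgeHyper.hyper I.word).Active e ∧
      ∃ i, (edgeHyper.hyper I.word).Within (χ · = i) e) ↔
      (I.graph.Adj e.divNat e.modNat ∧ e.divNat < e.modNat) ∧ c e.divNat = c e.modNat := by
    intro e
    constructor
    · rintro ⟨⟨v, hv, hev⟩, i, hi⟩
      have he := ((hmem e ⟨v, hn ▸ hv⟩).1 hev).1
      have h1 := hi _ (e.divNat.2.trans_eq hn.symm) ((hmem e _).2 ⟨he, .inl rfl⟩)
      have h2 := hi _ (e.modNat.2.trans_eq hn.symm) ((hmem e _).2 ⟨he, .inr rfl⟩)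
      exact ⟨he, Fin.ext ((h _).symm.trans (h1.trans (h2.symm.trans (h _))))⟩
    · rintro ⟨he, hc⟩
      refine ⟨⟨e.divNat, e.divNat.2.trans_eq hn.symm, (hmem e _).2 ⟨he, .inl rfl⟩⟩, c e.divNat,
        fun v hv hev => ?_⟩
      have h1 := h ⟨v, hn ▸ hv⟩
      rcases ((hmem e ⟨v, hn ▸ hv⟩).1 hev).2 with e1 | e1
      · exact h1.trans (congrArg (fun u => (c u : ℕ)) e1)
      · exact h1.trans (congrArg Fin.val ((congrArg c e1).trans hc.symm))
  rw [Hyper.mono, hm, count_eq_ncard]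
  symm
  refine Set.ncard_congr (fun e _ => s(e.divNat, e.modNat)) ?_ ?_ ?_
  · intro e he
    obtain ⟨⟨h1, -⟩, h2⟩ := (key e).1 he
    refine ⟨h1, ?_⟩
    intro u hu v hv
    rcases Sym2.mem_iff.1 hu with rfl | rfl <;> rcases Sym2.mem_iff.1 hv with rfl | rfl <;>
      simp [h2]
  · intro e e' he he' hee
    have h1 := ((key e).1 he).1.2
    have h2 := ((key e').1 he').1.2
    -- Two increasing pairs with the same underlying edge cannot be swapped copies of each other.
    refine finProdFinEquiv.symm.injective (Prod.ext ?_ ?_) <;>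
      rcases Sym2.eq_iff.1 hee with ⟨h3, h4⟩ | ⟨h3, h4⟩
    · exact h3
    · rw [h3, h4] at h1
      exact absurd h1 h2.asymm
    · exact h4
    · rw [h3, h4] at h1
      exact absurd h1 h2.asymm
  · intro e he
    obtain ⟨he1, he2⟩ := he
    induction e using Sym2.ind with
    | _ u v =>
    have hc : c u = c v := he2 u (Sym2.mem_mk_left u v) v (Sym2.mem_mk_right u v)
    have hadj : I.graph.Adj u v := he1
    have hdm : ∀ a b : Fin I.n, (finProdFinEquiv (a, b)).divNat = a ∧
        (finProdFinEquiv (a, b)).modNat = b := fun a b =>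
      Prod.mk.inj (finProdFinEquiv.symm_apply_apply (a, b))
    rcases lt_or_gt_of_ne hadj.ne with hlt | hlt
    · refine ⟨finProdFinEquiv (u, v), (key _).2 ?_, ?_⟩
      · rw [(hdm u v).1, (hdm u v).2]
        exact ⟨⟨hadj, hlt⟩, hc⟩
      · rw [(hdm u v).1, (hdm u v).2]
    · refine ⟨finProdFinEquiv (v, u), (key _).2 ?_, ?_⟩
      · rw [(hdm v u).1, (hdm v u).2]
        exact ⟨⟨hadj.symm, hlt⟩, hc.symm⟩
      · rw [(hdm v u).1, (hdm v u).2, Sym2.eq_swap]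

/-! ### Running times -/

open Classical in
/-- A program that decides the existence of a coloring with many monochromatic hyperedges, together
with a time bound, solves the corresponding coloring problem. -/
theorem solvable_of_triple (H : HyperExpr) (hH : ∀ n, H.sizeFn n ≤ n * n)
    {val : ∀ I : Inst k, (Fin I.n → Fin k) → ℕ}
    (hval : ∀ (I : Inst k) (c : Fin I.n → Fin k) (χ : ℕ → ℕ), (∀ v : Fin I.n, χ v = c v) →
      val I c = (H.hyper I.word).mono χ)
    {P : Prog} {C T S : ℕ → ℕ} (hT : PolyBdd T) (hS : PolyBdd S) (hSz : ∀ z, z ≤ S z)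
    (hP : ∀ (w : ℕ → ℕ) (D z : ℕ), (H.hyper w).n ≤ z → (H.hyper w).m ≤ z * z →
      (∀ i, w i ≤ 2 ^ S z) → D ≤ 2 ^ S z → (∀ v < (H.hyper w).n, (H.hyper w).col v ≤ k) →
      Triple D P (St.start w) (C (H.hyper w).free * T (S z)) fun σ => σ.var 0 =
        if ∃ χ, (H.hyper w).IsColoring k χ ∧ H.thr w ≤ (H.hyper w).mono χ then 1 else 0)
    {b : ℝ} (hb : 1 ≤ b) (hC : ∀ N, (C N : ℝ) ≤ b ^ N) :
    SolvableInOStar Inst.encode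
      (fun I : Inst k => ∃ c, I.Extends c ∧ I.threshold ≤ (val I c : ℤ))
      fun I => b ^ I.uncolored := by
  have hpoly : PolyBdd fun z => (20 + 10 * z) + T (S z) :=
    ((PolyBdd.const 20).add ((PolyBdd.const 10).mul .id)).add (hT.comp hS)
  obtain ⟨p, hp⟩ := hpoly
  refine ⟨.seq header P, p, fun I => ?_⟩
  obtain ⟨t, st, hex, ht, hrep⟩ := I.exec_header
  have hn : (H.hyper I.word).n = I.n := I.word_zero
  have hz := hSz (inputSize I.encode)
  have hpow : 2 ^ inputSize I.encode ≤ 2 ^ S (inputSize I.encode) :=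
    Nat.pow_le_pow_right two_pos hz
  have hm : (H.hyper I.word).m ≤ inputSize I.encode * inputSize I.encode := by
    have h1 := hH (I.word 0)
    rw [I.word_zero] at h1
    exact (congrArg H.sizeFn I.word_zero).le.trans (h1.trans (Nat.mul_le_mul I.n_le I.n_le))
  obtain ⟨t', st', σ', hex', ht', hrep', hQ⟩ := hP I.word I.encode.length (inputSize I.encode)
    (hn ▸ I.n_le) hm (fun i => (I.word_le i).trans hpow)
    ((I.length_le.trans Nat.lt_two_pow_self.le).trans hpow) (I.col_le H) st hrep
  refine ⟨_, st', .seq hex hex', ?_, ?_⟩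
  · rw [show 0 = 2 * 0 from rfl, hrep'.var, hQ]
    have hiff := I.exists_extends_iff H (hval I)
    split_ifs with h1 h2 h2
    · rfl
    · exact absurd (hiff.2 h1) h2
    · exact absurd (hiff.1 h2) h1
    · rfl
  · rw [I.free_eq] at ht'
    -- The header takes only polynomial time; since `1 ≤ b`, its bound may be enlarged by the
    -- exponential factor.
    have h1 : ((t : ℕ) : ℝ) ≤ b ^ I.uncolored * (20 + 10 * inputSize I.encode : ℕ) :=
      (Nat.cast_le.2 ht).trans (le_mul_of_one_le_left (Nat.cast_nonneg _) (one_le_pow₀ hb))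
    have h2 : ((t' : ℕ) : ℝ) ≤ b ^ I.uncolored * (T (S (inputSize I.encode)) : ℕ) := by
      refine (Nat.cast_le.2 ht').trans ?_
      rw [Nat.cast_mul]
      exact mul_le_mul_of_nonneg_right (hC _) (Nat.cast_nonneg _)
    have h3 : (((20 + 10 * inputSize I.encode) + T (S (inputSize I.encode)) : ℕ) : ℝ) ≤
        (p.eval (inputSize I.encode) : ℕ) := Nat.cast_le.2 (hp _)
    calc ((t + t' : ℕ) : ℝ) ≤ b ^ I.uncolored *
          (((20 + 10 * inputSize I.encode) + T (S (inputSize I.encode)) : ℕ) : ℝ) := by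
          rw [Nat.cast_add, Nat.cast_add, mul_add]
          exact add_le_add h1 h2
      _ ≤ _ := mul_le_mul_of_nonneg_left h3 (by positivity)

theorem coverBd_mono {n n' m m' : ℕ} (hn : n ≤ n') (hm : m ≤ m') :
    coverBd k n m ≤ coverBd k n' m' := by
  unfold coverBd tableBd
  gcongr

/-- At most `z * z` hyperedges occur for an input of size `z`. The extra summand `z` ensures that
the parameter also bounds the lengths of the input words. -/
theorem polyBdd_coverBd : PolyBdd fun z => z + coverBd k z (z * z) := by
  have hsq : PolyBdd fun z => z * z := .mul .id .id
  have htab : PolyBdd fun z => tableBd k z (z * z) :=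
    PolyBdd.mul (((PolyBdd.const k).mul .id).add (.const 1))
      (hsq.add ((((PolyBdd.const k).mul hsq).add (.const 1)).mul .id))
  exact PolyBdd.id.add ((((((PolyBdd.const k).add .id).add hsq).add (.const 2)).add .id).add
    ((PolyBdd.const k).mul (.add .id htab)))

theorem rounds_mono {m m' : ℕ} (hm : m ≤ m') : rounds m ≤ rounds m' := by
  unfold rounds
  gcongr

theorem polyBdd_rounds : PolyBdd fun z => rounds (z * z) + z * z + z + 3 := by
  have hsq : PolyBdd fun z => z * z := .mul .id .id
  exact ((((((hsq.mul (hsq.add (.const 1))).add (.const 1)).mul (hsq.mul hsq)).add hsq).add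
    .id).add (.const 3))

theorem solvable_two_pow (hk : 0 < k) (H : HyperExpr) (hH : ∀ n, H.sizeFn n ≤ n * n)
    {val : ∀ I : Inst k, (Fin I.n → Fin k) → ℕ}
    (hval : ∀ (I : Inst k) (c : Fin I.n → Fin k) (χ : ℕ → ℕ), (∀ v : Fin I.n, χ v = c v) →
      val I c = (H.hyper I.word).mono χ) :
    SolvableInOStar Inst.encode
      (fun I : Inst k => ∃ c, I.Extends c ∧ I.threshold ≤ (val I c : ℤ))
      fun I => (2 : ℝ) ^ I.uncolored :=
  solvable_of_triple H hH hval (P := H.coverProg k) (C := fun N => 2 ^ N) polyBdd_coverTime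
    (polyBdd_coverBd (k := k)) (fun _ => Nat.le_add_right _ _)
    (fun w D z hn hm hw hD hcol => triple_coverProg hk hw hD
      ((coverBd_mono hn hm).trans (Nat.le_add_left _ _)) hcol)
    one_le_two fun N => by simp

theorem solvable_three (H : HyperExpr) (hH : ∀ n, H.sizeFn n ≤ n * n)
    {val : ∀ I : Inst 3, (Fin I.n → Fin 3) → ℕ}
    (hval : ∀ (I : Inst 3) (c : Fin I.n → Fin 3) (χ : ℕ → ℕ), (∀ v : Fin I.n, χ v = c v) →
      val I c = (H.hyper I.word).mono χ) :
    SolvableInOStar Inst.encode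
      (fun I : Inst 3 => ∃ c, I.Extends c ∧ I.threshold ≤ (val I c : ℤ))
      fun I => (1.89 : ℝ) ^ I.uncolored :=
  solvable_of_triple H hH hval (P := H.threeProg) (C := fun N => (smallSets N).card)
    polyBdd_threeTime polyBdd_rounds (fun z => by omega)
    (fun w D z hn hm hw hD hcol => triple_threeProg hw hD
      (by have := rounds_mono hm; omega) hcol)
    (by norm_num) card_smallSets_le

end HappyColoring

theorem mainTheorem5 :
    (∀ k : ℕ, 3 ≤ k →
      RAM.SolvableInOStar HappyColoring.Inst.encode (HappyColoring.MHE k)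
          (fun I => (2 : ℝ) ^ I.uncolored) ∧
        RAM.SolvableInOStar HappyColoring.Inst.encode (HappyColoring.MHV k)
          (fun I => (2 : ℝ) ^ I.uncolored)) ∧
    RAM.SolvableInOStar HappyColoring.Inst.encode (HappyColoring.MHE 3)
        (fun I => (1.89 : ℝ) ^ I.uncolored) ∧
      RAM.SolvableInOStar HappyColoring.Inst.encode (HappyColoring.MHV 3)
        (fun I => (1.89 : ℝ) ^ I.uncolored) := by
  have hE : ∀ n, HappyColoring.edgeHyper.sizeFn n ≤ n * n := fun n => le_rfl
  have hV : ∀ n, HappyColoring.vertexHyper.sizeFn n ≤ n * n := Nat.le_mul_self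
  exact ⟨fun k hk => ⟨
    HappyColoring.solvable_two_pow (by omega) _ hE HappyColoring.happyEdges_eq_mono,
    HappyColoring.solvable_two_pow (by omega) _ hV HappyColoring.happyVertices_eq_mono⟩,
    HappyColoring.solvable_three _ hE HappyColoring.happyEdges_eq_mono,
    HappyColoring.solvable_three _ hV HappyColoring.happyVertices_eq_mono⟩
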